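/- For all reals $1\le p<\infty$ and for $p=\infty$, define the $\ell_{p,2}$-distance of two curves $P=(p_1,\dots,p_{a})$ and $Q=(q_1,\dots,q_{b})$ in $\mathbb R^d$ by $d_{p,2}(P,Q)=\min_\tau\bigl(\sum_{(i,j)\in\tau}\|p_i-q_j\|_2^p\bigr)^{1/p}$ (a maximum over $\tau$ instead of the sum if $p=\infty$), where $\tau$ ranges over all alignments, i.e. sequences of index pairs from $(1,1)$ to $(a,b)$ in which each step increases the first index, the second index, or both by $1$. There is a deterministic data structure for the $(1+\varepsilon,r)$-approximate near-neighbor problem for curves under the $\ell_{p,2}$-distance with $n\cdot O(1/\varepsilon)^{m(d+1)}$ space, $n\cdot(1+\log(n/\varepsilon))\cdot O(1/\varepsilon)^{m(d+1)}$ preprocessing time and $O\bigl(md\,(1+\log(nmd/\varepsilon))\bigr)$ query time. Precisely: there are two deterministic programs (preprocessing and query) and a constant $A>0$ such that for all $1\le p\le\infty$, all integers $n,m,d\ge1$, all $0<\varepsilon\le1$ and $r>0$, and all curves $C_1,\dots,C_n$ with $m$ vertices in $\mathbb R^d$, the following holds. Given $n,m,d,\varepsilon,r,p$ and the curves $C_1,\dots,C_n$,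 the preprocessing halts after at most $n\,(1+\log(n/\varepsilon))\,(A/\varepsilon)^{m(d+1)}$ steps, and both programs use a memory of $S\le n\,(A/\varepsilon)^{m(d+1)}$ integer cells and as many real cells. Afterwards, for every query curve $Q$ with $m$ vertices in $\mathbb R^d$, the query program, which has access to the memory left by the preprocessing and to $Q$ only, halts after at most $A\,md\,(1+\log(nmd/\varepsilon))$ steps with the memory unchanged, and if some $C_i$ satisfies $d_{p,2}(Q,C_i)\le r$, it returns an index $j$ with $d_{p,2}(Q,C_j)\le(1+\varepsilon)r$. The model of computation is the deterministic real RAM with indirect addressing: a finite program works on a fixed number of integer and real registers, on memory cells holding integers or reals, and on a read-only input (not counted as memory); integer arithmetic, real arithmetic, powers $|x|^y$, the floor function, comparisons and accesses to memory or input take unit time. -/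

import Mathlib

open scoped ENNReal

namespace ANNC

/-! ## Curves, alignments and the distances -/

/-- A curve with `m` vertices in `d`-dimensional Euclidean space. -/
abbrev Curve (m d : ℕ) : Type := Fin m → EuclideanSpace ℝ (Fin d)

/-- The admissible steps of an alignment: the first index, the second index, or both advance by
one. -/
def AlignStep {a b : ℕ} (x y : Fin a × Fin b) : Prop :=
  ((y.1 : ℕ) = x.1 + 1 ∧ (y.2 : ℕ) = x.2) ∨
  ((y.1 : ℕ) = x.1 ∧ (y.2 : ℕ) = x.2 + 1) ∨
  ((y.1 : ℕ) = x.1 + 1 ∧ (y.2 : ℕ) = x.2 + 1)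

/-- Alignments of a curve with `a` vertices and a curve with `b` vertices (vertices are numbered
from `0`): sequences of index pairs that lead from the pair of first vertices to the pair of last
vertices by admissible steps. -/
structure IsAlignment {a b : ℕ} (τ : List (Fin a × Fin b)) : Prop where
  nonempty : τ ≠ []
  head : ∀ x ∈ τ.head?, (x.1 : ℕ) = 0 ∧ (x.2 : ℕ) = 0
  last : ∀ x ∈ τ.getLast?, (x.1 : ℕ) + 1 = a ∧ (x.2 : ℕ) + 1 = b
  step : τ.IsChain AlignStep

/-- The `ℓ_{p,2}`-cost of an alignment: the `ℓ_p`-norm of the sequence of the Euclidean distances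
of the matched pairs of vertices (the maximum of these distances if `p = ∞`). -/
noncomputable def lpCost (p : ℝ≥0∞) {a b d : ℕ} (P : Curve a d) (Q : Curve b d)
    (τ : List (Fin a × Fin b)) : ℝ :=
  if p = ∞ then (τ.map fun x => ‖P x.1 - Q x.2‖).foldr max 0
  else (τ.map fun x => ‖P x.1 - Q x.2‖ ^ p.toReal).sum ^ (1 / p.toReal)

/-- The `ℓ_{p,2}`-distance of two curves: the least cost of an alignment. -/
noncomputable def lpDist (p : ℝ≥0∞) {a b d : ℕ} (P : Curve a d) (Q : Curve b d) : ℝ :=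
  sInf {c : ℝ | ∃ τ : List (Fin a × Fin b), IsAlignment τ ∧ c = lpCost p P Q τ}

/-! ## A deterministic real RAM

A fixed finite program works on finitely many integer and real registers, on two banks of memory
(one of integer cells, one of real cells), both addressed indirectly and both of the same finite
size, and on a read-only input. Every arithmetic operation, comparison, memory access and input
access takes one unit of time. -/

/-- The state of the machine. The input is an array of real numbers with three indices: the number
of the curve, of the vertex and of the coordinate, all counted from `0`. -/
structure State where
  ireg : ℕ → ℤ
  rreg : ℕ → ℝ
  imem : ℤ → ℤ
  rmem : ℤ → ℝ
  inp : ℤ → ℤ → ℤ → ℝ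

/-- Integer expressions over the registers; `div` is integer division. -/
inductive IExpr : Type
  | const (z : ℤ)
  | reg (i : ℕ)
  | add (e f : IExpr)
  | sub (e f : IExpr)
  | mul (e f : IExpr)
  | div (e f : IExpr)

/-- Real expressions over the registers. The only constants are integers. -/
inductive RExpr : Type
  | ofInt (e : IExpr)
  | reg (i : ℕ)
  | add (e f : RExpr)
  | sub (e f : RExpr)
  | mul (e f : RExpr)
  | div (e f : RExpr)
  | pow (e f : RExpr)

/-- Conditions: comparisons and their Boolean combinations. -/
inductive Test : Type
  | ile (e f : IExpr)
  | rle (e f : RExpr)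
  | neg (b : Test)
  | conj (b c : Test)

/-- The value of an integer expression. -/
def IExpr.eval (s : State) : IExpr → ℤ
  | const z => z
  | reg i => s.ireg i
  | add e f => e.eval s + f.eval s
  | sub e f => e.eval s - f.eval s
  | mul e f => e.eval s * f.eval s
  | div e f => e.eval s / f.eval s

/-- The value of a real expression. A quotient by `0` is `0`; a power is taken of the absolute
value of its base. -/
noncomputable def RExpr.eval (s : State) : RExpr → ℝ
  | ofInt e => (e.eval s : ℝ)
  | reg i => s.rreg i
  | add e f => e.eval s + f.eval s
  | sub e f => e.eval s - f.eval s
  | mul e f => e.eval s * f.eval s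
  | div e f => e.eval s / f.eval s
  | pow e f => |e.eval s| ^ (f.eval s)

/-- The truth of a condition. -/
def Test.Holds (s : State) : Test → Prop
  | ile e f => e.eval s ≤ f.eval s
  | rle e f => e.eval s ≤ f.eval s
  | neg b => ¬ b.Holds s
  | conj b c => b.Holds s ∧ c.Holds s

/-- The number of unit-time steps of the evaluation: the number of nodes of the expression. -/
def IExpr.cost : IExpr → ℕ
  | const _ => 1
  | reg _ => 1
  | add e f => e.cost + f.cost + 1
  | sub e f => e.cost + f.cost + 1
  | mul e f => e.cost + f.cost + 1
  | div e f => e.cost + f.cost + 1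

/-- The number of unit-time steps of the evaluation: the number of nodes of the expression. -/
def RExpr.cost : RExpr → ℕ
  | ofInt e => e.cost + 1
  | reg _ => 1
  | add e f => e.cost + f.cost + 1
  | sub e f => e.cost + f.cost + 1
  | mul e f => e.cost + f.cost + 1
  | div e f => e.cost + f.cost + 1
  | pow e f => e.cost + f.cost + 1

/-- The number of unit-time steps of the evaluation: the number of nodes of the condition. -/
def Test.cost : Test → ℕ
  | ile e f => e.cost + f.cost + 1
  | rle e f => e.cost + f.cost + 1
  | neg b => b.cost + 1
  | conj b c => b.cost + c.cost + 1

/-- Programs. The names of the target registers come first. -/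
inductive Prog : Type
  | skip
  /-- integer register `i` := `e` -/
  | iset (i : ℕ) (e : IExpr)
  /-- real register `i` := `e` -/
  | rset (i : ℕ) (e : RExpr)
  /-- integer register `i` := the greatest integer that is at most `e` -/
  | floor (i : ℕ) (e : RExpr)
  /-- integer register `i` := the integer cell with address `a` -/
  | iload (i : ℕ) (a : IExpr)
  /-- real register `i` := the real cell with address `a` -/
  | rload (i : ℕ) (a : IExpr)
  /-- the integer cell with address `a` := `e` -/
  | istore (a e : IExpr)
  /-- the real cell with address `a` := `e` -/
  | rstore (a : IExpr) (e : RExpr)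
  /-- real register `i` := coordinate `j` of vertex `k` of curve `c` of the input -/
  | read (i : ℕ) (c k j : IExpr)
  | seq (c₁ c₂ : Prog)
  | cond (b : Test) (c₁ c₂ : Prog)
  | loop (b : Test) (c : Prog)

/-- `Exec S c s t s'`: on a machine whose two memory banks have `S` cells each (with the addresses
`0, …, S - 1`), program `c` started in state `s` halts after `t` steps in state `s'`. An access to
any other address blocks the machine. -/
inductive Exec (S : ℕ) : Prog → State → ℕ → State → Prop
  | skip (s : State) : Exec S .skip s 1 s
  | iset (s : State) (i : ℕ) (e : IExpr) :
      Exec S (.iset i e) s (e.cost + 1) { s with ireg := Function.update s.ireg i (e.eval s) }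
  | rset (s : State) (i : ℕ) (e : RExpr) :
      Exec S (.rset i e) s (e.cost + 1) { s with rreg := Function.update s.rreg i (e.eval s) }
  | floor (s : State) (i : ℕ) (e : RExpr) :
      Exec S (.floor i e) s (e.cost + 1) { s with ireg := Function.update s.ireg i ⌊e.eval s⌋ }
  | iload (s : State) (i : ℕ) (a : IExpr) (h₀ : 0 ≤ a.eval s) (h₁ : a.eval s < S) :
      Exec S (.iload i a) s (a.cost + 1)
        { s with ireg := Function.update s.ireg i (s.imem (a.eval s)) }
  | rload (s : State) (i : ℕ) (a : IExpr) (h₀ : 0 ≤ a.eval s) (h₁ : a.eval s < S) :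
      Exec S (.rload i a) s (a.cost + 1)
        { s with rreg := Function.update s.rreg i (s.rmem (a.eval s)) }
  | istore (s : State) (a e : IExpr) (h₀ : 0 ≤ a.eval s) (h₁ : a.eval s < S) :
      Exec S (.istore a e) s (a.cost + e.cost + 1)
        { s with imem := Function.update s.imem (a.eval s) (e.eval s) }
  | rstore (s : State) (a : IExpr) (e : RExpr) (h₀ : 0 ≤ a.eval s) (h₁ : a.eval s < S) :
      Exec S (.rstore a e) s (a.cost + e.cost + 1)
        { s with rmem := Function.update s.rmem (a.eval s) (e.eval s) }
  | read (s : State) (i : ℕ) (c k j : IExpr) :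
      Exec S (.read i c k j) s (c.cost + k.cost + j.cost + 1)
        { s with rreg := Function.update s.rreg i (s.inp (c.eval s) (k.eval s) (j.eval s)) }
  | seq {c₁ c₂ : Prog} {s s' s'' : State} {t₁ t₂ : ℕ}
      (h₁ : Exec S c₁ s t₁ s') (h₂ : Exec S c₂ s' t₂ s'') :
      Exec S (.seq c₁ c₂) s (t₁ + t₂) s''
  | condTrue {b : Test} {c₁ : Prog} (c₂ : Prog) {s s' : State} {t : ℕ}
      (hb : b.Holds s) (h : Exec S c₁ s t s') :
      Exec S (.cond b c₁ c₂) s (b.cost + t) s'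
  | condFalse {b : Test} (c₁ : Prog) {c₂ : Prog} {s s' : State} {t : ℕ}
      (hb : ¬ b.Holds s) (h : Exec S c₂ s t s') :
      Exec S (.cond b c₁ c₂) s (b.cost + t) s'
  | loopDone {b : Test} (c : Prog) {s : State} (hb : ¬ b.Holds s) :
      Exec S (.loop b c) s b.cost s
  | loopStep {b : Test} {c : Prog} {s s' s'' : State} {t₁ t₂ : ℕ}
      (hb : b.Holds s) (h₁ : Exec S c s t₁ s') (h₂ : Exec S (.loop b c) s' t₂ s'') :
      Exec S (.loop b c) s (b.cost + t₁ + t₂) s''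

/-- The machine is deterministic: the running time and the final state are determined by the
program and the initial state. -/
theorem Exec.unique {S : ℕ} {c : Prog} {s s₁ s₂ : State} {t₁ t₂ : ℕ}
    (h₁ : Exec S c s t₁ s₁) (h₂ : Exec S c s t₂ s₂) : t₁ = t₂ ∧ s₁ = s₂ := by
  induction h₁ generalizing t₂ s₂ with
  | seq _ _ ih₁ ih₂ =>
    cases h₂ with
    | seq k₁ k₂ =>
      obtain ⟨rfl, rfl⟩ := ih₁ k₁
      obtain ⟨rfl, rfl⟩ := ih₂ k₂
      exact ⟨rfl, rfl⟩
  | condTrue _ hb _ ih =>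
    cases h₂ with
    | condTrue _ _ k =>
      obtain ⟨rfl, rfl⟩ := ih k
      exact ⟨rfl, rfl⟩
    | condFalse _ hb' _ => exact absurd hb hb'
  | condFalse _ hb _ ih =>
    cases h₂ with
    | condTrue _ hb' _ => exact absurd hb' hb
    | condFalse _ _ k =>
      obtain ⟨rfl, rfl⟩ := ih k
      exact ⟨rfl, rfl⟩
  | loopDone _ hb =>
    cases h₂ with
    | loopDone _ _ => exact ⟨rfl, rfl⟩
    | loopStep hb' _ _ => exact absurd hb' hb
  | loopStep hb _ _ ih₁ ih₂ =>
    cases h₂ with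
    | loopDone _ hb' => exact absurd hb hb'
    | loopStep _ k₁ k₂ =>
      obtain ⟨rfl, rfl⟩ := ih₁ k₁
      obtain ⟨rfl, rfl⟩ := ih₂ k₂
      exact ⟨rfl, rfl⟩
  | _ => cases h₂; exact ⟨rfl, rfl⟩

/-! ## The near-neighbor problem on this machine -/

/-- A sequence of `n` curves as input of the machine. -/
def input {n m d : ℕ} (C : Fin n → Curve m d) (i k j : ℤ) : ℝ :=
  if h : (0 ≤ i ∧ i < n) ∧ (0 ≤ k ∧ k < m) ∧ (0 ≤ j ∧ j < d) then
    C ⟨i.toNat, by omega⟩ ⟨k.toNat, by omega⟩ ⟨j.toNat, by omega⟩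
  else 0

/-- The state in which the preprocessing starts: the integer registers hold `n`, `m`, `d`, the real
registers hold `ε`, `r`, `p` (with `0` for `p = ∞`), the memory is empty, and the input consists of
the given curves. -/
noncomputable def initState (p : ℝ≥0∞) {n m d : ℕ} (ε r : ℝ) (C : Fin n → Curve m d) : State where
  ireg := fun i => if i = 0 then n else if i = 1 then m else if i = 2 then d else 0
  rreg := fun i => if i = 0 then ε else if i = 1 then r else if i = 2 then p.toReal else 0
  imem := fun _ => 0
  rmem := fun _ => 0
  inp := input C

/-- The state in which a query starts: the registers are cleared, the memory, which holds the data
structure, is as the preprocessing has left it in state `s`, and the input consists of the query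
curve alone. -/
noncomputable def queryState {m d : ℕ} (s : State) (Q : Curve m d) : State where
  ireg := fun _ => 0
  rreg := fun _ => 0
  imem := s.imem
  rmem := s.rmem
  inp := input fun _ : Fin 1 => Q

/-- The output `z` of a query is correct: if some input curve lies within distance `r` of the query
curve, then `z` is the index of an input curve within distance `(1 + ε) r` of the query curve. -/
def CorrectAnswer (p : ℝ≥0∞) {n m d : ℕ} (ε r : ℝ) (C : Fin n → Curve m d) (Q : Curve m d)
    (z : ℤ) : Prop :=
  (∃ i, lpDist p Q (C i) ≤ r) → ∃ j : Fin n, z = (j : ℤ) ∧ lpDist p Q (C j) ≤ (1 + ε) * r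

end ANNC

/-! # A data structure for approximate near neighbors of curves under the `ℓ_{p,2}`-distance -/

/-! A query curve is rounded to a grid, and the dictionary contains every rounded curve that can
come from a query near some input curve. The coarse grid has side `D = r / ((2m)^(1/p) √d)`, the
fine one has side `δ = D / M` with `M` the least power of two that is at least `2 / ε`. Rounding to
the fine grid moves a vertex by at most `√d δ`, and an alignment has at most `2m` pairs, so by
Minkowski's inequality the cost of every alignment changes by at most `r / M ≤ ε r / 2`
(`lpCost_le_add`, `Par.Good.δ_le`). One half of the tolerance `ε r` thus pays for passing from the
query to its rounding, the other half for passing back (`lpDist_le_of_gridCurve`).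

The dictionary is enumerated through codes. A code is a number that describes an input curve `C_i`,
an alignment and the fine coordinates of the curve aligned with `C_i`. A vertex is decoded when the
alignment first meets it, relative to the vertex of `C_i` it is then matched with: each coordinate
consists of a position inside its coarse cell (`M` possibilities) and of a coarse displacement
written in unary with base-4 digits. By the power mean inequality the distances along an alignment
of cost at most `r` sum up to at most `(2m)^(1-1/p) r`. With the above `D`, all displacements and
all steps of the alignment together therefore need at most `8md` base-4 digits (`weight_sum_le`,
`exists_path`). Hence `N = n' (4^8 M)^(md)` codes suffice, where `n' ≤ 2n` and `M ≤ 4 / ε`.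

The preprocessing decodes every number below `N`, recomputes the cost of the alignment found, stores
`key * n' + i` if the curve lies within the digit range of the keys and the cost is at most `(1 +
ε/2) r`, and stores `-1` otherwise. As each entry is verified, nothing has to be known about
arbitrary codes (`codeEntry_sound`); it only matters that every near query has a code
(`codeEntry_complete`). After sorting, binary search finds the last entry that is at most `key * n'
+ (n' - 1)` for the key of the rounded query; if some input curve is near, this entry carries the
right key and a valid index (`search_correct`).

Here `log N = O(md (1 + log (n/ε)))`, which bounds the search time, and the preprocessing spends
`O(md log N)` steps per code, a factor whose part `(md)^2` disappears in the base of the exponential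
(`pow_absorb`). The programs are verified by computing running time and final state together. -/

namespace ANNC

/-! ## A program logic with running times -/

/-- The integer register `i` as an expression. -/
def V (i : ℕ) : IExpr := .reg i

/-- An integer constant as an expression. -/
def lit (z : ℤ) : IExpr := .const z

/-- The real register `i` as an expression. -/
def F (i : ℕ) : RExpr := .reg i

/-- An integer expression as a real expression. -/
def toR (e : IExpr) : RExpr := .ofInt e

instance : Add IExpr := ⟨.add⟩
instance : Sub IExpr := ⟨.sub⟩
instance : Mul IExpr := ⟨.mul⟩
instance : Div IExpr := ⟨.div⟩
instance : Add RExpr := ⟨.add⟩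
instance : Sub RExpr := ⟨.sub⟩
instance : Mul RExpr := ⟨.mul⟩
instance : Div RExpr := ⟨.div⟩

/-- The test `e < f`. -/
def lt (e f : IExpr) : Test := .neg (.ile f e)

infixr:35 " ;; " => Prog.seq

/-! ### Evaluation and cost of expressions -/

section eval
variable (s : State) (e f : IExpr) (x y : RExpr) (i : ℕ) (z : ℤ)

@[simp] theorem eval_V : (V i).eval s = s.ireg i := rfl
@[simp] theorem eval_lit : (lit z).eval s = z := rfl
@[simp] theorem eval_add : (e + f).eval s = e.eval s + f.eval s := rfl
@[simp] theorem eval_sub : (e - f).eval s = e.eval s - f.eval s := rfl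
@[simp] theorem eval_mul : (e * f).eval s = e.eval s * f.eval s := rfl
@[simp] theorem eval_div : (e / f).eval s = e.eval s / f.eval s := rfl
@[simp] theorem cost_V : (V i).cost = 1 := rfl
@[simp] theorem cost_lit : (lit z).cost = 1 := rfl
@[simp] theorem cost_add : (e + f).cost = e.cost + f.cost + 1 := rfl
@[simp] theorem cost_sub : (e - f).cost = e.cost + f.cost + 1 := rfl
@[simp] theorem cost_mul : (e * f).cost = e.cost + f.cost + 1 := rfl
@[simp] theorem cost_div : (e / f).cost = e.cost + f.cost + 1 := rfl
@[simp] theorem eval_F : (F i).eval s = s.rreg i := rfl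
@[simp] theorem eval_toR : (toR e).eval s = (e.eval s : ℝ) := rfl
@[simp] theorem reval_add : (x + y).eval s = x.eval s + y.eval s := rfl
@[simp] theorem reval_sub : (x - y).eval s = x.eval s - y.eval s := rfl
@[simp] theorem reval_mul : (x * y).eval s = x.eval s * y.eval s := rfl
@[simp] theorem reval_div : (x / y).eval s = x.eval s / y.eval s := rfl
@[simp] theorem reval_pow : (RExpr.pow x y).eval s = |x.eval s| ^ (y.eval s) := rfl
@[simp] theorem cost_F : (F i).cost = 1 := rfl
@[simp] theorem cost_toR : (toR e).cost = e.cost + 1 := rfl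
@[simp] theorem rcost_add : (x + y).cost = x.cost + y.cost + 1 := rfl
@[simp] theorem rcost_sub : (x - y).cost = x.cost + y.cost + 1 := rfl
@[simp] theorem rcost_mul : (x * y).cost = x.cost + y.cost + 1 := rfl
@[simp] theorem rcost_div : (x / y).cost = x.cost + y.cost + 1 := rfl
@[simp] theorem rcost_pow : (RExpr.pow x y).cost = x.cost + y.cost + 1 := rfl
@[simp] theorem holds_lt : (lt e f).Holds s ↔ e.eval s < f.eval s := not_le
@[simp] theorem holds_ile : (Test.ile e f).Holds s ↔ e.eval s ≤ f.eval s := Iff.rfl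
@[simp] theorem holds_rle : (Test.rle x y).Holds s ↔ x.eval s ≤ y.eval s := Iff.rfl
@[simp] theorem holds_neg (b : Test) : (Test.neg b).Holds s ↔ ¬ b.Holds s := Iff.rfl
@[simp] theorem holds_conj (b c : Test) : (Test.conj b c).Holds s ↔ b.Holds s ∧ c.Holds s :=
  Iff.rfl
@[simp] theorem cost_lt : (lt e f).cost = e.cost + f.cost + 2 := by
  simp [lt, Test.cost]; omega
@[simp] theorem cost_ile : (Test.ile e f).cost = e.cost + f.cost + 1 := rfl
@[simp] theorem cost_rle : (Test.rle x y).cost = x.cost + y.cost + 1 := rfl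
@[simp] theorem cost_neg (b : Test) : (Test.neg b).cost = b.cost + 1 := rfl
@[simp] theorem cost_conj (b c : Test) : (Test.conj b c).cost = b.cost + c.cost + 1 := rfl

end eval

/-- The program `c` started in `s` halts, and its running time and final state satisfy `Q`. -/
def Run (S : ℕ) (c : Prog) (s : State) (Q : ℕ → State → Prop) : Prop :=
  ∃ t s', Exec S c s t s' ∧ Q t s'

/-! ### Exact rules for the program constructs -/

section rules
variable {S : ℕ} {s : State} {Q : ℕ → State → Prop}

theorem Run.mono {c : Prog} {Q' : ℕ → State → Prop} (h : Run S c s Q)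
    (hQ : ∀ t s', Q t s' → Q' t s') : Run S c s Q' := by
  obtain ⟨t, s', h, hq⟩ := h
  exact ⟨t, s', h, hQ _ _ hq⟩

/-- Stated as equivalences, this rule and its companions let `simp only` replace straight-line code
by its final state and exact step count; valid addresses are the only side conditions. -/
theorem run_skip : Run S .skip s Q ↔ Q 1 s :=
  ⟨by rintro ⟨_, _, h, hq⟩; cases h; exact hq, fun h => ⟨_, _, .skip s, h⟩⟩

theorem run_iset {i : ℕ} {e : IExpr} : Run S (.iset i e) s Q ↔
    Q (e.cost + 1) { s with ireg := Function.update s.ireg i (e.eval s) } :=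
  ⟨by rintro ⟨_, _, h, hq⟩; cases h; exact hq, fun h => ⟨_, _, .iset s i e, h⟩⟩

theorem run_rset {i : ℕ} {e : RExpr} : Run S (.rset i e) s Q ↔
    Q (e.cost + 1) { s with rreg := Function.update s.rreg i (e.eval s) } :=
  ⟨by rintro ⟨_, _, h, hq⟩; cases h; exact hq, fun h => ⟨_, _, .rset s i e, h⟩⟩

theorem run_floor {i : ℕ} {e : RExpr} : Run S (.floor i e) s Q ↔
    Q (e.cost + 1) { s with ireg := Function.update s.ireg i ⌊e.eval s⌋ } :=
  ⟨by rintro ⟨_, _, h, hq⟩; cases h; exact hq, fun h => ⟨_, _, .floor s i e, h⟩⟩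

theorem run_iload {i : ℕ} {a : IExpr} : Run S (.iload i a) s Q ↔
    (0 ≤ a.eval s ∧ a.eval s < S) ∧
    Q (a.cost + 1) { s with ireg := Function.update s.ireg i (s.imem (a.eval s)) } :=
  ⟨by rintro ⟨_, _, h, hq⟩; cases h; exact ⟨⟨‹_›, ‹_›⟩, hq⟩,
    fun h => ⟨_, _, .iload s i a h.1.1 h.1.2, h.2⟩⟩

theorem run_rload {i : ℕ} {a : IExpr} : Run S (.rload i a) s Q ↔
    (0 ≤ a.eval s ∧ a.eval s < S) ∧
    Q (a.cost + 1) { s with rreg := Function.update s.rreg i (s.rmem (a.eval s)) } :=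
  ⟨by rintro ⟨_, _, h, hq⟩; cases h; exact ⟨⟨‹_›, ‹_›⟩, hq⟩,
    fun h => ⟨_, _, .rload s i a h.1.1 h.1.2, h.2⟩⟩

theorem run_istore {a e : IExpr} : Run S (.istore a e) s Q ↔
    (0 ≤ a.eval s ∧ a.eval s < S) ∧
    Q (a.cost + e.cost + 1) { s with imem := Function.update s.imem (a.eval s) (e.eval s) } :=
  ⟨by rintro ⟨_, _, h, hq⟩; cases h; exact ⟨⟨‹_›, ‹_›⟩, hq⟩,
    fun h => ⟨_, _, .istore s a e h.1.1 h.1.2, h.2⟩⟩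

theorem run_rstore {a : IExpr} {e : RExpr} : Run S (.rstore a e) s Q ↔
    (0 ≤ a.eval s ∧ a.eval s < S) ∧
    Q (a.cost + e.cost + 1) { s with rmem := Function.update s.rmem (a.eval s) (e.eval s) } :=
  ⟨by rintro ⟨_, _, h, hq⟩; cases h; exact ⟨⟨‹_›, ‹_›⟩, hq⟩,
    fun h => ⟨_, _, .rstore s a e h.1.1 h.1.2, h.2⟩⟩

theorem run_read {i : ℕ} {c k j : IExpr} : Run S (.read i c k j) s Q ↔
    Q (c.cost + k.cost + j.cost + 1)
      { s with rreg := Function.update s.rreg i (s.inp (c.eval s) (k.eval s) (j.eval s)) } :=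
  ⟨by rintro ⟨_, _, h, hq⟩; cases h; exact hq, fun h => ⟨_, _, .read s i c k j, h⟩⟩

theorem run_seq {c₁ c₂ : Prog} : Run S (c₁ ;; c₂) s Q ↔
    Run S c₁ s fun t₁ s₁ => Run S c₂ s₁ fun t₂ s₂ => Q (t₁ + t₂) s₂ :=
  ⟨by rintro ⟨_, _, h, hq⟩; cases h with | seq h₁ h₂ => exact ⟨_, _, h₁, _, _, h₂, hq⟩,
    by rintro ⟨_, _, h₁, _, _, h₂, hq⟩; exact ⟨_, _, h₁.seq h₂, hq⟩⟩

theorem run_cond {b : Test} {c₁ c₂ : Prog} : Run S (.cond b c₁ c₂) s Q ↔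
    (b.Holds s → Run S c₁ s fun t s' => Q (b.cost + t) s') ∧
    (¬ b.Holds s → Run S c₂ s fun t s' => Q (b.cost + t) s') := by
  constructor
  · rintro ⟨_, _, h, hq⟩
    cases h with
    | condTrue _ hb h => exact ⟨fun _ => ⟨_, _, h, hq⟩, fun h' => absurd hb h'⟩
    | condFalse _ hb h => exact ⟨fun h' => absurd h' hb, fun _ => ⟨_, _, h, hq⟩⟩
  · rintro ⟨h₁, h₂⟩
    by_cases hb : b.Holds s
    · obtain ⟨_, _, h, hq⟩ := h₁ hb
      exact ⟨_, _, .condTrue _ hb h, hq⟩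
    · obtain ⟨_, _, h, hq⟩ := h₂ hb
      exact ⟨_, _, .condFalse _ hb h, hq⟩

end rules

/-- The integer registers that a program may change. -/
def Prog.wi : Prog → List ℕ
  | iset i _ => [i]
  | floor i _ => [i]
  | iload i _ => [i]
  | seq c₁ c₂ => c₁.wi ++ c₂.wi
  | cond _ c₁ c₂ => c₁.wi ++ c₂.wi
  | loop _ c => c.wi
  | _ => []

/-- The real registers that a program may change. -/
def Prog.wr : Prog → List ℕ
  | rset i _ => [i]
  | rload i _ => [i]
  | read i _ _ _ => [i]
  | seq c₁ c₂ => c₁.wr ++ c₂.wr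
  | cond _ c₁ c₂ => c₁.wr ++ c₂.wr
  | loop _ c => c.wr
  | _ => []

/-- Whether a program may store integers. -/
def Prog.storesI : Prog → Bool
  | istore _ _ => true
  | seq c₁ c₂ => c₁.storesI || c₂.storesI
  | cond _ c₁ c₂ => c₁.storesI || c₂.storesI
  | loop _ c => c.storesI
  | _ => false

/-- Whether a program may store real numbers. -/
def Prog.storesR : Prog → Bool
  | rstore _ _ => true
  | seq c₁ c₂ => c₁.storesR || c₂.storesR
  | cond _ c₁ c₂ => c₁.storesR || c₂.storesR
  | loop _ c => c.storesR
  | _ => false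

/-- What the text of a program guarantees to remain unchanged. -/
structure Frame (c : Prog) (s s' : State) : Prop where
  ireg : ∀ i, i ∉ c.wi → s'.ireg i = s.ireg i
  rreg : ∀ i, i ∉ c.wr → s'.rreg i = s.rreg i
  inp : s'.inp = s.inp
  imem : c.storesI = false → s'.imem = s.imem
  rmem : c.storesR = false → s'.rmem = s.rmem

/-- The sets of written registers are read off the program text, so `decide` settles each
preservation claim, and loop invariants need to mention only what changes. -/
theorem Exec.frame {S : ℕ} {c : Prog} {s s' : State} {t : ℕ} (h : Exec S c s t s') :
    Frame c s s' := by
  induction h with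
  | seq _ _ h₁ h₂ =>
    constructor
    · intro i hi
      simp only [Prog.wi, List.mem_append, not_or] at hi
      rw [h₂.ireg i hi.2, h₁.ireg i hi.1]
    · intro i hi
      simp only [Prog.wr, List.mem_append, not_or] at hi
      rw [h₂.rreg i hi.2, h₁.rreg i hi.1]
    · rw [h₂.inp, h₁.inp]
    · intro hi
      simp only [Prog.storesI, Bool.or_eq_false_iff] at hi
      rw [h₂.imem hi.2, h₁.imem hi.1]
    · intro hi
      simp only [Prog.storesR, Bool.or_eq_false_iff] at hi
      rw [h₂.rmem hi.2, h₁.rmem hi.1]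
  | condTrue _ _ _ h =>
    constructor
    · intro i hi
      simp only [Prog.wi, List.mem_append, not_or] at hi
      exact h.ireg i hi.1
    · intro i hi
      simp only [Prog.wr, List.mem_append, not_or] at hi
      exact h.rreg i hi.1
    · exact h.inp
    · intro hi
      simp only [Prog.storesI, Bool.or_eq_false_iff] at hi
      exact h.imem hi.1
    · intro hi
      simp only [Prog.storesR, Bool.or_eq_false_iff] at hi
      exact h.rmem hi.1
  | condFalse _ _ _ h =>
    constructor
    · intro i hi
      simp only [Prog.wi, List.mem_append, not_or] at hi
      exact h.ireg i hi.2
    · intro i hi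
      simp only [Prog.wr, List.mem_append, not_or] at hi
      exact h.rreg i hi.2
    · exact h.inp
    · intro hi
      simp only [Prog.storesI, Bool.or_eq_false_iff] at hi
      exact h.imem hi.2
    · intro hi
      simp only [Prog.storesR, Bool.or_eq_false_iff] at hi
      exact h.rmem hi.2
  | loopStep _ _ _ h₁ h₂ =>
    exact ⟨fun i hi => (h₂.ireg i hi).trans (h₁.ireg i hi),
      fun i hi => (h₂.rreg i hi).trans (h₁.rreg i hi), h₂.inp.trans h₁.inp,
      fun hi => (h₂.imem hi).trans (h₁.imem hi), fun hi => (h₂.rmem hi).trans (h₁.rmem hi)⟩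
  | _ =>
    constructor <;>
      simp +contextual [Prog.wi, Prog.wr, Prog.storesI, Prog.storesR, Function.update_of_ne]

theorem Run.frame {S : ℕ} {c : Prog} {s : State} {Q : ℕ → State → Prop} (h : Run S c s Q) :
    Run S c s fun t s' => Q t s' ∧ Frame c s s' := by
  obtain ⟨t, s', h, hq⟩ := h
  exact ⟨t, s', h, hq, h.frame⟩

theorem Frame.refl (c : Prog) (s : State) : Frame c s s :=
  ⟨fun _ _ => rfl, fun _ _ => rfl, rfl, fun _ => rfl, fun _ => rfl⟩

theorem Frame.trans {c : Prog} {s₁ s₂ s₃ : State} (h₁ : Frame c s₁ s₂) (h₂ : Frame c s₂ s₃) :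
    Frame c s₁ s₃ :=
  ⟨fun i hi => (h₂.ireg i hi).trans (h₁.ireg i hi),
    fun i hi => (h₂.rreg i hi).trans (h₁.rreg i hi), h₂.inp.trans h₁.inp,
    fun hi => (h₂.imem hi).trans (h₁.imem hi), fun hi => (h₂.rmem hi).trans (h₁.rmem hi)⟩

/-- A loop whose invariant carries a decreasing bound for the number of rounds. -/
theorem run_loop {S : ℕ} {s : State} {b : Test} {c : Prog} (k T : ℕ) (I : ℕ → State → Prop)
    (hstep : ∀ k s', Frame c s s' → I k s' → b.Holds s' →
      ∃ k' < k, Run S c s' fun t s' => t ≤ T ∧ I k' s')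
    (h : I k s) :
    Run S (.loop b c) s fun t s' => t ≤ k * (b.cost + T) + b.cost ∧ ¬ b.Holds s' ∧
      ∃ k', I k' s' := by
  -- The frame always refers to the state in which the loop was entered, so that `hstep` may use
  -- facts about that state in every round.
  suffices H : ∀ k s', Frame c s s' → I k s' → Run S (.loop b c) s' fun t s' =>
      t ≤ k * (b.cost + T) + b.cost ∧ ¬ b.Holds s' ∧ ∃ k', I k' s' from H k s (.refl c s) h
  intro k
  induction k using Nat.strong_induction_on with
  | _ k ih =>
    intro s' hf h
    by_cases hb : b.Holds s'
    · obtain ⟨k', hk, t, s₁, he, ht, hI⟩ := hstep k s' hf h hb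
      obtain ⟨t', s₂, he', ht', hP⟩ := ih k' hk s₁ (hf.trans he.frame) hI
      refine ⟨_, _, .loopStep hb he he', ?_, hP⟩
      have : (k' + 1) * (b.cost + T) ≤ k * (b.cost + T) := Nat.mul_le_mul_right _ hk
      rw [add_mul] at this
      omega
    · exact ⟨_, _, .loopDone c hb, by omega, hb, k, h⟩

/-- A loop with a counter that runs from `0` to `n`. -/
theorem run_for {S : ℕ} {s : State} {b : Test} {c : Prog} (n T : ℕ) (I : ℕ → State → Prop)
    (hb : ∀ i s', Frame c s s' → I i s' → (b.Holds s' ↔ i < n))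
    (hstep : ∀ i s', i < n → Frame c s s' → I i s' → Run S c s' fun t s' => t ≤ T ∧ I (i + 1) s')
    (h : I 0 s) :
    Run S (.loop b c) s fun t s' => t ≤ n * (b.cost + T) + b.cost ∧ I n s' := by
  suffices H : ∀ k i s', i + k = n → Frame c s s' → I i s' → Run S (.loop b c) s' fun t s' =>
      t ≤ k * (b.cost + T) + b.cost ∧ I n s' from H n 0 s (zero_add n) (.refl c s) h
  intro k
  induction k with
  | zero =>
    rintro i s' rfl hf hI
    exact ⟨_, _, .loopDone c (by simp [hb i s' hf hI]), by simp, hI⟩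
  | succ k ih =>
    intro i s' hi hf hI
    obtain ⟨t, s₁, he, ht, hI₁⟩ := hstep i s' (by omega) hf hI
    obtain ⟨t', s₂, he', ht', hP⟩ := ih (i + 1) s₁ (by omega) (hf.trans he.frame) hI₁
    refine ⟨_, _, .loopStep ((hb i s' hf hI).2 (by omega)) he he', ?_, hP⟩
    rw [add_mul]
    omega

/-! ## The decoding of a code -/

/-- The coarse displacement encoded by the leading base-4 digits of `x` up to the first zero, and
the remaining code. -/
def coarse (x : ℕ) : ℤ × ℕ :=
  if x % 4 = 0 then (0, x / 4)
  else ((coarse (x / 4)).1 + (2 * (x % 4 : ℕ) - 3), (coarse (x / 4)).2)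
termination_by x
decreasing_by all_goals omega

/-- The fine coordinate encoded by `x` relative to the coarse coordinate `g`, and the remaining
code. -/
def coord (M : ℕ) (g : ℤ) (x : ℕ) : ℤ × ℕ :=
  (M * (g + (coarse (x / M)).1) + (x % M : ℕ), (coarse (x / M)).2)

/-- The code that remains after `k` coordinates. -/
def codeAfter (M : ℕ) (row : ℕ → ℤ) (x : ℕ) : ℕ → ℕ
  | 0 => x
  | k + 1 => (coord M (row k) (codeAfter M row x k)).2

/-- The `k`-th coordinate encoded by `x`. -/
def codeCoord (M : ℕ) (row : ℕ → ℤ) (x k : ℕ) : ℤ := (coord M (row k) (codeAfter M row x k)).1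

/-- Decoding never increases the code; hence a bound `2 ^ H` for the initial code persists and
limits the length of every later digit loop. -/
theorem coarse_le (x : ℕ) : (coarse x).2 ≤ x := by
  induction x using coarse.induct with
  | case1 x h => rw [coarse, if_pos h]; simp; omega
  | case2 x h ih => rw [coarse, if_neg h]; simp only; omega

theorem coord_le (M : ℕ) (g : ℤ) (x : ℕ) : (coord M g x).2 ≤ x :=
  (coarse_le _).trans (Nat.div_le_self _ _)

theorem codeAfter_le (M : ℕ) (row : ℕ → ℤ) (x k : ℕ) : codeAfter M row x k ≤ x := by
  induction k with
  | zero => exact le_rfl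
  | succ k ih => exact (coord_le _ _ _).trans ih

/-- The parameters of the data structure. -/
structure Par where
  n : ℕ
  m : ℕ
  d : ℕ
  n' : ℕ
  M : ℕ
  N : ℕ
  B : ℤ
  off : ℤ
  ε : ℝ
  r : ℝ
  p : ℝ
  δ : ℝ
  D : ℝ
  inp : ℤ → ℤ → ℤ → ℝ

/-- The registers that hold the parameters. -/
structure Env (E : Par) (s : State) : Prop where
  n : s.ireg 0 = E.n
  m : s.ireg 1 = E.m
  d : s.ireg 2 = E.d
  n' : s.ireg 3 = E.n'
  M : s.ireg 4 = E.M
  N : s.ireg 5 = E.N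
  B : s.ireg 6 = E.B
  off : s.ireg 7 = E.off
  ε : s.rreg 0 = E.ε
  r : s.rreg 1 = E.r
  p : s.rreg 2 = E.p
  δ : s.rreg 3 = E.δ
  D : s.rreg 4 = E.D
  inp : s.inp = E.inp

theorem Env.of_frame {E : Par} {c : Prog} {s s' : State} (h : Env E s) (hf : Frame c s s')
    (hi : ∀ i < 8, i ∉ c.wi) (hr : ∀ i < 5, i ∉ c.wr) : Env E s' where
  n := (hf.ireg 0 (hi 0 (by decide))).trans h.n
  m := (hf.ireg 1 (hi 1 (by decide))).trans h.m
  d := (hf.ireg 2 (hi 2 (by decide))).trans h.d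
  n' := (hf.ireg 3 (hi 3 (by decide))).trans h.n'
  M := (hf.ireg 4 (hi 4 (by decide))).trans h.M
  N := (hf.ireg 5 (hi 5 (by decide))).trans h.N
  B := (hf.ireg 6 (hi 6 (by decide))).trans h.B
  off := (hf.ireg 7 (hi 7 (by decide))).trans h.off
  ε := (hf.rreg 0 (hr 0 (by decide))).trans h.ε
  r := (hf.rreg 1 (hr 1 (by decide))).trans h.r
  p := (hf.rreg 2 (hr 2 (by decide))).trans h.p
  δ := (hf.rreg 3 (hr 3 (by decide))).trans h.δ
  D := (hf.rreg 4 (hr 4 (by decide))).trans h.D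
  inp := hf.inp.trans h.inp

theorem Env.setI {E : Par} {s : State} (h : Env E s) {i : ℕ} (hi : 8 ≤ i) (z : ℤ) :
    Env E { s with ireg := Function.update s.ireg i z } := by
  constructor
  case inp => exact h.inp
  all_goals simp only [Function.update_of_ne (show (0 : ℕ) ≠ i by omega),
    Function.update_of_ne (show 1 ≠ i by omega), Function.update_of_ne (show 2 ≠ i by omega),
    Function.update_of_ne (show 3 ≠ i by omega), Function.update_of_ne (show 4 ≠ i by omega),
    Function.update_of_ne (show 5 ≠ i by omega), Function.update_of_ne (show 6 ≠ i by omega),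
    Function.update_of_ne (show 7 ≠ i by omega), h.n, h.m, h.d, h.n', h.M, h.N, h.B, h.off, h.ε,
    h.r, h.p, h.δ, h.D]

theorem Env.setR {E : Par} {s : State} (h : Env E s) {i : ℕ} (hi : 5 ≤ i) (z : ℝ) :
    Env E { s with rreg := Function.update s.rreg i z } := by
  constructor
  case inp => exact h.inp
  all_goals simp only [Function.update_of_ne (show (0 : ℕ) ≠ i by omega),
    Function.update_of_ne (show 1 ≠ i by omega), Function.update_of_ne (show 2 ≠ i by omega),
    Function.update_of_ne (show 3 ≠ i by omega), Function.update_of_ne (show 4 ≠ i by omega),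
    h.n, h.m, h.d, h.n', h.M, h.N, h.B, h.off, h.ε, h.r, h.p, h.δ, h.D]

/-- The coarse coordinates of the vertex `a` of the input curve `i`. -/
noncomputable def Par.row (E : Par) (i : ℤ) (a k : ℕ) : ℤ := ⌊E.inp i a k / E.D⌋

/-- The distance of the vertex `b` of the curve with the fine coordinates `z` to the vertex `a` of
the input curve `i`. -/
noncomputable def Par.dist (E : Par) (i : ℤ) (z : ℕ → ℤ) (b a : ℕ) : ℝ :=
  (∑ k ∈ Finset.range E.d, (E.δ * z (b * E.d + k) - E.inp i a k) ^ 2) ^ (1 / 2 : ℝ)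

/-- The cost `acc` of a partial alignment, before the `p`-th root, after one more pair at distance
`v`; here `p = 0` stands for `∞`. -/
noncomputable def accStep (p acc v : ℝ) : ℝ := if p ≤ 0 then max acc v else acc + v ^ p

/-- The final cost of an alignment. -/
noncomputable def accRoot (p acc : ℝ) : ℝ := if p ≤ 0 then acc else |acc| ^ (1 / p)

/-- A stage of the decoding: the position `a`, `b` on the input curve and the decoded curve, the
remaining code `x`, whether the vertex `b` is still to be decoded, the fine coordinates `z` decoded
so far, and the cost of the pairs visited so far. -/
structure Cfg where
  a : ℕ
  b : ℕ
  x : ℕ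
  new : Bool
  z : ℕ → ℤ
  acc : ℝ

/-- The coordinates after the decoding of the vertex `b` if this is to be done. -/
noncomputable def Cfg.nextZ (E : Par) (i : ℤ) (c : Cfg) (t : ℕ) : ℤ :=
  if c.new = true ∧ c.b * E.d ≤ t ∧ t < c.b * E.d + E.d then
    codeCoord E.M (E.row i c.a) c.x (t - c.b * E.d)
  else c.z t

/-- The code after the decoding of the vertex `b` if this is to be done. -/
noncomputable def Cfg.nextX (E : Par) (i : ℤ) (c : Cfg) : ℕ :=
  if c.new then codeAfter E.M (E.row i c.a) c.x E.d else c.x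

/-- One round of the decoding. -/
noncomputable def Cfg.next (E : Par) (i : ℤ) (c : Cfg) : Cfg where
  a := if c.nextX E i % 4 ≤ 1 then c.a + 1 else c.a
  b := if c.nextX E i % 4 = 1 then c.b else c.b + 1
  x := c.nextX E i / 4
  new := decide (c.nextX E i % 4 ≠ 1)
  z := c.nextZ E i
  acc := accStep E.p c.acc (E.dist i (c.nextZ E i) c.b c.a)

/-- The stage in which the decoding ends, if it ends after at most `f` rounds. -/
noncomputable def Cfg.final (E : Par) (i : ℤ) : ℕ → Cfg → Cfg
  | 0, c => c
  | f + 1, c => if c.a < E.m ∧ c.b < E.m then Cfg.final E i f (c.next E i) else c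

theorem Cfg.final_of_not {E : Par} {i : ℤ} {c : Cfg} (h : ¬ (c.a < E.m ∧ c.b < E.m)) (f : ℕ) :
    c.final E i f = c := by
  cases f <;> simp [Cfg.final, h]

theorem Cfg.nextX_le (E : Par) (i : ℤ) (c : Cfg) : c.nextX E i ≤ c.x := by
  unfold Cfg.nextX
  split
  · exact codeAfter_le _ _ _ _
  · exact le_rfl

/-- The key of a sequence of fine coordinates: its first `k` members as digits in base `B`. -/
def key (B off : ℤ) (z : ℕ → ℤ) : ℕ → ℤ
  | 0 => 0
  | k + 1 => key B off z k * B + (z k + off)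

/-- The first `k` members of `z` are in the range of the digits of a key. -/
def InRange (B off : ℤ) (z : ℕ → ℤ) (k : ℕ) : Prop := ∀ t < k, 0 ≤ z t + off ∧ z t + off < B

open Classical in
/-- The entry of the dictionary for the stage `c` in which the decoding for the input curve `i`
has ended. -/
noncomputable def Cfg.entry (E : Par) (i : ℕ) (c : Cfg) : ℤ :=
  if E.m ≤ c.a ∧ E.m ≤ c.b ∧ i < E.n ∧ InRange E.B E.off c.z (E.m * E.d) ∧
      accRoot E.p c.acc ≤ (1 + E.ε / 2) * E.r then
    key E.B E.off c.z (E.m * E.d) * E.n' + i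
  else -1

/-! ## The program for a single code -/

/-- Reads a coarse displacement from the code in register 12 into register 17. -/
def readCoarse : Prog :=
  .iset 17 (lit 0) ;;
  .loop (lt (lit 0) (V 12 - lit 4 * (V 12 / lit 4)))
    (.iset 17 (V 17 + (lit 2 * (V 12 - lit 4 * (V 12 / lit 4)) - lit 3)) ;;
     .iset 12 (V 12 / lit 4)) ;;
  .iset 12 (V 12 / lit 4)

/-- Each nonzero digit divides the positive code by 4, so the exponent in `y < 2 ^ k` drops and at
most `H` rounds occur. The sum of register 17 and the displacement still encoded is invariant. -/
theorem readCoarse_run {S : ℕ} {s : State} {x H : ℕ} (hx : s.ireg 12 = x) (hH : x < 2 ^ H) :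
    Run S readCoarse s fun t s' => t ≤ 40 * H + 20 ∧ s'.ireg 17 = (coarse x).1 ∧
      s'.ireg 12 = (coarse x).2 := by
  unfold readCoarse
  simp only [run_seq, run_iset]
  refine (run_loop H 19 (fun k s => ∃ y : ℕ, s.ireg 12 = y ∧ y < 2 ^ k ∧
      s.ireg 17 + (coarse y).1 = (coarse x).1 ∧ (coarse y).2 = (coarse x).2) ?_
      ⟨x, by simpa using hx, hH, by simp⟩).mono ?_
  · rintro k s - ⟨y, hy, hyk, h1, h2⟩ hb
    simp only [holds_lt, eval_lit, eval_sub, eval_V, eval_mul, eval_div, hy] at hb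
    have h4 : y % 4 ≠ 0 := by omega
    obtain _ | k := k
    · simp at hyk; omega
    refine ⟨k, by omega, ?_⟩
    simp only [run_seq, run_iset]
    refine ⟨by simp, y / 4, by simp [hy], by rw [pow_succ] at hyk; omega, ?_, ?_⟩
    · rw [← h1, coarse.eq_1 y, if_neg h4]
      simp [hy]; omega
    · rw [← h2, coarse.eq_1 y, if_neg h4]
  · rintro t s ⟨ht, hb, k, y, hy, -, h1, h2⟩
    simp only [holds_lt, eval_lit, eval_sub, eval_V, eval_mul, eval_div, hy] at hb
    have h4 : y % 4 = 0 := by omega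
    rw [coarse, if_pos h4] at h1 h2
    simp at ht h1 h2 ⊢
    refine ⟨by omega, h1, by rw [hy, ← h2]; simp⟩

/-- Decodes the coordinates of a vertex: the vertex 14 of the curve to be decoded, relative to the
vertex 13 of the input curve 11. -/
def readVertex : Prog :=
  .iset 16 (lit 0) ;;
  .loop (lt (V 16) (V 2))
    (.iset 18 (V 12 - V 4 * (V 12 / V 4)) ;;
     .iset 12 (V 12 / V 4) ;;
     readCoarse ;;
     .read 6 (V 11) (V 13) (V 16) ;;
     .floor 19 (F 6 / F 4) ;;
     .istore (lit 8 + (V 14 * V 2 + V 16)) (V 4 * (V 19 + V 17) + V 18) ;;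
     .iset 16 (V 16 + lit 1))

theorem readVertex_run {S : ℕ} {E : Par} {s : State} {x H a b : ℕ} {i : ℤ} (hE : Env E s)
    (hi : s.ireg 11 = i) (hx : s.ireg 12 = x) (ha : s.ireg 13 = a) (hb : s.ireg 14 = b)
    (hH : x < 2 ^ H) (hS : 8 + b * E.d + E.d ≤ S) :
    Run S readVertex s fun t s' => t ≤ E.d * (40 * H + 80) + 10 ∧
      s'.ireg 12 = codeAfter E.M (E.row i a) x E.d ∧
      (∀ k < E.d, s'.imem (8 + (b * E.d + k : ℕ)) = codeCoord E.M (E.row i a) x k) ∧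
      ∀ y : ℤ, ¬ (8 + (b * E.d : ℕ) ≤ y ∧ y < 8 + (b * E.d + E.d : ℕ)) → s'.imem y = s.imem y := by
  unfold readVertex
  simp only [run_seq, run_iset]
  refine (run_for E.d (40 * H + 70) (fun k s' => s'.ireg 16 = k ∧
      s'.ireg 12 = codeAfter E.M (E.row i a) x k ∧
      (∀ j < k, s'.imem (8 + (b * E.d + j : ℕ)) = codeCoord E.M (E.row i a) x j) ∧
      ∀ y : ℤ, ¬ (8 + (b * E.d : ℕ) ≤ y ∧ y < 8 + (b * E.d + E.d : ℕ)) → s'.imem y = s.imem y)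
      ?_ ?_ ?_).mono ?_
  · rintro k s1 hf ⟨hk, -⟩
    simp [hk, ((hE.setI (i := 16) (by decide) _).of_frame hf (by decide) (by decide)).d]
  · rintro k s1 hk hf ⟨hk', hx, hz, hm⟩
    have hE1 := (hE.setI (i := 16) (by decide) _).of_frame hf (by decide) (by decide)
    simp only [run_seq, run_iset, run_read, run_floor, run_istore]
    refine ((readCoarse_run (x := codeAfter E.M (E.row i a) x k / E.M) (H := H) ?_ ?_).frame).mono ?_
    · simp [hx, hE1.M]
    · exact (Nat.div_le_self _ _).trans_lt ((codeAfter_le _ _ _ _).trans_lt hH)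
    rintro t s2 ⟨⟨ht, h17, h12⟩, hf2⟩
    have hE2 := ((hE1.setI (i := 18) (by decide) _).setI (i := 12) (by decide) _).of_frame hf2
      (by decide) (by decide)
    have e11 : s2.ireg 11 = i := by
      rw [hf2.ireg 11 (by decide)]; simp [hf.ireg 11 (by decide), hi]
    have e13 : s2.ireg 13 = a := by
      rw [hf2.ireg 13 (by decide)]; simp [hf.ireg 13 (by decide), ha]
    have e14 : s2.ireg 14 = b := by
      rw [hf2.ireg 14 (by decide)]; simp [hf.ireg 14 (by decide), hb]
    have e16 : s2.ireg 16 = k := by rw [hf2.ireg 16 (by decide)]; simp [hk']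
    have e18 : s2.ireg 18 = (codeAfter E.M (E.row i a) x k % E.M : ℕ) := by
      rw [hf2.ireg 18 (by decide)]; simp [hx, hE1.M, Int.emod_def]
    have him : s2.imem = s1.imem := by rw [hf2.imem (by decide)]
    simp [e11, e13, e14, e16, e18, hE2.d, hE2.D, hE2.M, hE2.inp, h17, h12, him]
    refine ⟨⟨by positivity, by norm_cast; omega⟩, by omega, rfl, fun j hj => ?_, fun y hy => ?_⟩
    · obtain rfl | hj := hj.eq_or_lt
      · simp [codeCoord, coord, Par.row]
      · rw [Function.update_of_ne (by omega), ← hz j hj]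
        simp
    · rw [Function.update_of_ne (by rintro rfl; omega)]
      exact hm y (by push_cast; omega)
  · exact ⟨by simp, by simp [codeAfter, hx], by simp, by simp⟩
  · rintro t s' ⟨ht, -, h12, hz, hm⟩
    refine ⟨?_, h12, hz, hm⟩
    simp at ht ⊢
    nlinarith

/-- Computes in register 7 the distance of the decoded vertex 14 to the vertex 13 of the input
curve 11. -/
def vertexDist : Prog :=
  .rset 7 (toR (lit 0)) ;;
  .iset 16 (lit 0) ;;
  .loop (lt (V 16) (V 2))
    (.iload 18 (lit 8 + (V 14 * V 2 + V 16)) ;;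
     .read 6 (V 11) (V 13) (V 16) ;;
     .rset 7 (F 7 + (F 3 * toR (V 18) - F 6) * (F 3 * toR (V 18) - F 6)) ;;
     .iset 16 (V 16 + lit 1)) ;;
  .rset 7 (.pow (F 7) (toR (lit 1) / toR (lit 2)))

theorem vertexDist_run {S : ℕ} {E : Par} {s : State} {a b : ℕ} {i : ℤ} {z : ℕ → ℤ} (hE : Env E s)
    (hi : s.ireg 11 = i) (ha : s.ireg 13 = a) (hb : s.ireg 14 = b)
    (hz : ∀ k < E.d, s.imem (8 + (b * E.d + k : ℕ)) = z (b * E.d + k))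
    (hS : 8 + b * E.d + E.d ≤ S) :
    Run S vertexDist s fun t s' => t ≤ E.d * 40 + 20 ∧ s'.rreg 7 = E.dist i z b a := by
  unfold vertexDist
  simp only [run_seq, run_iset, run_rset]
  have hE0 := fun u v => (hE.setR (i := 7) (by decide) u).setI (i := 16) (by decide) v
  refine (run_for E.d 35 (fun k s' => s'.ireg 16 = k ∧
      s'.rreg 7 = ∑ k ∈ Finset.range k, (E.δ * z (b * E.d + k) - E.inp i a k) ^ 2) ?_ ?_ ?_).mono ?_
  · rintro k s1 hf ⟨hk, -⟩
    simp [hk, ((hE0 _ _).of_frame hf (by decide) (by decide)).d]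
  · rintro k s1 hk hf ⟨hk', hx⟩
    have hE1 := (hE0 _ _).of_frame hf (by decide) (by decide)
    have e11 : s1.ireg 11 = i := by simp [hf.ireg 11 (by decide), hi]
    have e13 : s1.ireg 13 = a := by simp [hf.ireg 13 (by decide), ha]
    have e14 : s1.ireg 14 = b := by simp [hf.ireg 14 (by decide), hb]
    have him : s1.imem = s.imem := by rw [hf.imem (by decide)]
    have := hz k hk
    push_cast at this
    simp only [run_seq, run_iset, run_read, run_rset, run_iload]
    simp [e11, e13, e14, hk', hE1.d, hE1.inp, hE1.δ, him, hx, Finset.sum_range_succ, this]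
    exact ⟨⟨by positivity, by norm_cast; omega⟩, by ring⟩
  · exact ⟨by simp, by simp⟩
  · rintro t s' ⟨ht, -, h7⟩
    simp at ht
    refine ⟨by simp; omega, ?_⟩
    -- The machine raises the absolute value of the base to a power; for a sum of squares this is
    -- the base itself.
    have : 0 ≤ s'.rreg 7 := by rw [h7]; positivity
    simp only [reval_pow, eval_F, reval_div, eval_toR, eval_lit, Function.update_self,
      abs_of_nonneg this]
    simp [h7, Par.dist]

/-- Adds the distance in register 7 to the cost in register 8. -/
def addDist : Prog :=
  .cond (.rle (F 2) (toR (lit 0)))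
    (.cond (.rle (F 8) (F 7)) (.rset 8 (F 7)) .skip)
    (.rset 8 (F 8 + .pow (F 7) (F 2)))

theorem addDist_run {S : ℕ} {E : Par} {s : State} (hE : Env E s) (h7 : 0 ≤ s.rreg 7) :
    Run S addDist s fun t s' => t ≤ 20 ∧ s'.rreg 8 = accStep E.p (s.rreg 8) (s.rreg 7) := by
  unfold addDist
  simp only [run_cond, run_rset, run_skip, accStep]
  simp +contextual [hE.p, abs_of_nonneg h7]
  intro _ h
  exact h.le

/-- Reads a step of the alignment from the code. -/
def readStep : Prog :=
  .iset 18 (V 12 - lit 4 * (V 12 / lit 4)) ;;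
  .iset 12 (V 12 / lit 4) ;;
  .cond (.conj (.ile (V 18) (lit 1)) (.ile (lit 1) (V 18)))
    (.iset 13 (V 13 + lit 1) ;; .iset 15 (lit 0))
    (.iset 14 (V 14 + lit 1) ;; .iset 15 (lit 1) ;;
     .cond (.ile (V 18) (lit 0)) (.iset 13 (V 13 + lit 1)) .skip)

/-- Digit 0 advances both curves, 1 only the input curve, 2 and 3 only the decoded one. Only after
digit 1 is there no new vertex to decode. -/
theorem readStep_run {S : ℕ} {s : State} {x a b : ℕ} (hx : s.ireg 12 = x) (ha : s.ireg 13 = a)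
    (hb : s.ireg 14 = b) :
    Run S readStep s fun t s' => t ≤ 50 ∧ s'.ireg 12 = (x / 4 : ℕ) ∧
      s'.ireg 13 = (if x % 4 ≤ 1 then a + 1 else a : ℕ) ∧
      s'.ireg 14 = (if x % 4 = 1 then b else b + 1 : ℕ) ∧
      s'.ireg 15 = (if x % 4 ≠ 1 then 1 else 0) := by
  have e : (x : ℤ) - 4 * (x / 4) = (x % 4 : ℕ) := by omega
  unfold readStep
  simp only [run_seq, run_iset, run_cond, run_skip]
  simp [hx, ha, hb, e]
  have : x % 4 = 0 ∨ x % 4 = 1 ∨ x % 4 = 2 ∨ x % 4 = 3 := by omega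
  norm_cast
  rcases this with h | h | h | h <;> simp [h]

/-- The machine is in the stage `c` of the decoding for the input curve `i`. -/
structure Match (E : Par) (i : ℤ) (c : Cfg) (s : State) : Prop where
  i : s.ireg 11 = i
  x : s.ireg 12 = c.x
  a : s.ireg 13 = c.a
  b : s.ireg 14 = c.b
  new : s.ireg 15 = if c.new then 1 else 0
  acc : s.rreg 8 = c.acc
  z : ∀ t < E.m * E.d, s.imem (8 + t) = c.z t

/-- One round of the decoding. -/
def pathRound : Prog :=
  .cond (.ile (lit 1) (V 15)) readVertex .skip ;;
  vertexDist ;;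
  addDist ;;
  readStep

theorem Par.dist_nonneg (E : Par) (i : ℤ) (z : ℕ → ℤ) (b a : ℕ) : 0 ≤ E.dist i z b a := by
  unfold Par.dist
  positivity

theorem pathRound_run {S : ℕ} {E : Par} {s : State} {i : ℤ} {c : Cfg} {H : ℕ} (hE : Env E s)
    (hM : Match E i c s) (hb : c.b < E.m) (hH : c.x < 2 ^ H) (hS : 8 + E.m * E.d ≤ S) :
    Run S pathRound s fun t s' => t ≤ E.d * (40 * H + 120) + 120 ∧ Match E i (c.next E i) s' ∧
      ∀ y : ℤ, ¬ (8 ≤ y ∧ y < 8 + (E.m * E.d : ℕ)) → s'.imem y = s.imem y := by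
  have hbd : c.b * E.d + E.d ≤ E.m * E.d := by rw [← Nat.succ_mul]; exact Nat.mul_le_mul_right _ hb
  unfold pathRound
  rw [run_seq]
  have h1 : Run S (.cond (.ile (lit 1) (V 15)) readVertex .skip) s fun t s' =>
      t ≤ E.d * (40 * H + 80) + 20 ∧ s'.ireg 12 = c.nextX E i ∧
      (∀ t < E.m * E.d, s'.imem (8 + t) = c.nextZ E i t) ∧
      ∀ y : ℤ, ¬ (8 ≤ y ∧ y < 8 + (E.m * E.d : ℕ)) → s'.imem y = s.imem y := by
    rw [run_cond]
    by_cases hn : c.new = true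
    · simp only [holds_ile, eval_lit, eval_V, hM.new, hn, if_true, le_refl, not_true,
        false_imp_iff, and_true, true_imp_iff]
      refine (readVertex_run hE hM.i hM.x hM.a hM.b hH (by omega)).mono ?_
      rintro t s' ⟨ht, h12, hz, hm⟩
      refine ⟨by simp; omega, by simp [h12, Cfg.nextX, hn], fun t ht => ?_, fun y hy => ?_⟩
      · unfold Cfg.nextZ
        split_ifs with h
        · rw [← hz (t - c.b * E.d) (by omega), show c.b * E.d + (t - c.b * E.d) = t by omega]
        · rw [hm _ (by simp only [hn, true_and] at h; omega), hM.z t ht]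
      · exact hm y (by omega)
    · simp only [holds_ile, eval_lit, eval_V, hM.new, hn, run_skip]
      refine ⟨by simp, fun _ => ⟨by simp, by simp [hM.x, Cfg.nextX, hn], fun t ht => ?_,
        fun _ _ => trivial⟩⟩
      simp [Cfg.nextZ, hn, hM.z t ht]
  refine h1.frame.mono ?_
  rintro t1 s1 ⟨⟨ht1, h12, hz1, hm1⟩, hf1⟩
  have hE1 := hE.of_frame hf1 (by decide) (by decide)
  rw [run_seq]
  refine (vertexDist_run (z := c.nextZ E i) (a := c.a) (b := c.b) (i := i) hE1
    (by rw [hf1.ireg _ (by decide), hM.i]) (by rw [hf1.ireg _ (by decide), hM.a])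
    (by rw [hf1.ireg _ (by decide), hM.b]) (fun k hk => hz1 _ (by omega)) (by omega)).frame.mono ?_
  rintro t2 s2 ⟨⟨ht2, h7⟩, hf2⟩
  have hE2 := hE1.of_frame hf2 (by decide) (by decide)
  rw [run_seq]
  refine (addDist_run hE2 (by rw [h7]; exact E.dist_nonneg ..)).frame.mono ?_
  rintro t3 s3 ⟨⟨ht3, h8⟩, hf3⟩
  refine (readStep_run (x := c.nextX E i) (a := c.a) (b := c.b)
    (by rw [hf3.ireg _ (by decide), hf2.ireg _ (by decide), h12])
    (by rw [hf3.ireg _ (by decide), hf2.ireg _ (by decide), hf1.ireg _ (by decide), hM.a])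
    (by rw [hf3.ireg _ (by decide), hf2.ireg _ (by decide), hf1.ireg _ (by decide), hM.b])).frame.mono
    ?_
  rintro t4 s4 ⟨⟨ht4, h12', h13, h14, h15⟩, hf4⟩
  have him : s4.imem = s1.imem := by
    rw [hf4.imem (by decide), hf3.imem (by decide), hf2.imem (by decide)]
  refine ⟨by nlinarith, ⟨?_, h12', h13, h14, by simpa [Cfg.next] using h15, ?_, ?_⟩, ?_⟩
  · rw [hf4.ireg _ (by decide), hf3.ireg _ (by decide), hf2.ireg _ (by decide),
      hf1.ireg _ (by decide), hM.i]
  · rw [hf4.rreg _ (by decide), h8, h7, hf2.rreg _ (by decide), hf1.rreg _ (by decide), hM.acc]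
    rfl
  · intro t ht
    rw [him, hz1 t ht]
    rfl
  · intro y hy
    rw [him, hm1 y hy]

/-- Computes in register 19 the key of the decoded curve, and sets register 20 if some coordinate
is out of range. -/
def computeKey : Prog :=
  .iset 19 (lit 0) ;;
  .iset 20 (lit 0) ;;
  .iset 16 (lit 0) ;;
  .loop (lt (V 16) (V 1 * V 2))
    (.iload 18 (lit 8 + V 16) ;;
     .iset 18 (V 18 + V 7) ;;
     .cond (.conj (.ile (lit 0) (V 18)) (lt (V 18) (V 6))) .skip (.iset 20 (lit 1)) ;;
     .iset 19 (V 19 * V 6 + V 18) ;;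
     .iset 16 (V 16 + lit 1))

theorem inRange_succ {B off : ℤ} {z : ℕ → ℤ} {k : ℕ} :
    InRange B off z (k + 1) ↔ InRange B off z k ∧ 0 ≤ z k + off ∧ z k + off < B := by
  simp only [InRange, Nat.lt_succ_iff_lt_or_eq, or_imp, forall_and, forall_eq]
  tauto

open Classical in
theorem computeKey_run {S : ℕ} {E : Par} {s : State} {z : ℕ → ℤ} (hE : Env E s)
    (hz : ∀ t < E.m * E.d, s.imem (8 + t) = z t) (hS : 8 + E.m * E.d ≤ S) :
    Run S computeKey s fun t s' => t ≤ (E.m * E.d) * 50 + 20 ∧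
      s'.ireg 19 = key E.B E.off z (E.m * E.d) ∧
      s'.ireg 20 = if InRange E.B E.off z (E.m * E.d) then 0 else 1 := by
  unfold computeKey
  simp only [run_seq, run_iset]
  have hE0 := fun u v w => ((hE.setI (i := 19) (by decide) u).setI (i := 20) (by decide) v).setI
    (i := 16) (by decide) w
  refine (run_for (E.m * E.d) 40 (fun k s' => s'.ireg 16 = k ∧ s'.ireg 19 = key E.B E.off z k ∧
      s'.ireg 20 = if InRange E.B E.off z k then 0 else 1) ?_ ?_ ?_).mono ?_
  · rintro k s1 hf ⟨hk, -⟩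
    have hE1 := (hE0 _ _ _).of_frame hf (by decide) (by decide)
    simp [hk, hE1.m, hE1.d]
    norm_cast
  · rintro k s1 hk hf ⟨hk', h19, h20⟩
    have hE1 := (hE0 _ _ _).of_frame hf (by decide) (by decide)
    have him : s1.imem = s.imem := by rw [hf.imem (by decide)]
    simp only [run_seq, run_iset, run_cond, run_iload, run_skip]
    simp [hk', hE1.off, hE1.B, him, hz k hk, h19, h20, key, inRange_succ]
    refine ⟨⟨by positivity, by omega⟩, ?_, ?_⟩
    · intro h h'
      simp [h, h']
    · exact fun h _ => h
  · exact ⟨by simp, by simp [key], by simp [InRange]⟩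
  · rintro t s' ⟨ht, -, h19, h20⟩
    simp at ht
    exact ⟨by simp; omega, h19, h20⟩

/-- Computes in register 21 the entry of the dictionary for the code in register 8. -/
def makeEntry : Prog :=
  .iset 12 (V 8 / V 3) ;;
  .iset 11 (V 8 - V 3 * V 12) ;;
  .iset 13 (lit 0) ;;
  .iset 14 (lit 0) ;;
  .iset 15 (lit 1) ;;
  .rset 8 (toR (lit 0)) ;;
  .loop (.conj (lt (V 13) (V 1)) (lt (V 14) (V 1))) pathRound ;;
  computeKey ;;
  .cond (.rle (F 2) (toR (lit 0))) .skip (.rset 8 (.pow (F 8) (toR (lit 1) / F 2))) ;;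
  .iset 21 (lit (-1)) ;;
  .cond (.conj (.ile (V 1) (V 13)) (.conj (.ile (V 1) (V 14)) (.conj (lt (V 11) (V 0))
      (.conj (.ile (V 20) (lit 0))
        (.rle (F 8) ((toR (lit 1) + F 0 / toR (lit 2)) * F 1))))))
    (.iset 21 (V 19 * V 3 + V 11)) .skip

/-- The stage in which the decoding of the code `w` starts if the memory holds `z`. -/
def startCfg (n' w : ℕ) (z : ℕ → ℤ) : Cfg where
  a := 0
  b := 0
  x := w / n'
  new := true
  z := z
  acc := 0

/-- The entry of the dictionary for the code `w` if the memory holds `z`. -/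
noncomputable def codeEntry (E : Par) (w : ℕ) (z : ℕ → ℤ) : ℤ :=
  (Cfg.final E (w % E.n' : ℕ) (2 * E.m) (startCfg E.n' w z)).entry E (w % E.n')

/-- The growth of `a + b` limits the decoding to `2m` rounds, whatever the code is. -/
theorem Cfg.next_lt (E : Par) (i : ℤ) (c : Cfg) :
    c.a + c.b < (c.next E i).a + (c.next E i).b ∧ (c.next E i).a ≤ c.a + 1 ∧
      (c.next E i).b ≤ c.b + 1 := by
  simp only [Cfg.next]
  split_ifs <;> omega

/-- The invariant `2m ≤ k + a + b` says that the fuel `k` cannot run out while the loop test holds,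
so the machine and `Cfg.final` stop in the same stage. -/
theorem pathLoop_run {S : ℕ} {E : Par} {s : State} {i : ℤ} {c : Cfg} {H : ℕ} (hE : Env E s)
    (hM : Match E i c s) (ha : c.a = 0) (hb : c.b = 0) (hH : c.x < 2 ^ H)
    (hS : 8 + E.m * E.d ≤ S) :
    Run S (.loop (.conj (lt (V 13) (V 1)) (lt (V 14) (V 1))) pathRound) s fun t s' =>
      t ≤ 2 * E.m * (E.d * (40 * H + 120) + 140) + 10 ∧ Match E i (c.final E i (2 * E.m)) s' ∧
      ∀ y : ℤ, ¬ (8 ≤ y ∧ y < 8 + (E.m * E.d : ℕ)) → s'.imem y = s.imem y := by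
  refine (run_loop (2 * E.m) (E.d * (40 * H + 120) + 120) (fun k s' => ∃ c' : Cfg,
    Match E i c' s' ∧ c'.final E i k = c.final E i (2 * E.m) ∧ 2 * E.m ≤ k + c'.a + c'.b ∧
      c'.a ≤ E.m ∧ c'.b ≤ E.m ∧ c'.x < 2 ^ H ∧
      ∀ y : ℤ, ¬ (8 ≤ y ∧ y < 8 + (E.m * E.d : ℕ)) → s'.imem y = s.imem y) ?_ ?_).frame.mono ?_
  · rintro k s1 hf ⟨c', hM', hc, hk, ha', hb', hx, hm⟩ hB
    have hE1 := hE.of_frame hf (by decide) (by decide)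
    simp only [holds_conj, holds_lt, eval_V, hM'.a, hM'.b, hE1.m, Nat.cast_lt] at hB
    obtain _ | k := k
    · omega
    refine ⟨k, by omega, (pathRound_run hE1 hM' hB.2 hx hS).mono ?_⟩
    rintro t s2 ⟨ht, hM2, hm2⟩
    have := c'.next_lt E i
    refine ⟨ht, c'.next E i, hM2, ?_, by omega, by omega, by omega, ?_, ?_⟩
    · rw [← hc, Cfg.final, if_pos hB]
    · exact (Nat.div_le_self _ _).trans_lt ((c'.nextX_le E i).trans_lt hx)
    · intro y hy
      rw [hm2 y hy, hm y hy]
  · exact ⟨c, hM, rfl, by omega, by omega, by omega, hH, fun _ _ => rfl⟩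
  · rintro t s' ⟨⟨ht, hB, k, c', hM', hc, -, -, -, -, hm⟩, hf⟩
    have hE1 := hE.of_frame hf (by decide) (by decide)
    simp only [holds_conj, holds_lt, eval_V, hM'.a, hM'.b, hE1.m, Nat.cast_lt] at hB
    rw [Cfg.final_of_not hB] at hc
    refine ⟨?_, hc ▸ hM', hm⟩
    simp at ht
    nlinarith

/-- The coordinate cells are not cleared between codes: decoding starts with whatever the previous
code left there. Hence the quantifier over `z`, which both soundness and completeness tolerate. -/
theorem makeEntry_run {S : ℕ} {E : Par} {s : State} {w H : ℕ} (hE : Env E s)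
    (hw : s.ireg 8 = w) (hH : w < 2 ^ H) (hS : 8 + E.m * E.d ≤ S) :
    Run S makeEntry s fun t s' =>
      t ≤ 2 * E.m * (E.d * (40 * H + 120) + 140) + (E.m * E.d) * 50 + 200 ∧
      (∃ z, s'.ireg 21 = codeEntry E w z) ∧
      ∀ y : ℤ, ¬ (8 ≤ y ∧ y < 8 + (E.m * E.d : ℕ)) → s'.imem y = s.imem y := by
  unfold makeEntry
  simp only [run_seq, run_iset, run_rset]
  set z : ℕ → ℤ := fun t => s.imem (8 + t) with hz
  set c := startCfg E.n' w z with hc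
  have hE0 := fun u1 u2 u3 u4 u5 u6 => (((((hE.setI (i := 12) (by decide) u1).setI (i := 11)
    (by decide) u2).setI (i := 13) (by decide) u3).setI (i := 14) (by decide) u4).setI (i := 15)
    (by decide) u5).setR (i := 8) (by decide) u6
  refine ((pathLoop_run (c := c) (i := (w % E.n' : ℕ)) (H := H) (hE0 _ _ _ _ _ _) ?_ rfl rfl ?_
    hS).frame).mono ?_
  · constructor
    · simp [hw, hE.n', Int.emod_def]
    · simp [hw, hE.n', hc, startCfg]
    · simp [hc, startCfg]
    · simp [hc, startCfg]
    · simp [hc, startCfg]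
    · simp [hc, startCfg]
    · simp [hc, startCfg, hz]
  · exact (Nat.div_le_self _ _).trans_lt hH
  rintro t1 s1 ⟨⟨ht1, hM1, hm1⟩, hf1⟩
  have hE1 := (hE0 _ _ _ _ _ _).of_frame hf1 (by decide) (by decide)
  clear hE0
  refine (computeKey_run hE1 hM1.z hS).frame.mono ?_
  rintro t2 s2 ⟨⟨ht2, h19, h20⟩, hf2⟩
  have hE2 := hE1.of_frame hf2 (by decide) (by decide)
  have e11 : s2.ireg 11 = (w % E.n' : ℕ) := by rw [hf2.ireg _ (by decide), hM1.i]
  have e13 := (hf2.ireg 13 (by decide)).trans hM1.a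
  have e14 := (hf2.ireg 14 (by decide)).trans hM1.b
  have r8 := (hf2.rreg 8 (by decide)).trans hM1.acc
  have him := hf2.imem (by decide)
  have h3 : Run S (.cond (.rle (F 2) (toR (lit 0))) .skip
      (.rset 8 (.pow (F 8) (toR (lit 1) / F 2)))) s2 fun t s' => t ≤ 20 ∧
      s'.rreg 8 = accRoot E.p (Cfg.final E (w % E.n' : ℕ) (2 * E.m) c).acc := by
    simp only [run_cond, run_rset, run_skip, accRoot]
    simp +contextual [hE2.p, r8, not_le]
  refine h3.frame.mono ?_
  rintro t3 s3 ⟨⟨ht3, r8'⟩, hf3⟩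
  have hE3 := hE2.of_frame hf3 (by decide) (by decide)
  rw [← hf3.ireg _ (by decide)] at h19 h20 e11 e13 e14
  have him3 := hf3.imem (by decide)
  have hmem : ∀ y : ℤ, ¬ (8 ≤ y ∧ y < 8 + (E.m * E.d : ℕ)) → s3.imem y = s.imem y := by
    intro y hy
    rw [him3, him, hm1 y hy]
  have hfl : s3.ireg 20 ≤ 0 ↔ InRange E.B E.off
      (Cfg.final E (w % E.n' : ℕ) (2 * E.m) c).z (E.m * E.d) := by
    rw [h20]
    split_ifs with h
    · exact iff_of_true le_rfl h
    · exact iff_of_false (by norm_num) h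
  have hu : ∀ (v : ℤ) (j : ℕ), j < 21 → Function.update s3.ireg 21 v j = s3.ireg j :=
    fun v j hj => Function.update_of_ne hj.ne _ _
  simp only [run_cond, run_iset, run_skip]
  simp only [holds_conj, holds_ile, holds_lt, holds_rle, eval_V, eval_F, eval_lit, reval_mul,
    reval_add, reval_div, eval_toR, eval_mul, eval_add, hu _ 0 (by decide),
    hu _ 1 (by decide), hu _ 3 (by decide), hu _ 11 (by decide), hu _ 13 (by decide),
    hu _ 14 (by decide), hu _ 19 (by decide), hu _ 20 (by decide), hE3.n, hE3.m, hE3.n', hE3.ε, hE3.r,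
    h19, hfl, e11, e13, e14, r8', Nat.cast_le, Nat.cast_lt]
  refine ⟨fun h => ⟨?_, ⟨z, ?_⟩, hmem⟩, fun h => ⟨?_, ⟨z, ?_⟩, hmem⟩⟩
  · simp; omega
  · rw [codeEntry, Cfg.entry, if_pos (by simpa using h)]
    simp [hc]
  · simp; omega
  · rw [codeEntry, Cfg.entry, if_neg (by simpa using h)]
    simp

/-! ## Merge sort -/

/-- `f` is monotone on the interval from `lo` to `hi - 1`. -/
def SortedOn (f : ℕ → ℤ) (lo hi : ℕ) : Prop := ∀ i j, lo ≤ i → i ≤ j → j < hi → f i ≤ f j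

/-- The arrays `f` and `g` have the same members between `lo` and `hi - 1`. -/
def SameOn (f g : ℕ → ℤ) (lo hi : ℕ) : Prop :=
  ∀ v, (∃ t, lo ≤ t ∧ t < hi ∧ g t = v) ↔ ∃ t, lo ≤ t ∧ t < hi ∧ f t = v

/-- The state of a merge of the blocks of `f` from `lo` to `mid - 1` and from `mid` to `hi - 1`
into `g`: the first `k - lo` members have been written. -/
structure Merging (f g : ℕ → ℤ) (lo mid hi a b k : ℕ) : Prop where
  la : lo ≤ a
  am : a ≤ mid
  mb : mid ≤ b
  bh : b ≤ hi
  hk : k + mid = a + b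
  sorted : SortedOn g lo k
  lea : a < mid → ∀ t, lo ≤ t → t < k → g t ≤ f a
  leb : b < hi → ∀ t, lo ≤ t → t < k → g t ≤ f b
  same : ∀ v, (∃ t, lo ≤ t ∧ t < k ∧ g t = v) ↔
    ∃ t, (lo ≤ t ∧ t < a ∨ mid ≤ t ∧ t < b) ∧ f t = v

theorem Merging.congr {f g g' : ℕ → ℤ} {lo mid hi a b k : ℕ} (h : Merging f g lo mid hi a b k)
    (hg : ∀ t, lo ≤ t → t < k → g' t = g t) : Merging f g' lo mid hi a b k where
  la := h.la
  am := h.am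
  mb := h.mb
  bh := h.bh
  hk := h.hk
  sorted i j hi hij hj := by
    rw [hg i hi (by omega), hg j (by omega) hj]; exact h.sorted i j hi hij hj
  lea ha t ht htk := by rw [hg t ht htk]; exact h.lea ha t ht htk
  leb hb t ht htk := by rw [hg t ht htk]; exact h.leb hb t ht htk
  same v := by
    rw [← h.same v]
    exact exists_congr fun t => and_congr_right fun h₁ => and_congr_right fun h₂ => by rw [hg t h₁ h₂]

/-- `lea` puts `f a` above everything written so far, and `hab` puts it below the head of the other
block, which is what `leb` needs afterwards. -/
theorem Merging.stepA {f g : ℕ → ℤ} {lo mid hi a b k : ℕ} (h : Merging f g lo mid hi a b k)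
    (hf : SortedOn f lo mid) (ha : a < mid) (hab : b < hi → f a ≤ f b) (hg : g k = f a) :
    Merging f g lo mid hi (a + 1) b (k + 1) where
  la := by have := h.la; omega
  am := ha
  mb := h.mb
  bh := h.bh
  hk := by have := h.hk; omega
  sorted i j hi hij hj := by
    obtain hj | rfl := Nat.lt_succ_iff_lt_or_eq.1 hj
    · exact h.sorted i j hi hij hj
    · obtain hi' | rfl := hij.lt_or_eq
      · rw [hg]; exact h.lea ha i hi hi'
      · exact le_rfl
  lea ha' t ht htk := by
    have : f a ≤ f (a + 1) := hf a (a + 1) h.la (by omega) ha'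
    obtain hj | rfl := Nat.lt_succ_iff_lt_or_eq.1 htk
    · exact (h.lea ha t ht hj).trans this
    · rwa [hg]
  leb hb t ht htk := by
    obtain hj | rfl := Nat.lt_succ_iff_lt_or_eq.1 htk
    · exact h.leb hb t ht hj
    · rw [hg]; exact hab hb
  same v := by
    have e := h.same v
    have := h.la
    have := h.mb
    have := h.hk
    constructor
    · rintro ⟨t, h1, h2, rfl⟩
      obtain hj | rfl := Nat.lt_succ_iff_lt_or_eq.1 h2
      · obtain ⟨t', h', e'⟩ := e.1 ⟨t, h1, hj, rfl⟩
        exact ⟨t', by omega, e'⟩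
      · exact ⟨a, by omega, hg.symm⟩
    · rintro ⟨t, h1, rfl⟩
      by_cases hta : t = a
      · subst hta; exact ⟨k, by omega, by omega, hg⟩
      · have hh : lo ≤ t ∧ t < a ∨ mid ≤ t ∧ t < b := by clear e; omega
        obtain ⟨t', h', h'', e'⟩ := e.2 ⟨t, hh, rfl⟩
        exact ⟨t', h', by omega, e'⟩

theorem Merging.stepB {f g : ℕ → ℤ} {lo mid hi a b k : ℕ} (h : Merging f g lo mid hi a b k)
    (hf : SortedOn f mid hi) (hb : b < hi) (hab : a < mid → f b ≤ f a) (hg : g k = f b) :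
    Merging f g lo mid hi a (b + 1) (k + 1) where
  la := h.la
  am := h.am
  mb := by have := h.mb; omega
  bh := hb
  hk := by have := h.hk; omega
  sorted i j hi hij hj := by
    obtain hj | rfl := Nat.lt_succ_iff_lt_or_eq.1 hj
    · exact h.sorted i j hi hij hj
    · obtain hi' | rfl := hij.lt_or_eq
      · rw [hg]; exact h.leb hb i hi hi'
      · exact le_rfl
  lea ha t ht htk := by
    obtain hj | rfl := Nat.lt_succ_iff_lt_or_eq.1 htk
    · exact h.lea ha t ht hj
    · rw [hg]; exact hab ha
  leb hb' t ht htk := by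
    have : f b ≤ f (b + 1) := hf b (b + 1) h.mb (by omega) hb'
    obtain hj | rfl := Nat.lt_succ_iff_lt_or_eq.1 htk
    · exact (h.leb hb t ht hj).trans this
    · rwa [hg]
  same v := by
    have e := h.same v
    have := h.la
    have := h.am
    have := h.mb
    have := h.hk
    constructor
    · rintro ⟨t, h1, h2, rfl⟩
      obtain hj | rfl := Nat.lt_succ_iff_lt_or_eq.1 h2
      · obtain ⟨t', h', e'⟩ := e.1 ⟨t, h1, hj, rfl⟩
        exact ⟨t', by omega, e'⟩
      · exact ⟨b, by omega, hg.symm⟩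
    · rintro ⟨t, h1, rfl⟩
      by_cases hta : t = b
      · subst hta; exact ⟨k, by omega, by omega, hg⟩
      · have hh : lo ≤ t ∧ t < a ∨ mid ≤ t ∧ t < b := by clear e; omega
        obtain ⟨t', h', h'', e'⟩ := e.2 ⟨t, hh, rfl⟩
        exact ⟨t', h', by omega, e'⟩

/-- Merges the two blocks of length register 22 that start at the index register 23. -/
def mergeBlock : Prog :=
  .iset 25 (V 23) ;;
  .iset 26 (V 23 + V 22) ;;
  .iset 24 (V 23) ;;
  .loop (lt (V 24) (V 23 + lit 2 * V 22))
    (.iload 27 (V 9 + V 25) ;;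
     .iload 28 (V 9 + V 26) ;;
     .cond (.conj (lt (V 25) (V 23 + V 22))
         (.neg (.conj (lt (V 26) (V 23 + lit 2 * V 22)) (lt (V 28) (V 27)))))
       (.istore (V 10 + V 24) (V 27) ;; .iset 25 (V 25 + lit 1))
       (.istore (V 10 + V 24) (V 28) ;; .iset 26 (V 26 + lit 1)) ;;
     .iset 24 (V 24 + lit 1))

/-- The strict bound `hsrc` matters: both heads are loaded before it is tested whether their blocks
are exhausted, so the cell just behind the source array may be read. -/
theorem mergeBlock_run {S : ℕ} {s : State} {src dst lo w N : ℕ} {f : ℕ → ℤ}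
    (h9 : s.ireg 9 = src) (h10 : s.ireg 10 = dst) (h22 : s.ireg 22 = w) (h23 : s.ireg 23 = lo)
    (hdisj : src + N ≤ dst ∨ dst + N ≤ src) (hN : lo + 2 * w ≤ N) (hsrc : src + N < S)
    (hdst : dst + N < S) (hf : ∀ t < N, s.imem (src + t) = f t)
    (h₁ : SortedOn f lo (lo + w)) (h₂ : SortedOn f (lo + w) (lo + 2 * w)) :
    Run S mergeBlock s fun t s' => t ≤ 2 * w * 60 + 40 ∧
      (∀ y : ℤ, ¬ (dst + lo ≤ y ∧ y < dst + lo + 2 * w) → s'.imem y = s.imem y) ∧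
      SortedOn (fun t => s'.imem (dst + t)) lo (lo + 2 * w) ∧
      SameOn f (fun t => s'.imem (dst + t)) lo (lo + 2 * w) := by
  unfold mergeBlock
  simp only [run_seq, run_iset]
  refine (run_for (2 * w) 50 (fun i s' => s'.ireg 24 = (lo + i : ℕ) ∧
      (∀ y : ℤ, ¬ (dst + lo ≤ y ∧ y < dst + lo + 2 * w) → s'.imem y = s.imem y) ∧
      ∃ a b : ℕ, s'.ireg 25 = a ∧ s'.ireg 26 = b ∧
        Merging f (fun t => s'.imem (dst + t)) lo (lo + w) (lo + 2 * w) a b (lo + i))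
      ?_ ?_ ?_).mono ?_
  · rintro i s1 hf1 ⟨h24, -⟩
    have e22 : s1.ireg 22 = w := by simp [hf1.ireg 22 (by decide), h22]
    have e23 : s1.ireg 23 = lo := by simp [hf1.ireg 23 (by decide), h23]
    simp [e22, e23, h24]
    omega
  · rintro i s1 hi hf1 ⟨h24, hm, a, b, h25, h26, hM⟩
    have e22 : s1.ireg 22 = w := by simp [hf1.ireg 22 (by decide), h22]
    have e23 : s1.ireg 23 = lo := by simp [hf1.ireg 23 (by decide), h23]
    have e9 : s1.ireg 9 = src := by simp [hf1.ireg 9 (by decide), h9]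
    have e10 : s1.ireg 10 = dst := by simp [hf1.ireg 10 (by decide), h10]
    have hla := hM.la
    have ham := hM.am
    have hmb := hM.mb
    have hbh := hM.bh
    have hk := hM.hk
    -- All writes go to the other array, which is disjoint from the source.
    have hfs : ∀ t < N, s1.imem (src + t) = f t := fun t ht => by rw [hm _ (by omega), hf t ht]
    have hcongr : ∀ v : ℤ, Merging f
        (fun t => Function.update s1.imem (dst + (lo + i : ℕ)) v (dst + t)) lo (lo + w)
        (lo + 2 * w) a b (lo + i) := fun v => hM.congr fun t _ ht => by
      rw [Function.update_of_ne (by omega)]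
    simp only [run_seq, run_iset, run_cond, run_iload, run_istore]
    simp only [holds_conj, holds_neg, holds_lt, eval_V, eval_add, eval_mul, eval_lit, cost_V,
      cost_add, cost_mul, cost_lit, cost_lt, cost_conj, cost_neg, Function.update_apply, h24, h25,
      h26, e22, e23, e9, e10, Nat.reduceEqDiff, if_false, if_true]
    refine ⟨⟨by omega, by omega⟩, ⟨by omega, by omega⟩, fun h => ⟨⟨by omega, by omega⟩, ?_⟩,
      fun h => ⟨⟨by omega, by omega⟩, ?_⟩⟩
    · refine ⟨by omega, by push_cast; ring, fun y hy => ?_, a + 1, b, by simp, rfl, ?_⟩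
      · rw [if_neg (by omega), hm y hy]
      have ha : a < lo + w := by omega
      have hab : b < lo + 2 * w → f a ≤ f b := by
        intro hb
        rw [← hfs a (by omega), ← hfs b (by omega)]
        have := h.2
        push Not at this
        exact this (by omega)
      have := (hcongr (f a)).stepA h₁ ha hab (by simp)
      simp only [Function.update_apply, ← hfs a (by omega)] at this
      exact this
    · have hab : ¬ (a < lo + w ∧ (b < lo + 2 * w → f a ≤ f b)) := by
        rintro ⟨ha, hab⟩
        refine h ⟨by omega, fun h' => ?_⟩
        rw [hfs a (by omega)] at h'
        rw [hfs b (by omega)] at h'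
        have := hab (by omega)
        omega
      refine ⟨by omega, by push_cast; ring, fun y hy => ?_, a, b + 1, rfl, by simp, ?_⟩
      · rw [if_neg (by omega), hm y hy]
      have hb : b < lo + 2 * w := by
        by_contra hb
        exact hab ⟨by omega, fun h => absurd h hb⟩
      have hab' : a < lo + w → f b ≤ f a := fun ha => by
        by_contra h'
        exact hab ⟨ha, fun _ => by omega⟩
      have := (hcongr (f b)).stepB h₂ hb hab' (by simp)
      simp only [Function.update_apply, ← hfs b (by omega)] at this
      exact this
  · refine ⟨by simp [h23], fun _ _ => rfl, lo, lo + w, by simp [h23], by simp [h22, h23], ?_⟩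
    refine ⟨le_rfl, by omega, le_rfl, by omega, by omega, fun i j _ _ _ => by omega,
      fun _ t _ _ => by omega, fun _ t _ _ => by omega, fun v => ?_⟩
    constructor
    · rintro ⟨t, _, _, _⟩; omega
    · rintro ⟨t, _, _⟩; omega
  · rintro t s' ⟨ht, -, hm, a, b, -, -, hM⟩
    have hla := hM.la
    have ham := hM.am
    have hmb := hM.mb
    have hbh := hM.bh
    have hk := hM.hk
    simp at ht
    refine ⟨by simp; omega, hm, hM.sorted, fun v => (hM.same v).trans (exists_congr fun t => ?_)⟩
    rw [← and_assoc]
    exact and_congr_left fun _ => by omega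

/-- The array `f` of length `N` is sorted on each block of length `w`. -/
def BlockSorted (f : ℕ → ℤ) (w N : ℕ) : Prop :=
  ∀ q, (q + 1) * w ≤ N → SortedOn f (q * w) ((q + 1) * w)

/-- Merges all pairs of blocks. -/
def mergePass : Prog :=
  .iset 23 (lit 0) ;;
  .loop (lt (V 23) (V 5)) (mergeBlock ;; .iset 23 (V 23 + lit 2 * V 22))

theorem mergePass_run {S : ℕ} {s : State} {src dst w n N : ℕ} {f : ℕ → ℤ}
    (h5 : s.ireg 5 = N) (h9 : s.ireg 9 = src) (h10 : s.ireg 10 = dst) (h22 : s.ireg 22 = w)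
    (hdisj : src + N ≤ dst ∨ dst + N ≤ src) (hw : 0 < w) (hN : N = n * (2 * w))
    (hsrc : src + N < S) (hdst : dst + N < S) (hf : ∀ t < N, s.imem (src + t) = f t)
    (hs : BlockSorted f w N) :
    Run S mergePass s fun t s' => t ≤ N * 120 + 10 ∧
      (∀ y : ℤ, ¬ (dst ≤ y ∧ y < dst + N) → s'.imem y = s.imem y) ∧
      BlockSorted (fun t => s'.imem (dst + t)) (2 * w) N ∧
      SameOn f (fun t => s'.imem (dst + t)) 0 N := by
  unfold mergePass
  simp only [run_seq, run_iset]
  refine (run_for n (2 * w * 60 + 50) (fun i s' => s'.ireg 23 = (i * (2 * w) : ℕ) ∧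
      (∀ y : ℤ, ¬ (dst ≤ y ∧ y < dst + N) → s'.imem y = s.imem y) ∧
      (∀ q < i, SortedOn (fun t => s'.imem (dst + t)) (q * (2 * w)) ((q + 1) * (2 * w))) ∧
      SameOn f (fun t => s'.imem (dst + t)) 0 (i * (2 * w))) ?_ ?_ ?_).mono ?_
  · rintro i s1 hf1 ⟨h23, -⟩
    have e5 : s1.ireg 5 = N := by simp [hf1.ireg 5 (by decide), h5]
    simp only [holds_lt, eval_V, h23, e5, hN, Nat.cast_lt]
    exact Nat.mul_lt_mul_right (by omega)
  · rintro i s1 hi hf1 ⟨h23, hm, hsort, hsame⟩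
    have e22 : s1.ireg 22 = w := by simp [hf1.ireg 22 (by decide), h22]
    have e9 : s1.ireg 9 = src := by simp [hf1.ireg 9 (by decide), h9]
    have e10 : s1.ireg 10 = dst := by simp [hf1.ireg 10 (by decide), h10]
    have hle : (i + 1) * (2 * w) ≤ N := hN ▸ Nat.mul_le_mul_right _ hi
    have e1 : (i + 1) * (2 * w) = i * (2 * w) + 2 * w := by ring
    -- The `i`-th block of length `2 * w` is made of the blocks `2 * i` and `2 * i + 1` of length
    -- `w`.
    have hs1 := hs (2 * i) (by nlinarith)
    have hs2 := hs (2 * i + 1) (by nlinarith)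
    rw [show 2 * i * w = i * (2 * w) by ring,
      show (2 * i + 1) * w = i * (2 * w) + w by ring] at hs1
    rw [show (2 * i + 1 + 1) * w = i * (2 * w) + 2 * w by ring,
      show (2 * i + 1) * w = i * (2 * w) + w by ring] at hs2
    rw [run_seq]
    refine (mergeBlock_run e9 e10 e22 h23 hdisj (by omega) hsrc hdst
      (fun t ht => by rw [hm _ (by omega), hf t ht]) hs1 hs2).frame.mono ?_
    rintro t s2 ⟨⟨ht, hm2, hsort2, hsame2⟩, hf2⟩
    have hold : ∀ t : ℕ, t < i * (2 * w) → s2.imem (dst + t) = s1.imem (dst + t) := fun t ht =>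
      hm2 _ (by omega)
    rw [run_iset]
    refine ⟨by simp; omega, ?_, fun y hy => ?_, fun q hq => ?_, fun v => ?_⟩
    · simp [hf2.ireg 23 (by decide), hf2.ireg 22 (by decide), h23, e22]
      ring
    · rw [hm2 _ (by omega), hm _ hy]
    · obtain hq | rfl := Nat.lt_succ_iff_lt_or_eq.1 hq
      · intro x y h1 h2 h3
        have : (q + 1) * (2 * w) ≤ i * (2 * w) := Nat.mul_le_mul_right _ hq
        simp only
        rw [hold x (by omega), hold y (by omega)]
        exact hsort q hq x y h1 h2 h3
      · rwa [e1]
    · have e := hsame v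
      have e' := hsame2 v
      rw [e1]
      constructor
      · rintro ⟨t, -, h2, h3⟩
        by_cases htt : t < i * (2 * w)
        · obtain ⟨t', h1', h2', h3'⟩ := e.1 ⟨t, by omega, htt, by rw [← h3]; exact (hold t htt).symm⟩
          exact ⟨t', h1', by omega, h3'⟩
        · obtain ⟨t', h1', h2', h3'⟩ := e'.1 ⟨t, by omega, h2, h3⟩
          exact ⟨t', by omega, h2', h3'⟩
      · rintro ⟨t, -, h2, h3⟩
        by_cases htt : t < i * (2 * w)
        · obtain ⟨t', h1', h2', h3'⟩ := e.2 ⟨t, by omega, htt, h3⟩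
          exact ⟨t', h1', by omega, (hold t' h2').trans h3'⟩
        · obtain ⟨t', h1', h2', h3'⟩ := e'.2 ⟨t, by omega, h2, h3⟩
          exact ⟨t', by omega, h2', h3'⟩
  · refine ⟨by simp, fun _ _ => rfl, by simp, fun v => by simp⟩
  · rintro t s' ⟨ht, -, hm, hsort, hsame⟩
    rw [← hN] at hsame
    refine ⟨?_, hm, fun q hq => hsort q ?_, hsame⟩
    · simp at ht ⊢
      have : n * (4 + (2 * w * 60 + 50)) ≤ n * (2 * w) * 100 := by nlinarith
      rw [← hN] at this
      omega
    · rw [hN] at hq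
      exact Nat.le_of_mul_le_mul_right hq (by omega)

/-- Sorts the array at the address in register 9, whose length is a power of two, with the array at
the address in register 10 as auxiliary space; register 9 finally holds the address of the
result. -/
def mergeSort : Prog :=
  .iset 22 (lit 1) ;;
  .loop (lt (V 22) (V 5))
    (mergePass ;;
     .iset 23 (V 9) ;;
     .iset 9 (V 10) ;;
     .iset 10 (V 23) ;;
     .iset 22 (lit 2 * V 22))

/-- Each pass doubles the sorted blocks and exchanges the roles of the two arrays, so `H` passes
leave one block, in an array that depends on the parity of `H`. `SameOn` compares sets of values
without multiplicities, which is enough for a dictionary. -/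
theorem mergeSort_run {S : ℕ} {s : State} {src dst H : ℕ} {f : ℕ → ℤ}
    (h5 : s.ireg 5 = (2 ^ H : ℕ)) (h9 : s.ireg 9 = src) (h10 : s.ireg 10 = dst)
    (hdisj : src + 2 ^ H ≤ dst) (hS : dst + 2 ^ H < S)
    (hf : ∀ t : ℕ, t < 2 ^ H → s.imem (src + t) = f t) :
    Run S mergeSort s fun t s' => t ≤ H * (2 ^ H * 120 + 50) + 20 ∧
      ∃ res : ℕ, s'.ireg 9 = res ∧ (res = src ∨ res = dst) ∧
      (∀ y : ℤ, y < src → s'.imem y = s.imem y) ∧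
      SortedOn (fun t => s'.imem (res + t)) 0 (2 ^ H) ∧
      SameOn f (fun t => s'.imem (res + t)) 0 (2 ^ H) := by
  unfold mergeSort
  simp only [run_seq, run_iset]
  refine (run_for H (2 ^ H * 120 + 30) (fun i s' => s'.ireg 22 = (2 ^ i : ℕ) ∧
      (∀ y : ℤ, y < src → s'.imem y = s.imem y) ∧
      ∃ a b : ℕ, (a = src ∧ b = dst ∨ a = dst ∧ b = src) ∧ s'.ireg 9 = a ∧ s'.ireg 10 = b ∧
        BlockSorted (fun t => s'.imem (a + t)) (2 ^ i) (2 ^ H) ∧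
        SameOn f (fun t => s'.imem (a + t)) 0 (2 ^ H)) ?_ ?_ ?_).mono ?_
  · rintro i s1 hf1 ⟨h22, -⟩
    have e5 : s1.ireg 5 = (2 ^ H : ℕ) := by simp [hf1.ireg 5 (by decide), h5]
    simp only [holds_lt, eval_V, h22, e5, Nat.cast_lt]
    exact Nat.pow_lt_pow_iff_right (by decide)
  · rintro i s1 hi hf1 ⟨h22, hm, a, b, hab, h9, h10, hsort, hsame⟩
    have e5 : s1.ireg 5 = (2 ^ H : ℕ) := by simp [hf1.ireg 5 (by decide), h5]
    have hS' : a + 2 ^ H < S ∧ b + 2 ^ H < S ∧ (a + 2 ^ H ≤ b ∨ b + 2 ^ H ≤ a) := by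
      have h2 : 0 < 2 ^ H := by positivity
      clear e5
      omega
    rw [run_seq]
    refine (mergePass_run (f := fun t => s1.imem (a + t)) (n := 2 ^ (H - (i + 1))) e5 h9 h10 h22
      hS'.2.2 (by positivity) ?_ hS'.1 hS'.2.1 (fun _ _ => rfl) hsort).frame.mono ?_
    · rw [← pow_succ', ← pow_add]
      congr 1
      omega
    rintro t s2 ⟨⟨ht, hm2, hsort2, hsame2⟩, hf2⟩
    simp only [run_seq, run_iset]
    refine ⟨by simp; omega, ?_, fun y hy => ?_, b, a, by omega, ?_, ?_, ?_, fun v => ?_⟩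
    · simp [hf2.ireg 22 (by decide), h22]
      ring
    · rw [hm2 _ (by omega), hm _ hy]
    · simp [hf2.ireg 10 (by decide), h10]
    · simp [hf2.ireg 9 (by decide), h9]
    · rwa [pow_succ']
    · exact (hsame2 v).trans (hsame v)
  · refine ⟨by simp, fun _ _ => rfl, src, dst, by simp, by simp [h9], by simp [h10], ?_, ?_⟩
    · intro q hq i j h1 h2 h3
      obtain rfl : i = j := by omega
      exact le_rfl
    · intro v
      refine exists_congr fun t => and_congr_right fun _ => and_congr_right fun ht => ?_
      rw [← hf t ht]
  · rintro t s' ⟨ht, -, hm, a, b, hab, h9, -, hsort, hsame⟩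
    simp at ht
    refine ⟨by simp; nlinarith, a, h9, by omega, hm, ?_, hsame⟩
    simpa using hsort 0 (by simp)

/-! ## The query -/

/-- Loads the header of the data structure. -/
def loadHeader : Prog :=
  .iload 1 (lit 0) ;;
  .iload 2 (lit 1) ;;
  .iload 3 (lit 2) ;;
  .iload 5 (lit 3) ;;
  .iload 7 (lit 4) ;;
  .iload 9 (lit 5) ;;
  .rload 3 (lit 0) ;;
  .iset 6 (lit 2 * V 7)

/-- Computes in register 19 the key of the query curve. -/
def queryKey : Prog :=
  .iset 19 (lit 0) ;;
  .iset 16 (lit 0) ;;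
  .loop (lt (V 16) (V 1 * V 2))
    (.iset 17 (V 16 / V 2) ;;
     .read 6 (lit 0) (V 17) (V 16 - V 2 * V 17) ;;
     .floor 18 (F 6 / F 3) ;;
     .iset 19 (V 19 * V 6 + (V 18 + V 7)) ;;
     .iset 16 (V 16 + lit 1))

/-- The fine coordinates of a curve given by its table of coordinates. -/
noncomputable def gridCoord (δ : ℝ) (d : ℕ) (q : ℤ → ℤ → ℝ) (t : ℕ) : ℤ :=
  ⌊q (t / d : ℕ) (t % d : ℕ) / δ⌋

/-- No range check is made: a query with a coordinate out of range is far from all input curves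
(`inRange_gridOf`), and then every answer is correct. -/
theorem queryKey_run {S : ℕ} {s : State} {m d : ℕ} {B off : ℤ} (h1 : s.ireg 1 = m)
    (h2 : s.ireg 2 = d) (h6 : s.ireg 6 = B) (h7 : s.ireg 7 = off) :
    Run S queryKey s fun t s' => t ≤ m * d * 50 + 20 ∧
      s'.ireg 19 = key B off (gridCoord (s.rreg 3) d (s.inp 0)) (m * d) := by
  unfold queryKey
  simp only [run_seq, run_iset]
  refine (run_for (m * d) 35 (fun i s' => s'.ireg 16 = i ∧
      s'.ireg 19 = key B off (gridCoord (s.rreg 3) d (s.inp 0)) i) ?_ ?_ ?_).mono ?_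
  · rintro i s1 hf ⟨h16, -⟩
    simp [h16, hf.ireg 1 (by decide), hf.ireg 2 (by decide), h1, h2]
    norm_cast
  · rintro i s1 hi hf ⟨h16, h19⟩
    have e2 : s1.ireg 2 = d := by simp [hf.ireg 2 (by decide), h2]
    have e6 : s1.ireg 6 = B := by simp [hf.ireg 6 (by decide), h6]
    have e7 : s1.ireg 7 = off := by simp [hf.ireg 7 (by decide), h7]
    have r3 : s1.rreg 3 = s.rreg 3 := by simp [hf.rreg 3 (by decide)]
    have hin : s1.inp = s.inp := hf.inp
    simp only [run_seq, run_iset, run_read, run_floor]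
    simp [h16, h19, e2, e6, e7, r3, hin, key, gridCoord, Int.emod_def]
  · simp [key]
  · rintro t s' ⟨ht, -, h19⟩
    simp at ht
    exact ⟨by simp; omega, h19⟩

/-- Searches the sorted array at the address in register 9, whose length is a power of two, for the
last member that is at most register 21; loads this into register 18. -/
def search : Prog :=
  .iset 16 (lit 0) ;;
  .iset 17 (V 5) ;;
  .loop (lt (lit 1) (V 17))
    (.iset 17 (V 17 / lit 2) ;;
     .iload 18 (V 9 + (V 16 + V 17)) ;;
     .cond (.ile (V 18) (V 21)) (.iset 16 (V 16 + V 17)) .skip) ;;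
  .iload 18 (V 9 + V 16)

/-- The window of candidates starts at `pos` and has length `2 ^ (H - i)`; all members behind it
exceed the target. The member 0 is never compared, whence the alternative `pos = 0`. -/
theorem search_run {S : ℕ} {s : State} {base H : ℕ} {f : ℕ → ℤ} (h5 : s.ireg 5 = (2 ^ H : ℕ))
    (h9 : s.ireg 9 = base) (hS : base + 2 ^ H < S)
    (hf : ∀ t : ℕ, t < 2 ^ H → s.imem (base + t) = f t) (hs : SortedOn f 0 (2 ^ H)) :
    Run S search s fun t s' => t ≤ H * 40 + 30 ∧
      ∃ pos < 2 ^ H, s'.ireg 18 = f pos ∧ (pos = 0 ∨ f pos ≤ s.ireg 21) ∧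
        ∀ k, pos < k → k < 2 ^ H → s.ireg 21 < f k := by
  unfold search
  simp only [run_seq, run_iset]
  refine (run_for H 25 (fun i s' => s'.ireg 17 = (2 ^ (H - i) : ℕ) ∧ ∃ pos : ℕ,
      s'.ireg 16 = pos ∧ pos + 2 ^ (H - i) ≤ 2 ^ H ∧ (pos = 0 ∨ f pos ≤ s.ireg 21) ∧
        ∀ k, pos + 2 ^ (H - i) ≤ k → k < 2 ^ H → s.ireg 21 < f k) ?_ ?_ ?_).frame.mono ?_
  · rintro i s1 hf1 ⟨h17, -⟩
    simp only [holds_lt, eval_lit, eval_V, h17]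
    rw [show (1 : ℤ) = (1 : ℕ) from rfl, Nat.cast_lt, Nat.one_lt_two_pow_iff]
    omega
  · rintro i s1 hi hf1 ⟨h17, pos, h16, hle, hpos, hgt⟩
    have e9 : s1.ireg 9 = base := by simp [hf1.ireg 9 (by decide), h9]
    have e21 : s1.ireg 21 = s.ireg 21 := by simp [hf1.ireg 21 (by decide)]
    have him : s1.imem = s.imem := hf1.imem (by decide)
    obtain ⟨j, hj⟩ : ∃ j, H - i = j + 1 := ⟨H - i - 1, by omega⟩
    have hj' : H - (i + 1) = j := by omega
    rw [hj] at h17 hle hgt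
    rw [hj']
    have hp : 2 ^ (j + 1) = 2 ^ j + 2 ^ j := by ring
    rw [hp] at h17 hle hgt
    have hj0 : 0 < 2 ^ j := by positivity
    have hdiv : ((2 ^ j + 2 ^ j : ℕ) : ℤ) / 2 = (2 ^ j : ℕ) := by omega
    have hl := hf (pos + 2 ^ j) (by omega)
    rw [← Nat.cast_add] at hl
    simp only [run_seq, run_iset, run_iload, run_cond, run_skip]
    simp only [holds_ile, eval_V, eval_add, eval_div, eval_lit, cost_V, cost_add, cost_div,
      cost_lit, cost_ile, Function.update_apply, h16, h17, e9, e21, him, hdiv, Nat.reduceEqDiff,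
      if_false, if_true, ← Nat.cast_add, hl]
    refine ⟨⟨by omega, by omega⟩, fun h => ⟨by omega, trivial, pos + 2 ^ j, rfl, by omega, .inr h, ?_⟩,
      fun h => ⟨by omega, trivial, pos, rfl, by omega, hpos, ?_⟩⟩
    · intro k hk hk'
      exact hgt k (by omega) hk'
    · intro k hk hk'
      exact (not_le.1 h).trans_le (hs _ _ (Nat.zero_le _) hk hk')
  · refine ⟨by simp [h5], 0, by simp, by simp, .inl rfl, fun k hk hk' => ?_⟩
    simp at hk
    omega
  · rintro t s' ⟨⟨ht, -, pos, h16, hle, hpos, hgt⟩, hf1⟩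
    have e9 : s'.ireg 9 = base := by simp [hf1.ireg 9 (by decide), h9]
    have him : s'.imem = s.imem := hf1.imem (by decide)
    simp at ht hle hgt
    simp only [run_iload, eval_V, eval_add, e9, h16, him, hf pos hle]
    exact ⟨⟨by omega, by omega⟩, by simp; omega, pos, hle, by simp, hpos,
      fun k hk hk' => hgt k hk hk'⟩

/-- The query program. -/
def query : Prog :=
  loadHeader ;;
  queryKey ;;
  .iset 21 (V 19 * V 3 + (V 3 - lit 1)) ;;
  search ;;
  .iset 0 (V 18 - V 3 * (V 18 / V 3))

/-- The header of the data structure in the memory. -/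
structure Header (m d n' N base : ℕ) (off : ℤ) (δ : ℝ) (s : State) : Prop where
  m : s.imem 0 = m
  d : s.imem 1 = d
  n' : s.imem 2 = n'
  N : s.imem 3 = N
  off : s.imem 4 = off
  base : s.imem 5 = base
  δ : s.rmem 0 = δ

/-- The target is the key of the rounded query followed by the largest index `n' - 1`, hence an
upper bound for all entries with this key. -/
theorem query_run {S : ℕ} {s : State} {m d n' base H : ℕ} {off : ℤ} {δ : ℝ} {f : ℕ → ℤ}
    (hh : Header m d n' (2 ^ H) base off δ s) (hS : base + 2 ^ H < S) (hS8 : 8 ≤ S)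
    (hf : ∀ t : ℕ, t < 2 ^ H → s.imem (base + t) = f t) (hs : SortedOn f 0 (2 ^ H)) :
    Run S query s fun t s' => t ≤ m * d * 50 + H * 40 + 200 ∧
      ∃ pos < 2 ^ H, s'.ireg 0 = f pos % n' ∧
        (pos = 0 ∨ f pos ≤ key (2 * off) off (gridCoord δ d (s.inp 0)) (m * d) * n' + (n' - 1)) ∧
        ∀ k, pos < k → k < 2 ^ H →
          key (2 * off) off (gridCoord δ d (s.inp 0)) (m * d) * n' + (n' - 1) < f k := by
  unfold query
  rw [run_seq]
  have h0 : Run S loadHeader s fun t s' => t ≤ 40 ∧ s'.ireg 1 = m ∧ s'.ireg 2 = d ∧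
      s'.ireg 3 = n' ∧ s'.ireg 5 = (2 ^ H : ℕ) ∧ s'.ireg 6 = 2 * off ∧ s'.ireg 7 = off ∧
      s'.ireg 9 = base ∧ s'.rreg 3 = δ := by
    unfold loadHeader
    simp only [run_seq, run_iset, run_iload, run_rload]
    have : (8 : ℤ) ≤ S := by exact_mod_cast hS8
    simp [hh.m, hh.d, hh.n', hh.N, hh.off, hh.base, hh.δ]
    omega
  refine h0.frame.mono ?_
  rintro t1 s1 ⟨⟨ht1, e1, e2, e3, e5, e6, e7, e9, r3⟩, hf1⟩
  rw [run_seq]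
  refine (queryKey_run e1 e2 e6 e7).frame.mono ?_
  rintro t2 s2 ⟨⟨ht2, h19⟩, hf2⟩
  rw [r3, hf1.inp] at h19
  have him : s2.imem = s.imem := by rw [hf2.imem (by decide), hf1.imem (by decide)]
  have e3' := (hf2.ireg 3 (by decide)).trans e3
  simp only [run_seq, run_iset]
  refine (search_run (f := f) (H := H) (base := base) ?_ ?_ hS ?_ hs).frame.mono ?_
  · simp [hf2.ireg 5 (by decide), e5]
  · simp [hf2.ireg 9 (by decide), e9]
  · simpa [him] using hf
  rintro t3 s3 ⟨⟨ht3, pos, hpos, h18, hle, hgt⟩, hf3⟩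
  have e3'' : s3.ireg 3 = n' := by simp [hf3.ireg 3 (by decide), e3']
  have e21 : ∀ u, Function.update s2.ireg 21 u 21 = u := fun u => by simp
  simp only [e21, eval_add, eval_mul, eval_sub, eval_V, eval_lit, h19, e3'] at hle hgt
  refine ⟨by simp; omega, pos, hpos, ?_, hle, hgt⟩
  simp [h18, e3'', Int.emod_def]

/-! ## The preprocessing -/

/-- Computes the sizes: the least power of two `n' ≥ n` in register 3, the least power of two
`M ≥ 2 / ε` in register 4 and the number of codes in register 5. -/
def sizes : Prog :=
  .iset 3 (lit 1) ;;
  .loop (lt (V 3) (V 0)) (.iset 3 (lit 2 * V 3)) ;;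
  .iset 4 (lit 1) ;;
  .loop (.neg (.rle (toR (lit 2)) (toR (V 4) * F 0))) (.iset 4 (lit 2 * V 4)) ;;
  .iset 5 (V 3) ;;
  .iset 16 (lit 0) ;;
  .loop (lt (V 16) (V 1 * V 2))
    (.iset 5 (V 5 * (V 4 * lit 65536)) ;;
     .iset 16 (V 16 + lit 1))

/-- The least power of two that satisfies a monotone condition is found by doubling. -/
theorem exists_least_pow {P : ℕ → Prop} (h : ∃ k, P (2 ^ k)) :
    ∃ ν, P (2 ^ ν) ∧ ∀ i < ν, ¬ P (2 ^ i) := by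
  classical
  exact ⟨Nat.find h, Nat.find_spec h, fun i hi => Nat.find_min h hi⟩

/-- Minimality of the two powers of two yields the upper bounds `2 * n` and `4`, on which the space
bound rests. As `n'`, `M` and `65536` are powers of two, so is the number of codes, which keeps
sorting and searching free of rounding. -/
theorem sizes_run {s : State} {n m d : ℕ} {ε : ℝ} (h0 : s.ireg 0 = n) (h1 : s.ireg 1 = m)
    (h2 : s.ireg 2 = d) (hr : s.rreg 0 = ε) (hn : 1 ≤ n) (hε : 0 < ε) (hε1 : ε ≤ 1) :
    ∃ ν μ : ℕ, n ≤ 2 ^ ν ∧ 2 ^ ν ≤ 2 * n ∧ 2 ≤ 2 ^ μ * ε ∧ 2 ^ μ * ε ≤ 4 ∧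
    ∀ S, Run S sizes s fun t s' => t ≤ (ν + μ + m * d) * 30 + 50 ∧ s'.ireg 3 = (2 ^ ν : ℕ) ∧
      s'.ireg 4 = (2 ^ μ : ℕ) ∧ s'.ireg 5 = (2 ^ (ν + (m * d) * (μ + 16)) : ℕ) := by
  obtain ⟨ν, hν, hν'⟩ := exists_least_pow (P := fun k => n ≤ k) ⟨n, Nat.lt_two_pow_self.le⟩
  obtain ⟨μ, hμ, hμ'⟩ := exists_least_pow (P := fun k => 2 ≤ (k : ℝ) * ε) (by
    obtain ⟨k, hk⟩ := pow_unbounded_of_one_lt (2 / ε) (one_lt_two : (1 : ℝ) < 2)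
    exact ⟨k, by rw [div_lt_iff₀ hε] at hk; push_cast; exact hk.le⟩)
  push_cast at hμ hμ'
  refine ⟨ν, μ, hν, ?_, hμ, ?_, ?_⟩
  · obtain _ | k := ν
    · omega
    · have := hν' k (by omega)
      rw [pow_succ]
      omega
  · obtain _ | k := μ
    · simp at hμ; linarith
    · have := hμ' k (by omega)
      rw [pow_succ]
      linarith
  intro S
  unfold sizes
  simp only [run_seq, run_iset]
  refine (run_for ν 6 (fun i s' => s'.ireg 3 = (2 ^ i : ℕ) ∧ i ≤ ν) ?_ ?_ ?_).frame.mono ?_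
  · rintro i s1 hf1 ⟨h3, hi⟩
    simp only [holds_lt, eval_V, h3, hf1.ireg 0 (by decide)]
    simp only [Function.update_of_ne (show (0 : ℕ) ≠ 3 by decide), h0, Nat.cast_lt]
    obtain hi | rfl := hi.lt_or_eq
    · have := hν' i hi
      omega
    · omega
  · rintro i s1 hi hf1 ⟨h3, -⟩
    rw [run_iset]
    refine ⟨by simp, ?_, hi⟩
    simp [h3, pow_succ']
  · simp
  rintro t1 s1 ⟨⟨ht1, h3, -⟩, hf1⟩
  have e0 : s1.ireg 0 = n := by simp [hf1.ireg 0 (by decide), h0]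
  have e1 : s1.ireg 1 = m := by simp [hf1.ireg 1 (by decide), h1]
  have e2 : s1.ireg 2 = d := by simp [hf1.ireg 2 (by decide), h2]
  have er : s1.rreg 0 = ε := by simp [hf1.rreg 0 (by decide), hr]
  refine (run_for μ 6 (fun i s' => s'.ireg 4 = (2 ^ i : ℕ) ∧ i ≤ μ) ?_ ?_ ?_).frame.mono ?_
  · rintro i s2 hf2 ⟨h4, hi⟩
    simp only [holds_neg, holds_rle, eval_toR, eval_lit, reval_mul, eval_V, eval_F, h4,
      hf2.rreg 0 (by decide), er]
    push_cast
    obtain hi | rfl := hi.lt_or_eq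
    · exact iff_of_true (hμ' i hi) hi
    · exact iff_of_false (not_not.2 hμ) (lt_irrefl _)
  · rintro i s2 hi hf2 ⟨h4, -⟩
    rw [run_iset]
    refine ⟨by simp, ?_, hi⟩
    simp [h4, pow_succ']
  · simp
  rintro t2 s2 ⟨⟨ht2, h4, -⟩, hf2⟩
  have e1 : s2.ireg 1 = m := by simp [hf2.ireg 1 (by decide), e1]
  have e2 : s2.ireg 2 = d := by simp [hf2.ireg 2 (by decide), e2]
  have e3 : s2.ireg 3 = (2 ^ ν : ℕ) := by simp [hf2.ireg 3 (by decide), h3]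
  refine (run_for (m * d) 20 (fun i s' => s'.ireg 16 = i ∧
    s'.ireg 5 = (2 ^ (ν + i * (μ + 16)) : ℕ)) ?_ ?_ ?_).frame.mono ?_
  · rintro i s3 hf3 ⟨h16, -⟩
    simp [h16, hf3.ireg 1 (by decide), hf3.ireg 2 (by decide), e1, e2]
    norm_cast
  · rintro i s3 hi hf3 ⟨h16, h5⟩
    have e4 : s3.ireg 4 = (2 ^ μ : ℕ) := by simp [hf3.ireg 4 (by decide), h4]
    simp only [run_seq, run_iset]
    refine ⟨by simp, by simp [h16], ?_⟩
    simp [h5, e4]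
    ring
  · simp [e3]
  rintro t3 s3 ⟨⟨ht3, -, h5⟩, hf3⟩
  simp at ht1 ht2 ht3
  refine ⟨by simp; omega, ?_, ?_, h5⟩
  · simp [hf3.ireg 3 (by decide), e3]
  · simp [hf3.ireg 4 (by decide), h4]

/-- Computes the sides `δ` and `D` of the two grids, and the sum of the absolute values of the
coordinates of all input curves in real register 5. -/
def sides : Prog :=
  .rset 4 (F 1 / (.pow (toR (lit 2 * V 1)) (toR (lit 1) / F 2) *
    .pow (toR (V 2)) (toR (lit 1) / toR (lit 2)))) ;;
  .rset 3 (F 4 / toR (V 4)) ;;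
  .rset 5 (toR (lit 0)) ;;
  .iset 16 (lit 0) ;;
  .loop (lt (V 16) (V 0 * (V 1 * V 2)))
    (.iset 17 (V 16 / V 2) ;;
     .iset 18 (V 17 / V 1) ;;
     .read 6 (V 18) (V 17 - V 1 * V 18) (V 16 - V 2 * V 17) ;;
     .rset 5 (F 5 + .pow (F 6) (toR (lit 1))) ;;
     .iset 16 (V 16 + lit 1))

/-- The coarse side. -/
noncomputable def coarseSide (m d : ℕ) (r p : ℝ) : ℝ :=
  r / ((2 * m) ^ (1 / p) * (d : ℝ) ^ (1 / 2 : ℝ))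

/-- The sum of the absolute values of all coordinates of a table of curves. -/
noncomputable def absSum (n m d : ℕ) (q : ℤ → ℤ → ℤ → ℝ) : ℝ :=
  ∑ t ∈ Finset.range (n * (m * d)), |q (t / d / m : ℕ) (t / d % m : ℕ) (t % d : ℕ)|

theorem sides_run {S : ℕ} {s : State} {n m d M : ℕ} (h0 : s.ireg 0 = n) (h1 : s.ireg 1 = m)
    (h2 : s.ireg 2 = d) (h4 : s.ireg 4 = M) :
    Run S sides s fun t s' => t ≤ n * (m * d) * 50 + 50 ∧
      s'.rreg 4 = coarseSide m d (s.rreg 1) (s.rreg 2) ∧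
      s'.rreg 3 = coarseSide m d (s.rreg 1) (s.rreg 2) / M ∧
      s'.rreg 5 = absSum n m d s.inp := by
  unfold sides
  simp only [run_seq, run_iset, run_rset]
  refine (run_for (n * (m * d)) 40 (fun i s' => s'.ireg 16 = i ∧ s'.rreg 5 =
    ∑ t ∈ Finset.range i, |s.inp (t / d / m : ℕ) (t / d % m : ℕ) (t % d : ℕ)|)
    ?_ ?_ ?_).frame.mono ?_
  · rintro i s1 hf1 ⟨h16, -⟩
    simp [h16, hf1.ireg 0 (by decide), hf1.ireg 1 (by decide), hf1.ireg 2 (by decide), h0, h1, h2]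
    norm_cast
  · rintro i s1 hi hf1 ⟨h16, h5⟩
    have e1 : s1.ireg 1 = m := by simp [hf1.ireg 1 (by decide), h1]
    have e2 : s1.ireg 2 = d := by simp [hf1.ireg 2 (by decide), h2]
    have hin : s1.inp = s.inp := hf1.inp
    simp only [run_seq, run_iset, run_rset, run_read]
    simp [h16, e1, e2, hin, h5, Finset.sum_range_succ, Int.emod_def]
  · simp
  · rintro t1 s1 ⟨⟨ht1, -, h5⟩, hf1⟩
    -- For `p = ∞` the register holds 0, and `1 / 0 = 0` on the machine as in `coarseSide`: the
    -- factor `(2m)^(1/p)` becomes 1, as it should.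
    have a0 : |(2 * m : ℝ)| = 2 * m := abs_of_nonneg (by positivity)
    simp at ht1
    refine ⟨by simp; omega, ?_, ?_, h5⟩
    · simp [hf1.rreg 4 (by decide), h1, h2, coarseSide, a0]
    · simp [hf1.rreg 3 (by decide), h1, h2, h4, coarseSide, a0]

/-- Computes the range of the digits of the keys, and the addresses of the two arrays. -/
def addresses : Prog :=
  .floor 7 ((F 5 + F 1) / F 3) ;;
  .iset 7 (V 7 + lit 2) ;;
  .iset 6 (lit 2 * V 7) ;;
  .iset 9 (lit 8 + V 1 * V 2) ;;
  .iset 10 (V 9 + V 5)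

/-- Fills the array at the address in register 9 with the entries of all codes. -/
def fill : Prog :=
  .iset 8 (lit 0) ;;
  .loop (lt (V 8) (V 5))
    (makeEntry ;;
     .istore (V 9 + V 8) (V 21) ;;
     .iset 8 (V 8 + lit 1))

-- Decoding writes only to the `m * d` coordinate cells below the array, so the entries stored
-- earlier survive.
set_option maxRecDepth 4000 in
theorem fill_run {S : ℕ} {E : Par} {s : State} {H : ℕ} (hE : Env E s) (hN : E.N = 2 ^ H)
    (h9 : s.ireg 9 = (8 + E.m * E.d : ℕ)) (hS : 8 + E.m * E.d + E.N ≤ S) :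
    Run S fill s fun t s' =>
      t ≤ 2 ^ H * (2 * E.m * (E.d * (40 * H + 120) + 140) + (E.m * E.d) * 50 + 230) + 10 ∧
      ∀ w : ℕ, w < 2 ^ H → ∃ z, s'.imem ((8 + E.m * E.d : ℕ) + w) = codeEntry E w z := by
  unfold fill
  simp only [run_seq, run_iset]
  have hE0 := fun u => hE.setI (i := 8) (by decide) u
  refine (run_for (2 ^ H) (2 * E.m * (E.d * (40 * H + 120) + 140) + (E.m * E.d) * 50 + 220)
    (fun i s' => s'.ireg 8 = i ∧ ∀ w : ℕ, w < i → ∃ z,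
      s'.imem ((8 + E.m * E.d : ℕ) + w) = codeEntry E w z) ?_ ?_ ?_).mono ?_
  · rintro i s1 hf1 ⟨h8, -⟩
    simp [h8, ((hE0 _).of_frame hf1 (by decide) (by decide)).N, hN]
    norm_cast
  · rintro i s1 hi hf1 ⟨h8, hw⟩
    have hE1 := (hE0 _).of_frame hf1 (by decide) (by decide)
    have e9 : s1.ireg 9 = (8 + E.m * E.d : ℕ) := by rw [hf1.ireg 9 (by decide)]; simp [h9]
    simp only [run_seq, run_iset, run_istore]
    refine (makeEntry_run hE1 h8 hi (by omega)).frame.mono ?_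
    rintro t s2 ⟨⟨ht, ⟨z, h21⟩, hm⟩, hf2⟩
    simp only [eval_add, eval_V, eval_lit, hf2.ireg 9 (by decide), hf2.ireg 8 (by decide), e9, h8,
      h21]
    refine ⟨⟨by omega, by omega⟩, by simp only [cost_add, cost_V, cost_lit]; omega, by simp, fun w hwi => ?_⟩
    obtain hwi | rfl := Nat.lt_succ_iff_lt_or_eq.1 hwi
    · obtain ⟨z', hz'⟩ := hw w hwi
      refine ⟨z', ?_⟩
      rw [Function.update_of_ne (by omega), hm _ (by omega), hz']
    · exact ⟨z, by simp⟩
  · simp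
  · rintro t s' ⟨ht, -, hw⟩
    simp at ht
    refine ⟨?_, hw⟩
    simp
    nlinarith [Nat.zero_le (2 ^ H)]

/-- Stores the header of the data structure. -/
def storeHeader : Prog :=
  .istore (lit 0) (V 1) ;;
  .istore (lit 1) (V 2) ;;
  .istore (lit 2) (V 3) ;;
  .istore (lit 3) (V 5) ;;
  .istore (lit 4) (V 7) ;;
  .istore (lit 5) (V 9) ;;
  .rstore (lit 0) (F 3)

/-- The preprocessing program. -/
def preprocess : Prog :=
  sizes ;; sides ;; addresses ;; fill ;; mergeSort ;; storeHeader

/-- The parameters that the preprocessing computes from the input, if `2 ^ ν` and `2 ^ μ` are the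
powers of two that it finds. -/
noncomputable def mkPar (n m d ν μ : ℕ) (ε r p : ℝ) (q : ℤ → ℤ → ℤ → ℝ) : Par where
  n := n
  m := m
  d := d
  n' := 2 ^ ν
  M := 2 ^ μ
  N := 2 ^ (ν + m * d * (μ + 16))
  off := ⌊(absSum n m d q + r) / (coarseSide m d r p / (2 ^ μ : ℕ))⌋ + 2
  B := 2 * (⌊(absSum n m d q + r) / (coarseSide m d r p / (2 ^ μ : ℕ))⌋ + 2)
  ε := ε
  r := r
  p := p
  δ := coarseSide m d r p / (2 ^ μ : ℕ)
  D := coarseSide m d r p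
  inp := q

/-- The data structure is in the memory: the header, and a sorted array that consists of entries of
all codes. -/
structure Built (E : Par) (H S : ℕ) (s : State) : Prop where
  exists_array : ∃ (base : ℕ) (f : ℕ → ℤ), Header E.m E.d E.n' (2 ^ H) base E.off E.δ s ∧
    base + 2 ^ H < S ∧ (∀ t : ℕ, t < 2 ^ H → s.imem (base + t) = f t) ∧ SortedOn f 0 (2 ^ H) ∧
    (∀ k < 2 ^ H, ∃ w < 2 ^ H, ∃ z, f k = codeEntry E w z) ∧
    ∀ w < 2 ^ H, ∃ k < 2 ^ H, ∃ z, f k = codeEntry E w z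

/-- The memory `S` is made of 8 header cells, `m * d` coordinate cells, two arrays of length `2 ^ H`
and one more cell for the reading past the end during a merge. -/
theorem preprocess_run {s : State} {n m d : ℕ} {ε r p : ℝ} {q : ℤ → ℤ → ℤ → ℝ}
    (h0 : s.ireg 0 = n) (h1 : s.ireg 1 = m) (h2 : s.ireg 2 = d) (hr0 : s.rreg 0 = ε)
    (hr1 : s.rreg 1 = r) (hr2 : s.rreg 2 = p) (hq : s.inp = q) (hn : 1 ≤ n) (hmd : 1 ≤ m * d)
    (hε : 0 < ε) (hε1 : ε ≤ 1) :
    ∃ ν μ H S : ℕ, n ≤ 2 ^ ν ∧ 2 ^ ν ≤ 2 * n ∧ 2 ≤ 2 ^ μ * ε ∧ 2 ^ μ * ε ≤ 4 ∧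
      H = ν + m * d * (μ + 16) ∧ S = 9 + m * d + 2 * 2 ^ H ∧
      Run S preprocess s fun t s' =>
        t ≤ (H + n * (m * d)) * 100 + H * (2 ^ H * 120 + 50) +
          2 ^ H * (2 * m * (d * (40 * H + 120) + 140) + (m * d) * 50 + 230) + 500 ∧
        Built (mkPar n m d ν μ ε r p q) H S s' := by
  obtain ⟨ν, μ, hν, hν', hμ, hμ', hrun⟩ := sizes_run h0 h1 h2 hr0 hn hε hε1
  refine ⟨ν, μ, _, _, hν, hν', hμ, hμ', rfl, rfl, ?_⟩
  set H := ν + m * d * (μ + 16) with hH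
  set S := 9 + m * d + 2 * 2 ^ H with hS
  set E := mkPar n m d ν μ ε r p q with hE
  unfold preprocess
  rw [run_seq]
  refine (hrun S).frame.mono ?_
  rintro t1 s1 ⟨⟨ht1, e3, e4, e5⟩, hf1⟩
  rw [run_seq]
  refine (sides_run ((hf1.ireg 0 (by decide)).trans h0) ((hf1.ireg 1 (by decide)).trans h1)
    ((hf1.ireg 2 (by decide)).trans h2) e4).frame.mono ?_
  rintro t2 s2 ⟨⟨ht2, r4, r3, r5⟩, hf2⟩
  rw [hf1.inp, hq] at r5
  rw [hf1.rreg 1 (by decide), hf1.rreg 2 (by decide), hr1, hr2] at r3 r4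
  have e0' : s2.ireg 0 = n := by rw [hf2.ireg 0 (by decide), hf1.ireg 0 (by decide), h0]
  have e1' : s2.ireg 1 = m := by rw [hf2.ireg 1 (by decide), hf1.ireg 1 (by decide), h1]
  have e2' : s2.ireg 2 = d := by rw [hf2.ireg 2 (by decide), hf1.ireg 2 (by decide), h2]
  have e3' : s2.ireg 3 = (2 ^ ν : ℕ) := by rw [hf2.ireg 3 (by decide), e3]
  have e4' : s2.ireg 4 = (2 ^ μ : ℕ) := by rw [hf2.ireg 4 (by decide), e4]
  have e5' : s2.ireg 5 = (2 ^ H : ℕ) := by rw [hf2.ireg 5 (by decide), e5]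
  have r0' : s2.rreg 0 = ε := by rw [hf2.rreg 0 (by decide), hf1.rreg 0 (by decide), hr0]
  have r1' : s2.rreg 1 = r := by rw [hf2.rreg 1 (by decide), hf1.rreg 1 (by decide), hr1]
  have r2' : s2.rreg 2 = p := by rw [hf2.rreg 2 (by decide), hf1.rreg 2 (by decide), hr2]
  have hin : s2.inp = q := by rw [hf2.inp, hf1.inp, hq]
  have h3 : Run S addresses s2 fun t s' => t ≤ 50 ∧ Env E s' ∧
      s'.ireg 9 = (8 + m * d : ℕ) ∧ s'.ireg 10 = (8 + m * d + 2 ^ H : ℕ) := by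
    unfold addresses
    simp only [run_seq, run_iset, run_floor]
    refine ⟨by simp, ?_, by simp [e1', e2'], by simp [e1', e2', e5']⟩
    constructor <;> simp [e0', e1', e2', e3', e4', e5', r0', r1', r2', r3, r4, r5, hin, hE, mkPar, hH]
  rw [run_seq]
  refine h3.mono ?_
  rintro t3 s3 ⟨ht3, hE3, e9, e10⟩
  rw [run_seq]
  refine (fill_run (S := S) (H := H) hE3 rfl e9 ?_).frame.mono ?_
  · change 8 + m * d + 2 ^ H ≤ S
    omega
  rintro t4 s4 ⟨⟨ht4, hfill⟩, hf4⟩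
  have hE4 := hE3.of_frame hf4 (by decide) (by decide)
  rw [run_seq]
  refine (mergeSort_run (src := 8 + m * d) (dst := 8 + m * d + 2 ^ H) (H := H)
    (f := fun t => s4.imem ((8 + m * d : ℕ) + t)) hE4.N ?_ ?_ le_rfl ?_
    (fun _ _ => rfl)).frame.mono ?_
  · rw [hf4.ireg 9 (by decide), e9]
  · rw [hf4.ireg 10 (by decide), e10]
  · omega
  rintro t5 s5 ⟨⟨ht5, res, e9', hres, -, hsort, hsame⟩, hf5⟩
  have hE5 := hE4.of_frame hf5 (by decide) (by decide)
  have hS8 : (8 : ℤ) ≤ S := by omega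
  have h6 : Run S storeHeader s5 fun t s' => t ≤ 50 ∧
      Header E.m E.d E.n' (2 ^ H) res E.off E.δ s' ∧
      ∀ y : ℤ, 8 ≤ y → s'.imem y = s5.imem y := by
    unfold storeHeader
    simp only [run_seq, run_istore, run_rstore]
    have hN : s5.ireg 5 = (2 ^ H : ℕ) := hE5.N
    simp [hE5.m, hE5.d, hE5.n', hN, hE5.off, hE5.δ, e9']
    refine ⟨by omega, by omega, by omega, by omega, by omega, by omega, by omega, ?_, ?_⟩
    · constructor <;> simp
    · intro y hy
      simp [Function.update_of_ne, show y ≠ 0 by omega, show y ≠ 1 by omega,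
        show y ≠ 2 by omega, show y ≠ 3 by omega, show y ≠ 4 by omega, show y ≠ 5 by omega]
  refine h6.mono ?_
  rintro t6 s6 ⟨ht6, hh, hm6⟩
  -- Either possible address of the sorted array is at least 8, so the header does not overwrite it.
  have hmem : ∀ t : ℕ, s6.imem (res + t) = s5.imem (res + t) := fun t => hm6 _ (by omega)
  refine ⟨?_, res, fun t => s5.imem (res + t), hh, ?_, fun t _ => hmem t, hsort, ?_, ?_⟩
  · have ht4' : t4 ≤ 2 ^ H * (2 * m * (d * (40 * H + 120) + 140) + (m * d) * 50 + 230) + 10 := ht4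
    have : ν + μ + m * d ≤ H := by
      rw [hH, mul_add]
      have := Nat.mul_le_mul_right μ hmd
      omega
    generalize 2 ^ H * (2 * m * (d * (40 * H + 120) + 140) + (m * d) * 50 + 230) = T at ht4' ⊢
    generalize H * (2 ^ H * 120 + 50) = T' at ht5 ⊢
    generalize n * (m * d) = T'' at ht2 ⊢
    omega
  · have : 0 < 2 ^ H := by positivity
    omega
  · intro k hk
    obtain ⟨t, -, ht, e⟩ := (hsame _).1 ⟨k, Nat.zero_le _, hk, rfl⟩
    obtain ⟨z, hz⟩ := hfill t ht
    exact ⟨t, ht, z, e.symm.trans hz⟩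
  · intro w hw
    obtain ⟨z, hz⟩ := hfill w hw
    obtain ⟨k, -, hk, e⟩ := (hsame _).2 ⟨w, Nat.zero_le _, hw, rfl⟩
    exact ⟨k, hk, z, e.trans hz⟩

/-! ## Codes for given curves -/

/-- The digits 2 and 1 change the displacement by `+1` and `-1`, so `|q|` of them and a final 0
suffice; the digit 3 is never needed. Bounding `x + 1` by a multiple of `y + 1` makes such estimates
compose by multiplication. -/
theorem exists_coarse (q : ℤ) (y : ℕ) :
    ∃ x, coarse x = (q, y) ∧ x + 1 ≤ 4 ^ (q.natAbs + 1) * (y + 1) := by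
  generalize hn : q.natAbs = n
  induction n generalizing q with
  | zero =>
    obtain rfl : q = 0 := by omega
    refine ⟨4 * y, ?_, by omega⟩
    rw [coarse, if_pos (by omega)]
    simp
  | succ n ih =>
    by_cases hq : 0 ≤ q
    · obtain ⟨x, hx, hb⟩ := ih (q - 1) (by omega)
      refine ⟨4 * x + 2, ?_, by rw [pow_succ 4 (n + 1)]; linarith⟩
      rw [coarse, if_neg (by omega), show (4 * x + 2) / 4 = x by omega, hx,
        show (4 * x + 2) % 4 = 2 by omega]
      simp
    · obtain ⟨x, hx, hb⟩ := ih (q + 1) (by omega)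
      refine ⟨4 * x + 1, ?_, by rw [pow_succ 4 (n + 1)]; linarith⟩
      rw [coarse, if_neg (by omega), show (4 * x + 1) / 4 = x by omega, hx,
        show (4 * x + 1) % 4 = 1 by omega]
      simp

/-- Division with remainder by `M` splits `Z` into its coarse cell, encoded relative to `g`, and the
position in the cell. -/
theorem exists_coord {M : ℕ} (hM : 0 < M) (g Z : ℤ) (y : ℕ) :
    ∃ x, coord M g x = (Z, y) ∧ x + 1 ≤ M * 4 ^ ((Z / M - g).natAbs + 1) * (y + 1) := by
  obtain ⟨x, hx, hb⟩ := exists_coarse (Z / M - g) y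
  have hM' : (0 : ℤ) < M := by exact_mod_cast hM
  have h0 := Int.emod_nonneg Z hM'.ne'
  have h1 := Int.emod_lt_of_pos Z hM'
  refine ⟨M * x + (Z % M).toNat, ?_, ?_⟩
  · rw [coord, Nat.mul_add_div hM, Nat.div_eq_of_lt (by omega), add_zero, hx, Nat.mul_add_mod,
      Nat.mod_eq_of_lt (by omega)]
    simp only [add_sub_cancel, Int.toNat_of_nonneg h0, Int.mul_ediv_add_emod]
  · rw [mul_assoc]
    calc M * x + (Z % M).toNat + 1 ≤ M * (x + 1) := by rw [mul_add]; omega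
      _ ≤ _ := Nat.mul_le_mul_left _ hb

/-- The code is built backwards: the code of the last coordinate is the remainder that the earlier
coordinates have to leave. -/
theorem exists_vertex {M : ℕ} (hM : 0 < M) (row Z : ℕ → ℤ) (k y : ℕ) :
    ∃ x, codeAfter M row x k = y ∧ (∀ j < k, codeCoord M row x j = Z j) ∧
      x + 1 ≤ M ^ k * 4 ^ (∑ j ∈ Finset.range k, ((Z j / M - row j).natAbs + 1)) * (y + 1) := by
  induction k generalizing y with
  | zero => exact ⟨y, rfl, by simp, by simp⟩
  | succ k ih =>
    obtain ⟨x', hx', hb'⟩ := exists_coord hM (row k) (Z k) y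
    obtain ⟨x, hx, hc, hb⟩ := ih x'
    refine ⟨x, ?_, fun j hj => ?_, hb.trans ?_⟩
    · rw [codeAfter, hx, hx']
    · obtain hj | rfl := Nat.lt_succ_iff_lt_or_eq.1 hj
      · exact hc j hj
      · rw [codeCoord, hx, hx']
    · refine (Nat.mul_le_mul_left _ hb').trans_eq ?_
      rw [Finset.sum_range_succ, pow_add 4 (∑ _ ∈ _, _), pow_succ M]
      ring

theorem Par.dist_congr (E : Par) (i : ℤ) {z z' : ℕ → ℤ} {b : ℕ} (a : ℕ)
    (h : ∀ k < E.d, z (b * E.d + k) = z' (b * E.d + k)) : E.dist i z b a = E.dist i z' b a := by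
  unfold Par.dist
  congr 1
  exact Finset.sum_congr rfl fun k hk => by rw [h k (Finset.mem_range.1 hk)]

/-! ### Keys as numbers in base `B` -/

theorem key_congr {B off : ℤ} {z z' : ℕ → ℤ} {k : ℕ} (h : ∀ t < k, z t = z' t) :
    key B off z k = key B off z' k := by
  induction k with
  | zero => rfl
  | succ k ih => rw [key, key, ih fun t ht => h t (by omega), h k (by omega)]

/-- This is uniqueness of digits in base `B`, and the reason why entries out of range are rejected.
-/
theorem key_injective {B off : ℤ} {z z' : ℕ → ℤ} {k : ℕ} (hz : InRange B off z k)
    (hz' : InRange B off z' k) (h : key B off z k = key B off z' k) : ∀ t < k, z t = z' t := by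
  induction k with
  | zero => simp
  | succ k ih =>
    rw [inRange_succ] at hz hz'
    rw [key, key] at h
    have hB : 0 < B := by omega
    have hd : ∀ u v : ℤ, 0 ≤ v → v < B → (u * B + v) / B = u := fun u v h0 h1 => by
      rw [mul_comm, Int.mul_add_ediv_left _ _ hB.ne', Int.ediv_eq_zero_of_lt h0 h1, add_zero]
    have e : key B off z k = key B off z' k := by
      rw [← hd (key B off z k) _ hz.2.1 hz.2.2, h, hd _ _ hz'.2.1 hz'.2.2]
    intro t ht
    obtain ht | rfl := Nat.lt_succ_iff_lt_or_eq.1 ht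
    · exact ih hz.1 hz'.1 e t ht
    · rw [e] at h
      linarith

theorem key_nonneg {B off : ℤ} {z : ℕ → ℤ} {k : ℕ} (hz : InRange B off z k) :
    0 ≤ key B off z k := by
  induction k with
  | zero => exact le_rfl
  | succ k ih =>
    rw [inRange_succ] at hz
    have : 0 ≤ B := by omega
    have := ih hz.1
    have := hz.2.1
    rw [key]
    positivity

/-- The number of digits for a pair of an alignment. -/
noncomputable def Par.weight (E : Par) (i : ℤ) (Z : ℕ → ℤ) (b a : ℕ) : ℕ :=
  ∑ k ∈ Finset.range E.d, ((Z (b * E.d + k) / E.M - E.row i a k).natAbs + 1)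

/-- A code with the remainder `y` whose decoding continues a curve by the vertex `b` of `Z`. -/
theorem exists_next {E : Par} (hM : 0 < E.M) (i : ℤ) (Z : ℕ → ℤ) (b a y : ℕ) (new : Bool) :
    ∃ x, x + 1 ≤ E.M ^ (if new then E.d else 0) * 4 ^ E.weight i Z b a * (y + 1) ∧
      ∀ c : Cfg, c.a = a → c.b = b → c.new = new → c.x = x →
        (∀ t < (if new then b else b + 1) * E.d, c.z t = Z t) →
        c.nextX E i = y ∧ ∀ t < (b + 1) * E.d, c.nextZ E i t = Z t := by
  cases new with
  | false =>
    refine ⟨y, ?_, ?_⟩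
    · simp only [Bool.false_eq_true, if_false, pow_zero, one_mul]
      exact Nat.le_mul_of_pos_left _ (by positivity)
    · rintro c rfl rfl hn rfl hz
      exact ⟨by simp [Cfg.nextX, hn], fun t ht => by simpa [Cfg.nextZ, hn] using hz t (by simpa using ht)⟩
  | true =>
    obtain ⟨x, hx, hc, hb⟩ := exists_vertex hM (E.row i a) (fun k => Z (b * E.d + k)) E.d y
    refine ⟨x, by simpa [Par.weight] using hb, ?_⟩
    rintro c rfl rfl hn rfl hz
    refine ⟨by simp [Cfg.nextX, hn, hx], fun t ht => ?_⟩
    rw [add_mul, one_mul] at ht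
    by_cases h : c.b * E.d ≤ t
    · rw [Cfg.nextZ, if_pos ⟨hn, h, ht⟩, hc _ (by omega)]
      congr 1
      omega
    · rw [Cfg.nextZ, if_neg (by omega), hz t (by simp; omega)]

/-- A code whose decoding continues by the alignment `y :: l` and the coordinates `Z`. -/
theorem exists_path {E : Par} (hM : 0 < E.M) (i : ℤ) (Z : ℕ → ℤ) :
    ∀ (l : List (Fin E.m × Fin E.m)) (y : Fin E.m × Fin E.m) (new : Bool) (e : ℕ),
      (y :: l).IsChain AlignStep →
      (∀ x ∈ (y :: l).getLast?, (x.1 : ℕ) + 1 = E.m ∧ (x.2 : ℕ) + 1 = E.m) →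
      e + y.1 + (if new then 0 else 1) = E.m →
      ∃ x, x + 1 ≤ E.M ^ (e * E.d) *
          4 ^ ((y :: l).map fun v => E.weight i Z v.1 v.2 + 1).sum ∧
        ∀ c : Cfg, c.a = y.2 → c.b = y.1 → c.new = new → c.x = x →
          (∀ t < (if new then y.1 else y.1 + 1 : ℕ) * E.d, c.z t = Z t) →
          ∀ f, l.length + 1 ≤ f →
            (c.final E i f).a = E.m ∧ (c.final E i f).b = E.m ∧
            (∀ t < E.m * E.d, (c.final E i f).z t = Z t) ∧
            (c.final E i f).acc =
              ((y :: l).map fun v => E.dist i Z v.1 v.2).foldl (accStep E.p) c.acc := by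
  have hacc : ∀ (c : Cfg) (y : Fin E.m × Fin E.m), c.a = y.2 → c.b = y.1 →
      (∀ t < (y.1 + 1 : ℕ) * E.d, c.nextZ E i t = Z t) →
      (c.next E i).acc = accStep E.p c.acc (E.dist i Z y.1 y.2) := by
    intro c y ha hb hz
    simp only [Cfg.next, ha, hb]
    rw [E.dist_congr i (y.2 : ℕ) fun k hk => hz _ (by rw [add_mul]; omega)]
  intro l
  induction l with
  | nil =>
    intro y new e _ hlast he
    obtain ⟨h1, h2⟩ := hlast y (by simp)
    -- The remainder 0 ends with the digit 0, a step on both curves, which takes both positions from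
    -- the last vertices to `m` and stops the loop.
    obtain ⟨x, hx, hc⟩ := exists_next hM i Z y.1 y.2 0 new
    refine ⟨x, hx.trans ?_, ?_⟩
    · have : (if new then E.d else 0) = e * E.d := by
        cases new with
        | false => obtain rfl : e = 0 := by simp at he; omega
                   simp
        | true => obtain rfl : e = 1 := by simp at he; omega
                  simp
      rw [this]
      simp only [List.map_cons, List.map_nil, List.sum_cons, List.sum_nil, add_zero, zero_add,
        mul_one]
      exact Nat.mul_le_mul_left _ (Nat.pow_le_pow_right (by decide) (Nat.le_succ _))
    · intro c ha hb hn hcx hz f hf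
      obtain ⟨hX, hZ⟩ := hc c ha hb hn hcx hz
      obtain ⟨f, rfl⟩ : ∃ f', f = f' + 1 := ⟨f - 1, by simp at hf; omega⟩
      have e1 : (c.next E i).a = E.m := by simp [Cfg.next, hX, ha, h2]
      have e2 : (c.next E i).b = E.m := by simp [Cfg.next, hX, hb, h1]
      rw [Cfg.final, if_pos (by rw [ha, hb]; exact ⟨y.2.2, y.1.2⟩), Cfg.final_of_not (by omega)]
      exact ⟨e1, e2, fun t ht => hZ t (by rwa [h1]), by simp [hacc c y ha hb hZ]⟩
  | cons y' l ih =>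
    intro y new e hchain hlast he
    rw [List.isChain_cons_cons] at hchain
    obtain ⟨hstep, hchain⟩ := hchain
    have hy := y'.1.2
    -- Here `g` is the digit of the step to `y'`, `new'` tells whether this step opens a new vertex,
    -- and `e'` counts the vertices still to be decoded from there on.
    obtain ⟨g, new', e', hg4, he', hee, hga, hgb, hgn, hrow⟩ : ∃ (g : ℕ) (new' : Bool) (e' : ℕ),
        g < 4 ∧ e' + y'.1 + (if new' then 0 else 1) = E.m ∧
        (if new then E.d else 0) + e' * E.d = e * E.d ∧
        (if g ≤ 1 then (y.2 : ℕ) + 1 else y.2) = y'.2 ∧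
        (if g = 1 then (y.1 : ℕ) else y.1 + 1) = y'.1 ∧ decide (g ≠ 1) = new' ∧
        (if new' then y'.1 else y'.1 + 1 : ℕ) ≤ y.1 + 1 := by
      have hcase : ∀ k, e + y.1 + (if new then 0 else 1) = E.m →
          k + y.1 + 1 = E.m → (if new then E.d else 0) + k * E.d = e * E.d := by
        intro k h1 h2
        cases new with
        | false => obtain rfl : e = k := by simp at h1; omega
                   simp
        | true => obtain rfl : e = k + 1 := by simp at h1; omega
                  simp [add_mul, add_comm]
      rcases hstep with ⟨h1, h2⟩ | ⟨h1, h2⟩ | ⟨h1, h2⟩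
      · exact ⟨2, true, E.m - y'.1, by simp, by simp, hcase _ he (by omega), by simp [h2],
          by simp [h1], by simp, by simp; omega⟩
      · exact ⟨1, false, E.m - y'.1 - 1, by simp, by simp; omega, hcase _ he (by omega),
          by simp [h2], by simp [h1], by simp, by simp; omega⟩
      · exact ⟨0, true, E.m - y'.1, by simp, by simp, hcase _ he (by omega), by simp [h2],
          by simp [h1], by simp, by simp; omega⟩
    obtain ⟨x', hx', hc'⟩ := ih y' new' e' hchain (by simpa using hlast) he'
    obtain ⟨x, hx, hc⟩ := exists_next hM i Z y.1 y.2 (4 * x' + g) new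
    refine ⟨x, hx.trans ?_, ?_⟩
    · rw [← hee, List.map_cons, List.sum_cons, pow_add E.M, pow_add 4, pow_succ]
      -- The digit of the step costs one factor 4, the `+ 1` next to the weight.
      have : 4 * x' + g + 1 ≤ 4 * (x' + 1) := by omega
      calc _ ≤ E.M ^ (if new then E.d else 0) * 4 ^ E.weight i Z y.1 y.2 * (4 * (E.M ^ (e' * E.d) *
          4 ^ ((y' :: l).map fun v => E.weight i Z v.1 v.2 + 1).sum)) :=
            Nat.mul_le_mul_left _ (this.trans (Nat.mul_le_mul_left _ hx'))
        _ = _ := by ring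
    · intro c ha hb hn hcx hz f hf
      obtain ⟨hX, hZ⟩ := hc c ha hb hn hcx hz
      obtain ⟨f, rfl⟩ : ∃ f', f = f' + 1 := ⟨f - 1, by simp at hf; omega⟩
      rw [Cfg.final, if_pos (by rw [ha, hb]; exact ⟨y.2.2, y.1.2⟩)]
      have hX4 : c.nextX E i % 4 = g := by omega
      have := hc' (c.next E i) (by simp only [Cfg.next, hX4, ha, hga])
        (by simp only [Cfg.next, hX4, hb, hgb]) (by simp only [Cfg.next, hX4, hgn])
        (by simp only [Cfg.next, hX]; omega)
        (fun t ht => hZ t (ht.trans_le (Nat.mul_le_mul_right _ hrow))) f (by simpa using hf)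
      rw [hacc c y ha hb hZ] at this
      simpa using this

/-! ## The costs of alignments -/

/-- The `ℓ_p`-norm of a list of nonnegative numbers. -/
noncomputable def lpNorm (p : ℝ≥0∞) (l : List ℝ) : ℝ :=
  if p = ∞ then l.foldr max 0 else (l.map (· ^ p.toReal)).sum ^ (1 / p.toReal)

theorem lpCost_eq (p : ℝ≥0∞) {a b d : ℕ} (P : Curve a d) (Q : Curve b d)
    (τ : List (Fin a × Fin b)) :
    lpCost p P Q τ = lpNorm p (τ.map fun x => ‖P x.1 - Q x.2‖) := by
  simp [lpCost, lpNorm, List.map_map, Function.comp_def]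

theorem one_le_toReal {p : ℝ≥0∞} (hp : 1 ≤ p) (h : p ≠ ∞) : 1 ≤ p.toReal := by
  rwa [← ENNReal.toReal_one, ENNReal.toReal_le_toReal ENNReal.one_ne_top h]

theorem foldr_max_nonneg (l : List ℝ) : 0 ≤ l.foldr max 0 := by
  induction l with
  | nil => exact le_rfl
  | cons x l ih => exact ih.trans (le_max_right _ _)

theorem le_foldr_max {l : List ℝ} {x : ℝ} (hx : x ∈ l) : x ≤ l.foldr max 0 := by
  induction l with
  | nil => simp at hx
  | cons y l ih =>
    obtain rfl | hx := List.mem_cons.1 hx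
    · exact le_max_left _ _
    · exact (ih hx).trans (le_max_right _ _)

theorem foldr_max_le {l : List ℝ} {c : ℝ} (hc : 0 ≤ c) (h : ∀ x ∈ l, x ≤ c) :
    l.foldr max 0 ≤ c := by
  induction l with
  | nil => exact hc
  | cons y l ih =>
    exact max_le (h y (by simp)) (ih fun x hx => h x (by simp [hx]))

theorem lpNorm_nonneg (p : ℝ≥0∞) {l : List ℝ} (h : ∀ x ∈ l, 0 ≤ x) : 0 ≤ lpNorm p l := by
  unfold lpNorm
  split_ifs
  · exact foldr_max_nonneg l
  · refine Real.rpow_nonneg (List.sum_nonneg fun y hy => ?_) _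
    obtain ⟨x, hx, rfl⟩ := List.mem_map.1 hy
    exact Real.rpow_nonneg (h x hx) _

theorem sum_map_eq {α : Type*} (l : List α) (f : α → ℝ) :
    (l.map f).sum = ∑ i : Fin l.length, f l[i.1] :=
  (Fin.sum_univ_fun_getElem l f).symm

/-- Members that grow by at most `η` increase the norm by at most `K ^ (1 / p) η`. -/
theorem lpNorm_le_add {α : Type*} {p : ℝ≥0∞} (hp : 1 ≤ p) {l : List α} {f g : α → ℝ} {η : ℝ}
    {K : ℕ} (hl : l.length ≤ K) (hη : 0 ≤ η) (hf : ∀ x ∈ l, 0 ≤ f x) (hg : ∀ x ∈ l, 0 ≤ g x)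
    (h : ∀ x ∈ l, f x ≤ g x + η) :
    lpNorm p (l.map f) ≤ lpNorm p (l.map g) + (K : ℝ) ^ (1 / p.toReal) * η := by
  unfold lpNorm
  split_ifs with htop
  · subst htop
    -- Since `∞.toReal = 0`, the exponent `1 / p` is 0 and the factor is 1.
    simp only [ENNReal.toReal_top, div_zero, Real.rpow_zero, one_mul]
    refine foldr_max_le (add_nonneg (foldr_max_nonneg _) hη) fun y hy => ?_
    obtain ⟨x, hx, rfl⟩ := List.mem_map.1 hy
    exact (h x hx).trans (by gcongr; exact le_foldr_max (List.mem_map_of_mem hx))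
  · have h1 := one_le_toReal hp htop
    have h0 : 0 < p.toReal := by linarith
    simp only [List.map_map, Function.comp_def]
    rw [sum_map_eq, sum_map_eq]
    have hmem : ∀ i : Fin l.length, l[i.1] ∈ l := fun i => List.getElem_mem _
    calc (∑ i : Fin l.length, f l[i.1] ^ p.toReal) ^ (1 / p.toReal)
        ≤ (∑ i : Fin l.length, (g l[i.1] + η) ^ p.toReal) ^ (1 / p.toReal) := by
          refine Real.rpow_le_rpow (Finset.sum_nonneg fun i _ => Real.rpow_nonneg (hf _ (hmem i)) _)
            (Finset.sum_le_sum fun i _ => ?_) (by positivity)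
          exact Real.rpow_le_rpow (hf _ (hmem i)) (h _ (hmem i)) h0.le
      -- Minkowski's inequality; what remains is the norm of a constant list of length at most `K`.
      _ ≤ _ := Real.Lp_add_le_of_nonneg _ h1 (fun i _ => hg _ (hmem i)) fun _ _ => hη
      _ ≤ _ := by
          gcongr
          rw [Finset.sum_const, Finset.card_univ, Fintype.card_fin, nsmul_eq_mul,
            Real.mul_rpow (by positivity) (by positivity), ← Real.rpow_mul hη,
            mul_one_div_cancel h0.ne', Real.rpow_one]
          gcongr

/-- The power mean inequality. -/
theorem sum_mul_le_lpNorm {p : ℝ≥0∞} (hp : 1 ≤ p) {l : List ℝ} {K : ℕ} (hl : l.length ≤ K)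
    (h : ∀ x ∈ l, 0 ≤ x) :
    l.sum * (K : ℝ) ^ (1 / p.toReal) ≤ K * lpNorm p l := by
  have hn := lpNorm_nonneg p h
  have hlK : (l.length : ℝ) ≤ K := by exact_mod_cast hl
  by_cases htop : p = ∞
  · have : l.sum ≤ l.length • lpNorm p l := by
      refine List.sum_le_card_nsmul _ _ fun x hx => ?_
      rw [lpNorm, if_pos htop]
      exact le_foldr_max hx
    rw [nsmul_eq_mul] at this
    simp only [htop, ENNReal.toReal_top, div_zero, Real.rpow_zero, mul_one]
    rw [htop] at this hn
    exact this.trans (by gcongr)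
  · have h1 := one_le_toReal hp htop
    have h0 : 0 < p.toReal := by linarith
    obtain rfl | hK := K.eq_zero_or_pos
    · obtain rfl := List.length_eq_zero_iff.1 (Nat.le_zero.1 hl)
      simp
    have hK' : (0 : ℝ) < K := by exact_mod_cast hK
    have hmem : ∀ i : Fin l.length, l[i.1] ∈ l := fun i => List.getElem_mem _
    have e1 : l.sum = ∑ i : Fin l.length, l[i.1] := by
      simpa using sum_map_eq l id
    have hs : 0 ≤ l.sum := List.sum_nonneg h
    have key := Real.rpow_sum_le_const_mul_sum_rpow_of_nonneg (s := Finset.univ)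
      (f := fun i : Fin l.length => l[i.1]) h1 fun i _ => h _ (hmem i)
    rw [← e1, Finset.card_univ, Fintype.card_fin] at key
    have e2 : (l.map (· ^ p.toReal)).sum = ∑ i : Fin l.length, l[i.1] ^ p.toReal := sum_map_eq _ _
    rw [← e2] at key
    have hs' : 0 ≤ (l.map (· ^ p.toReal)).sum := List.sum_nonneg fun y hy => by
      obtain ⟨x, hx, rfl⟩ := List.mem_map.1 hy
      exact Real.rpow_nonneg (h x hx) _
    have key2 : l.sum ≤ (K : ℝ) ^ ((p.toReal - 1) / p.toReal) * lpNorm p l := by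
      rw [lpNorm, if_neg htop]
      calc l.sum = (l.sum ^ p.toReal) ^ (1 / p.toReal) := by
            rw [← Real.rpow_mul hs, mul_one_div_cancel h0.ne', Real.rpow_one]
        _ ≤ ((l.length : ℝ) ^ (p.toReal - 1) * (l.map (· ^ p.toReal)).sum) ^ (1 / p.toReal) :=
            Real.rpow_le_rpow (by positivity) key (by positivity)
        _ = (l.length : ℝ) ^ ((p.toReal - 1) / p.toReal) *
              (l.map (· ^ p.toReal)).sum ^ (1 / p.toReal) := by
            rw [Real.mul_rpow (by positivity) hs', ← Real.rpow_mul (by positivity),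
              mul_one_div]
        _ ≤ _ := by
            gcongr
    calc l.sum * (K : ℝ) ^ (1 / p.toReal)
        ≤ (K : ℝ) ^ ((p.toReal - 1) / p.toReal) * lpNorm p l * (K : ℝ) ^ (1 / p.toReal) := by
          gcongr
      _ = (K : ℝ) ^ ((p.toReal - 1) / p.toReal) * (K : ℝ) ^ (1 / p.toReal) * lpNorm p l := by ring
      _ = _ := by
          rw [← Real.rpow_add hK', ← add_div, sub_add_cancel, div_self h0.ne', Real.rpow_one]

theorem accStep_foldl {p : ℝ≥0∞} (hp : 1 ≤ p) {l : List ℝ} (h : ∀ x ∈ l, 0 ≤ x) :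
    accRoot p.toReal (l.foldl (accStep p.toReal) 0) = lpNorm p l := by
  unfold lpNorm
  split_ifs with htop
  · have e : accStep p.toReal = max := by
      funext a v
      simp [accStep, htop]
    rw [e, accRoot, if_pos (by simp [htop]), List.foldl_eq_foldr]
  · have h1 := one_le_toReal hp htop
    have h0 : ¬ p.toReal ≤ 0 := by linarith
    have e : ∀ (l : List ℝ) (a : ℝ), l.foldl (accStep p.toReal) a =
        a + (l.map (· ^ p.toReal)).sum := by
      intro l
      induction l with
      | nil => simp
      | cons x l ih => intro a; simp [ih, accStep, h0, add_assoc]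
    rw [e, accRoot, if_neg h0, zero_add, abs_of_nonneg]
    refine List.sum_nonneg fun y hy => ?_
    obtain ⟨x, hx, rfl⟩ := List.mem_map.1 hy
    exact Real.rpow_nonneg (h x hx) _

/-! ## Alignments -/

/-- The sum of the two indices grows with each step, and it ends at most at `a + b - 2`. -/
theorem alignment_length_aux {a b : ℕ} :
    ∀ (l : List (Fin a × Fin b)) (x : Fin a × Fin b), (x :: l).IsChain AlignStep →
      l.length + x.1 + x.2 + 2 ≤ a + b := by
  intro l
  induction l with
  | nil => intro x _; have := x.1.2; have := x.2.2; simp; omega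
  | cons y l ih =>
    intro x h
    rw [List.isChain_cons_cons] at h
    have := ih y h.2
    rcases h.1 with h | h | h <;> simp <;> omega

theorem IsAlignment.length_le {m : ℕ} {τ : List (Fin m × Fin m)} (h : IsAlignment τ) :
    τ.length ≤ 2 * m := by
  obtain _ | ⟨x, l⟩ := τ
  · exact absurd rfl h.nonempty
  · have := alignment_length_aux l x h.step
    simp
    omega

theorem exists_alignment {m : ℕ} (hm : 1 ≤ m) : ∃ τ : List (Fin m × Fin m), IsAlignment τ := by
  obtain ⟨m, rfl⟩ : ∃ k, m = k + 1 := ⟨m - 1, by omega⟩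
  refine ⟨List.ofFn fun i => (i, i), by simp, ?_, ?_, ?_⟩
  · simp [List.ofFn_succ]
  · intro x hx
    rw [List.getLast?_eq_some_getLast (by simp), List.getLast_ofFn] at hx
    simp at hx
    subst hx
    simp
  · rw [List.isChain_ofFn]
    intro i hi
    exact .inr (.inr ⟨rfl, rfl⟩)

/-- The infimum is attained because alignments have bounded length over a finite alphabet, so there
are finitely many. -/
theorem exists_lpCost_eq {m d : ℕ} (hm : 1 ≤ m) (p : ℝ≥0∞) (P Q : Curve m d) :
    ∃ τ : List (Fin m × Fin m), IsAlignment τ ∧ lpDist p P Q = lpCost p P Q τ := by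
  refine Set.Nonempty.csInf_mem
    (s := {c : ℝ | ∃ τ : List (Fin m × Fin m), IsAlignment τ ∧ c = lpCost p P Q τ}) ?_ ?_
  · obtain ⟨τ, hτ⟩ := exists_alignment hm
    exact ⟨_, τ, hτ, rfl⟩
  · refine ((List.finite_length_le (Fin m × Fin m) (2 * m)).image (lpCost p P Q)).subset ?_
    rintro _ ⟨τ, hτ, rfl⟩
    exact ⟨τ, hτ.length_le, rfl⟩

theorem lpCost_nonneg (p : ℝ≥0∞) {a b d : ℕ} (P : Curve a d) (Q : Curve b d)
    (τ : List (Fin a × Fin b)) : 0 ≤ lpCost p P Q τ := by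
  rw [lpCost_eq]
  refine lpNorm_nonneg p fun y hy => ?_
  obtain ⟨x, -, rfl⟩ := List.mem_map.1 hy
  exact norm_nonneg _

theorem lpDist_le {m d : ℕ} (p : ℝ≥0∞) (P Q : Curve m d) {τ : List (Fin m × Fin m)}
    (hτ : IsAlignment τ) : lpDist p P Q ≤ lpCost p P Q τ :=
  csInf_le ⟨0, by rintro _ ⟨τ, -, rfl⟩; exact lpCost_nonneg ..⟩ ⟨τ, hτ, rfl⟩

theorem lpCost_le_add {m d : ℕ} {p : ℝ≥0∞} (hp : 1 ≤ p) {P P' Q : Curve m d}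
    {τ : List (Fin m × Fin m)} (hτ : IsAlignment τ) {η : ℝ} (hη : 0 ≤ η)
    (h : ∀ j, ‖P j - P' j‖ ≤ η) :
    lpCost p P Q τ ≤ lpCost p P' Q τ + (2 * m : ℝ) ^ (1 / p.toReal) * η := by
  rw [lpCost_eq, lpCost_eq]
  have := lpNorm_le_add (l := τ) (f := fun x => ‖P x.1 - Q x.2‖) (g := fun x => ‖P' x.1 - Q x.2‖)
    hp hτ.length_le hη (fun _ _ => norm_nonneg _) (fun _ _ => norm_nonneg _) fun x _ => by
      rw [add_comm]
      exact (norm_sub_le_norm_sub_add_norm_sub _ (P' x.1) _).trans (by gcongr; exact h _)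
  push_cast at this
  exact this

theorem sum_norm_le {m d : ℕ} {p : ℝ≥0∞} (hp : 1 ≤ p) {P Q : Curve m d}
    {τ : List (Fin m × Fin m)} (hτ : IsAlignment τ) :
    (τ.map fun x => ‖P x.1 - Q x.2‖).sum * (2 * m : ℝ) ^ (1 / p.toReal) ≤
      2 * m * lpCost p P Q τ := by
  rw [lpCost_eq]
  have := sum_mul_le_lpNorm hp (l := τ.map fun x => ‖P x.1 - Q x.2‖) (K := 2 * m)
    (by simpa using hτ.length_le) fun y hy => by
      obtain ⟨x, -, rfl⟩ := List.mem_map.1 hy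
      exact norm_nonneg _
  push_cast at this
  exact this

theorem le_lpNorm {p : ℝ≥0∞} (hp : 1 ≤ p) {l : List ℝ} (h : ∀ x ∈ l, 0 ≤ x) {x : ℝ}
    (hx : x ∈ l) : x ≤ lpNorm p l := by
  unfold lpNorm
  split_ifs with htop
  · exact le_foldr_max hx
  · have h1 := one_le_toReal hp htop
    have h0 : 0 < p.toReal := by linarith
    have : x ^ p.toReal ≤ (l.map (· ^ p.toReal)).sum := by
      refine List.single_le_sum (fun y hy => ?_) _ (List.mem_map_of_mem hx)
      obtain ⟨x, hx, rfl⟩ := List.mem_map.1 hy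
      exact Real.rpow_nonneg (h x hx) _
    calc x = (x ^ p.toReal) ^ (1 / p.toReal) := by
          rw [← Real.rpow_mul (h x hx), mul_one_div_cancel h0.ne', Real.rpow_one]
      _ ≤ _ := Real.rpow_le_rpow (Real.rpow_nonneg (h x hx) _) this (by positivity)

theorem norm_le_lpCost {p : ℝ≥0∞} (hp : 1 ≤ p) {a b d : ℕ} (P : Curve a d) (Q : Curve b d)
    {τ : List (Fin a × Fin b)} {x : Fin a × Fin b} (hx : x ∈ τ) :
    ‖P x.1 - Q x.2‖ ≤ lpCost p P Q τ := by
  rw [lpCost_eq]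
  refine le_lpNorm hp (fun y hy => ?_) (List.mem_map.2 ⟨x, hx, rfl⟩)
  obtain ⟨x, -, rfl⟩ := List.mem_map.1 hy
  exact norm_nonneg _

/-- A discrete intermediate value theorem: the first index rises by at most one per step, so it
skips no vertex. -/
theorem exists_mem_of_isChain {a b : ℕ} :
    ∀ (l : List (Fin a × Fin b)) (x : Fin a × Fin b), (x :: l).IsChain AlignStep →
      (∀ y ∈ (x :: l).getLast?, (y.1 : ℕ) + 1 = a) →
      ∀ j : Fin a, x.1 ≤ j → ∃ y ∈ x :: l, y.1 = j := by
  intro l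
  induction l with
  | nil =>
    intro x _ hl j hj
    have := hl x (by simp)
    exact ⟨x, by simp, by ext; have := j.2; have : (x.1 : ℕ) ≤ j := hj; omega⟩
  | cons y l ih =>
    intro x h hl j hj
    rw [List.isChain_cons_cons] at h
    by_cases hx : x.1 = j
    · exact ⟨x, by simp, hx⟩
    · have hj' : (x.1 : ℕ) ≤ j := hj
      have hx' : (x.1 : ℕ) ≠ j := fun e => hx (Fin.ext e)
      obtain ⟨z, hz, e⟩ := ih y h.2 (by simpa using hl) j (by
        change (y.1 : ℕ) ≤ j
        rcases h.1 with h | h | h <;> omega)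
      exact ⟨z, by simp [hz], e⟩

theorem IsAlignment.exists_mem {m : ℕ} {τ : List (Fin m × Fin m)} (h : IsAlignment τ) (j : Fin m) :
    ∃ y ∈ τ, y.1 = j := by
  obtain _ | ⟨x, l⟩ := τ
  · exact absurd rfl h.nonempty
  · refine exists_mem_of_isChain l x h.step (fun y hy => (h.last y hy).1) j ?_
    have := (h.head x (by simp)).1
    change (x.1 : ℕ) ≤ j
    omega

/-! ## The decoded curves -/

theorem input_apply {n m d : ℕ} (C : Fin n → Curve m d) (i : Fin n) (k : Fin m) (j : Fin d) :
    input C (i : ℕ) (k : ℕ) (j : ℕ) = C i k j := by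
  have := i.2
  have := k.2
  have := j.2
  rw [input, dif_pos (by omega)]
  simp

/-- The curve with the fine coordinates `z`. -/
noncomputable def gridCurve (m d : ℕ) (δ : ℝ) (z : ℕ → ℤ) : Curve m d :=
  fun j => WithLp.toLp 2 fun k => δ * z (j * d + k)

theorem Par.dist_eq {E : Par} {C : Fin E.n → Curve E.m E.d} (hin : E.inp = input C) (i : Fin E.n)
    (z : ℕ → ℤ) (b a : Fin E.m) :
    E.dist (i : ℕ) z b a = ‖gridCurve E.m E.d E.δ z b - C i a‖ := by
  rw [EuclideanSpace.norm_eq, Real.sqrt_eq_rpow, Par.dist, Finset.sum_range, hin]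
  congr 1
  refine Finset.sum_congr rfl fun k _ => ?_
  rw [input_apply, Real.norm_eq_abs, sq_abs]
  rfl

/-- The alignment `τ` has been visited when the decoding is in the stage `c`. -/
structure Traced (E : Par) (i : ℤ) (c : Cfg) (τ : List (Fin E.m × Fin E.m)) : Prop where
  chain : τ.IsChain AlignStep
  head : ∀ x ∈ τ.head?, (x.1 : ℕ) = 0 ∧ (x.2 : ℕ) = 0
  nil : τ = [] → c.a = 0 ∧ c.b = 0 ∧ c.new = true
  last : ∀ x ∈ τ.getLast?, (c.b = x.1 + 1 ∧ c.a = x.2) ∨ (c.b = x.1 ∧ c.a = x.2 + 1) ∨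
    (c.b = x.1 + 1 ∧ c.a = x.2 + 1)
  rows : ∀ x ∈ τ, (x.1 : ℕ) < if c.new then c.b else c.b + 1
  acc : c.acc = (τ.map fun v => E.dist i c.z v.1 v.2).foldl (accStep E.p) 0

theorem Traced.next {E : Par} {i : ℤ} {c : Cfg} {τ : List (Fin E.m × Fin E.m)}
    (h : Traced E i c τ) (ha : c.a < E.m) (hb : c.b < E.m) :
    Traced E i (c.next E i) (τ ++ [(⟨c.b, hb⟩, ⟨c.a, ha⟩)]) where
  chain := by
    refine h.chain.append (by simp) fun x hx y hy => ?_
    simp at hy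
    subst hy
    exact h.last x hx
  head := by
    obtain _ | ⟨x, l⟩ := τ
    · have := h.nil rfl
      simp [this.1, this.2.1]
    · simpa using h.head
  nil := by simp
  last x hx := by
    simp at hx
    subst hx
    simp only [Cfg.next]
    have : c.nextX E i % 4 = 0 ∨ c.nextX E i % 4 = 1 ∨ 2 ≤ c.nextX E i % 4 := by omega
    rcases this with h | h | h
    · simp [h]
    · simp [h]
    · rw [if_neg (by omega), if_neg (by omega)]
      exact .inl ⟨rfl, rfl⟩
  rows x hx := by
    have : c.b < if (c.next E i).new then (c.next E i).b else (c.next E i).b + 1 := by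
      simp only [Cfg.next]
      by_cases hX : c.nextX E i % 4 = 1 <;> simp [hX]
    rcases List.mem_append.1 hx with hx | hx
    · have := h.rows x hx
      split_ifs at this <;> omega
    · simp at hx
      subst hx
      exact this
  acc := by
    rw [List.map_append, List.foldl_append]
    have : (τ.map fun v => E.dist i (c.next E i).z v.1 v.2) =
        τ.map fun v => E.dist i c.z v.1 v.2 := by
      -- A round rewrites coordinates only when the vertex `c.b` is new; then `rows` places all
      -- visited pairs before it, so the recorded distances keep their values.
      refine List.map_congr_left fun v hv => E.dist_congr i _ fun k hk => ?_
      have hrow := h.rows v hv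
      change c.nextZ E i _ = _
      rw [Cfg.nextZ, if_neg]
      rintro ⟨hn, h1, -⟩
      rw [if_pos hn] at hrow
      have : (v.1 + 1 : ℕ) * E.d ≤ c.b * E.d := Nat.mul_le_mul_right _ hrow
      rw [add_mul] at this
      omega
    rw [this, ← h.acc]
    rfl

theorem Traced.final {E : Par} {i : ℤ} (f : ℕ) {c : Cfg} {τ : List (Fin E.m × Fin E.m)}
    (h : Traced E i c τ) : ∃ τ', Traced E i (c.final E i f) τ' := by
  induction f generalizing c τ with
  | zero => exact ⟨τ, h⟩
  | succ f ih =>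
    rw [Cfg.final]
    split_ifs with hc
    · exact ih (h.next hc.1 hc.2)
    · exact ⟨τ, h⟩

/-- If both positions have left their curves, the last visited pair can only be the pair of last
vertices; this is why an entry demands both inequalities although the loop stops at the first. -/
theorem Traced.isAlignment {E : Par} {i : ℤ} {c : Cfg} {τ : List (Fin E.m × Fin E.m)}
    (h : Traced E i c τ) (hm : 1 ≤ E.m) (ha : E.m ≤ c.a) (hb : E.m ≤ c.b) : IsAlignment τ where
  nonempty hτ := by have := h.nil hτ; omega
  head := h.head
  last x hx := by
    have := h.last x hx
    have := x.1.2
    have := x.2.2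
    omega
  step := h.chain

/-- What the parameters of the data structure have to satisfy. -/
structure Par.Good (E : Par) (p : ℝ≥0∞) : Prop where
  hp : 1 ≤ p
  p_eq : E.p = p.toReal
  n_pos : 1 ≤ E.n
  m_pos : 1 ≤ E.m
  d_pos : 1 ≤ E.d
  n_le : E.n ≤ E.n'
  M_pos : 0 < E.M
  M_ge : 2 ≤ E.M * E.ε
  ε_pos : 0 < E.ε
  r_pos : 0 < E.r
  D_eq : E.D = coarseSide E.m E.d E.r E.p
  δ_eq : E.δ = E.D / E.M
  N_eq : E.N = E.n' * (E.M ^ (E.m * E.d) * 65536 ^ (E.m * E.d))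
  B_eq : E.B = 2 * E.off
  off_eq : E.off = ⌊(absSum E.n E.m E.d E.inp + E.r) / E.δ⌋ + 2

/-- The decoding accumulates the cost of the very alignment it traces and tests it, so every entry
other than `-1` comes with its own witness, for any code and any initial memory. -/
theorem codeEntry_sound {E : Par} {p : ℝ≥0∞} (hE : E.Good p) {C : Fin E.n → Curve E.m E.d}
    (hin : E.inp = input C) (w : ℕ) (z₀ : ℕ → ℤ) :
    codeEntry E w z₀ = -1 ∨ ∃ (i : Fin E.n) (z : ℕ → ℤ) (τ : List (Fin E.m × Fin E.m)),
      IsAlignment τ ∧ InRange E.B E.off z (E.m * E.d) ∧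
      lpCost p (gridCurve E.m E.d E.δ z) (C i) τ ≤ (1 + E.ε / 2) * E.r ∧
      codeEntry E w z₀ = key E.B E.off z (E.m * E.d) * E.n' + (i : ℕ) := by
  obtain ⟨τ, hτ⟩ := Traced.final (E := E) (i := (w % E.n' : ℕ)) (2 * E.m)
    (c := startCfg E.n' w z₀) (τ := [])
    ⟨by simp, by simp, by simp [startCfg], by simp, by simp, by simp [startCfg]⟩
  unfold codeEntry Cfg.entry
  split_ifs with h
  · right
    obtain ⟨ha, hb, hi, hr, hcost⟩ := h
    refine ⟨⟨w % E.n', hi⟩, _, τ, hτ.isAlignment hE.m_pos ha hb, hr, ?_, rfl⟩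
    rw [hτ.acc, hE.p_eq, accStep_foldl hE.hp] at hcost
    · rw [lpCost_eq]
      refine le_of_eq_of_le ?_ hcost
      congr 1
      exact List.map_congr_left fun v _ => (Par.dist_eq hin ⟨w % E.n', hi⟩ _ _ _).symm
    · intro x hx
      obtain ⟨v, -, rfl⟩ := List.mem_map.1 hx
      exact E.dist_nonneg ..
  · exact .inl rfl

/-- The fine coordinates of a curve. -/
noncomputable def gridOf {m d : ℕ} (δ : ℝ) (Q : Curve m d) : ℕ → ℤ :=
  gridCoord δ d (input (fun _ : Fin 1 => Q) 0)

theorem gridOf_apply {m d : ℕ} (δ : ℝ) (Q : Curve m d) (j : Fin m) (k : Fin d) :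
    gridOf δ Q (j * d + k) = ⌊Q j k / δ⌋ := by
  have hd : 0 < d := k.pos
  rw [gridOf, gridCoord]
  rw [show ((j : ℕ) * d + k) / d = j by
      rw [mul_comm, Nat.mul_add_div hd, Nat.div_eq_of_lt k.2, add_zero],
    show ((j : ℕ) * d + k) % d = k by
      rw [mul_comm, Nat.mul_add_mod, Nat.mod_eq_of_lt k.2]]
  exact congrArg (fun x => ⌊x / δ⌋) (input_apply (fun _ : Fin 1 => Q) 0 j k)

theorem norm_sub_gridCurve_le {m d : ℕ} {δ : ℝ} (hδ : 0 < δ) (Q : Curve m d) (j : Fin m) :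
    ‖gridCurve m d δ (gridOf δ Q) j - Q j‖ ≤ (d : ℝ) ^ (1 / 2 : ℝ) * δ := by
  have h : ∀ k : Fin d, ‖(gridCurve m d δ (gridOf δ Q) j - Q j) k‖ ≤ δ := by
    intro k
    change ‖δ * (gridOf δ Q (j * d + k) : ℝ) - Q j k‖ ≤ δ
    rw [gridOf_apply, Real.norm_eq_abs, abs_le]
    have h1 := Int.floor_le (Q j k / δ)
    have h2 := Int.lt_floor_add_one (Q j k / δ)
    rw [le_div_iff₀ hδ] at h1
    rw [div_lt_iff₀ hδ] at h2
    constructor <;> linarith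
  rw [EuclideanSpace.norm_eq, ← Real.sqrt_eq_rpow]
  refine Real.sqrt_le_iff.2 ⟨by positivity, ?_⟩
  rw [mul_pow, Real.sq_sqrt (by positivity)]
  calc _ ≤ ∑ _k : Fin d, δ ^ 2 := Finset.sum_le_sum fun k _ => by
        gcongr
        exact h k
    _ = _ := by simp

theorem sum_abs_le {d : ℕ} (x : EuclideanSpace ℝ (Fin d)) :
    ∑ k, |x k| ≤ (d : ℝ) ^ (1 / 2 : ℝ) * ‖x‖ := by
  rw [EuclideanSpace.norm_eq, ← Real.sqrt_eq_rpow, ← Real.sqrt_mul (by positivity)]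
  refine Real.le_sqrt_of_sq_le ?_
  have := sq_sum_le_card_mul_sum_sq (s := Finset.univ) (f := fun k => |x k|)
  simpa using this

theorem natAbs_floor_sub_le (a b : ℝ) : ((⌊a⌋ - ⌊b⌋).natAbs : ℝ) ≤ |a - b| + 1 := by
  rw [Nat.cast_natAbs, Int.cast_abs, Int.cast_sub, abs_le]
  have h1 := Int.floor_le a
  have h2 := Int.lt_floor_add_one a
  have h3 := Int.floor_le b
  have h4 := Int.lt_floor_add_one b
  have h5 := neg_abs_le (a - b)
  have h6 := le_abs_self (a - b)
  constructor <;> linarith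

/-! ### Completeness of the dictionary -/

section
variable {E : Par} {p : ℝ≥0∞} {C : Fin E.n → Curve E.m E.d}

/-- The ratio of `r` and the coarse side. -/
theorem Par.Good.ratio_pos (hE : E.Good p) :
    0 < (2 * E.m : ℝ) ^ (1 / p.toReal) * (E.d : ℝ) ^ (1 / 2 : ℝ) := by
  have := hE.m_pos
  have := hE.d_pos
  positivity

theorem Par.Good.D_mul (hE : E.Good p) :
    E.D * ((2 * E.m : ℝ) ^ (1 / p.toReal) * (E.d : ℝ) ^ (1 / 2 : ℝ)) = E.r := by
  rw [hE.D_eq, coarseSide, hE.p_eq, div_mul_cancel₀ _ hE.ratio_pos.ne']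

theorem Par.Good.D_pos (hE : E.Good p) : 0 < E.D :=
  pos_of_mul_pos_left (by rw [hE.D_mul]; exact hE.r_pos) hE.ratio_pos.le

theorem Par.Good.δ_pos (hE : E.Good p) : 0 < E.δ := by
  rw [hE.δ_eq]
  exact div_pos hE.D_pos (by exact_mod_cast hE.M_pos)

/-- The left side equals `r / M` by the choice of `D`, and `M ≥ 2 / ε`. -/
theorem Par.Good.δ_le (hE : E.Good p) :
    (2 * E.m : ℝ) ^ (1 / p.toReal) * ((E.d : ℝ) ^ (1 / 2 : ℝ) * E.δ) ≤ E.ε / 2 * E.r := by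
  have hM : (0 : ℝ) < E.M := by exact_mod_cast hE.M_pos
  have := hE.M_ge
  have := hE.r_pos
  calc _ = E.D * ((2 * E.m : ℝ) ^ (1 / p.toReal) * (E.d : ℝ) ^ (1 / 2 : ℝ)) / E.M := by
        rw [hE.δ_eq]; ring
    _ = E.r / E.M := by rw [hE.D_mul]
    _ ≤ _ := by
        rw [div_le_iff₀ hM]
        nlinarith

/-- As `δ = D / M`, dividing a fine coordinate by `M` gives exactly the coarse one. A displacement
is thus a difference of two floors at scale `D`, at most one more than the scaled distance, and its
terminating digit makes this 2 per coordinate. `sum_abs_le` (Cauchy–Schwarz) then brings in `√d`. -/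
theorem weight_le (hE : E.Good p) (hin : E.inp = input C) (i : Fin E.n) (Q : Curve E.m E.d)
    (b a : Fin E.m) : (E.weight (i : ℕ) (gridOf E.δ Q) b a : ℝ) ≤
      2 * E.d + (E.d : ℝ) ^ (1 / 2 : ℝ) / E.D * ‖Q b - C i a‖ := by
  have hM : (0 : ℝ) < E.M := by exact_mod_cast hE.M_pos
  have hD := hE.D_pos
  have key : ∀ k : Fin E.d, (((gridOf E.δ Q (b * E.d + k) / E.M - E.row (i : ℕ) a k).natAbs + 1 :
      ℕ) : ℝ) ≤ 2 + |(Q b - C i a) k| / E.D := by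
    intro k
    rw [gridOf_apply, ← Int.floor_div_natCast, Par.row, hin, input_apply, hE.δ_eq, div_div,
      div_mul_cancel₀ _ hM.ne']
    push_cast
    have := natAbs_floor_sub_le (Q b k / E.D) (C i a k / E.D)
    rw [← sub_div, abs_div, abs_of_pos hD] at this
    change _ ≤ 2 + |Q b k - C i a k| / E.D
    linarith
  rw [Par.weight, Finset.sum_range]
  push_cast
  calc _ ≤ ∑ k : Fin E.d, (2 + |(Q b - C i a) k| / E.D) :=
        Finset.sum_le_sum fun k _ => by simpa using key k
    _ = 2 * E.d + (∑ k, |(Q b - C i a) k|) / E.D := by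
        rw [Finset.sum_add_distrib, Finset.sum_div]
        simp [mul_comm]
    _ ≤ _ := by
        rw [div_mul_eq_mul_div]
        gcongr
        exact sum_abs_le _

/-- The side `D` is chosen for this bound: the scaled distances add up to at most `2md` by the power
mean inequality, and at most `2m` pairs contribute `2d + 1` further digits each. The total `6md +
2m` is at most `8md`, whence `65536 = 4 ^ 8` codes per coordinate besides the factor `M`. -/
theorem weight_sum_le (hE : E.Good p) (hin : E.inp = input C) (i : Fin E.n) (Q : Curve E.m E.d)
    {τ : List (Fin E.m × Fin E.m)} (hτ : IsAlignment τ) (hr : lpCost p Q (C i) τ ≤ E.r) :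
    (τ.map fun v => E.weight (i : ℕ) (gridOf E.δ Q) v.1 v.2 + 1).sum ≤ 8 * (E.m * E.d) := by
  have hD := hE.D_pos
  have hm : (1 : ℝ) ≤ E.m := by exact_mod_cast hE.m_pos
  have hd : (1 : ℝ) ≤ E.d := by exact_mod_cast hE.d_pos
  have hs := sum_norm_le hE.hp (P := Q) (Q := C i) hτ
  set s := (τ.map fun x => ‖Q x.1 - C i x.2‖).sum with hs_def
  have h1 : s * (E.d : ℝ) ^ (1 / 2 : ℝ) / E.D ≤ 2 * E.m * E.d := by
    have hpos : (0 : ℝ) < (2 * E.m : ℝ) ^ (1 / p.toReal) := by positivity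
    have hsq : (E.d : ℝ) ^ (1 / 2 : ℝ) * (E.d : ℝ) ^ (1 / 2 : ℝ) = E.d := by
      rw [← Real.rpow_add (by linarith)]; norm_num
    rw [div_le_iff₀ hD]
    refine le_of_mul_le_mul_right ?_ hpos
    calc s * (E.d : ℝ) ^ (1 / 2 : ℝ) * (2 * E.m : ℝ) ^ (1 / p.toReal)
        = (E.d : ℝ) ^ (1 / 2 : ℝ) * (s * (2 * E.m : ℝ) ^ (1 / p.toReal)) := by ring
      _ ≤ (E.d : ℝ) ^ (1 / 2 : ℝ) * (2 * E.m * E.r) := by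
          exact mul_le_mul_of_nonneg_left (hs.trans (by gcongr)) (by positivity)
      _ = _ := by
          rw [← hE.D_mul]
          linear_combination (2 * E.m * E.D * (2 * E.m : ℝ) ^ (1 / p.toReal)) * hsq
  have h2 : ∀ l : List (Fin E.m × Fin E.m),
      ((l.map fun v => E.weight (i : ℕ) (gridOf E.δ Q) v.1 v.2 + 1).sum : ℝ) ≤
        l.length * (2 * E.d + 1) + (l.map fun x => ‖Q x.1 - C i x.2‖).sum *
          (E.d : ℝ) ^ (1 / 2 : ℝ) / E.D := by
    intro l
    induction l with
    | nil => simp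
    | cons v l ih =>
      have := weight_le hE hin i Q v.1 v.2
      simp only [List.map_cons, List.sum_cons, List.length_cons, Nat.cast_add, Nat.cast_one]
      rw [add_mul ‖Q v.1 - C i v.2‖, add_div]
      have e : (E.d : ℝ) ^ (1 / 2 : ℝ) / E.D * ‖Q v.1 - C i v.2‖ =
        ‖Q v.1 - C i v.2‖ * (E.d : ℝ) ^ (1 / 2 : ℝ) / E.D := by ring
      linarith
  have h3 := h2 τ
  have hlen : (τ.length : ℝ) ≤ 2 * E.m := by exact_mod_cast hτ.length_le
  have h4 : (((τ.map fun v => E.weight (i : ℕ) (gridOf E.δ Q) v.1 v.2 + 1).sum : ℕ) : ℝ) ≤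
      8 * (E.m * E.d) := by
    refine h3.trans ?_
    nlinarith [mul_le_mul_of_nonneg_right hlen (show (0 : ℝ) ≤ 2 * E.d + 1 by linarith)]
  exact_mod_cast h4

theorem le_absSum {n m d : ℕ} (C : Fin n → Curve m d) (i : Fin n) (k : Fin m) (j : Fin d) :
    |C i k j| ≤ absSum n m d (input C) := by
  have hj := j.2
  have hk := k.2
  have hi := i.2
  have ht : ((i : ℕ) * m + k) * d + j < n * (m * d) := by
    have h1 : (i : ℕ) * m + k + 1 ≤ n * m := by
      calc (i : ℕ) * m + k + 1 ≤ (i + 1) * m := by rw [add_mul]; omega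
        _ ≤ _ := Nat.mul_le_mul_right _ hi
    calc ((i : ℕ) * m + k) * d + j < ((i : ℕ) * m + k + 1) * d := by rw [add_mul _ 1]; omega
      _ ≤ n * m * d := Nat.mul_le_mul_right _ h1
      _ = _ := mul_assoc _ _ _
  have e1 : (((i : ℕ) * m + k) * d + j) / d = i * m + k := by
    rw [mul_comm, Nat.mul_add_div (by omega), Nat.div_eq_of_lt hj, add_zero]
  have e2 : (((i : ℕ) * m + k) * d + j) % d = j := by
    rw [mul_comm, Nat.mul_add_mod, Nat.mod_eq_of_lt hj]
  have e3 : ((i : ℕ) * m + k) / m = i := by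
    rw [mul_comm, Nat.mul_add_div (by omega), Nat.div_eq_of_lt hk, add_zero]
  have e4 : ((i : ℕ) * m + k) % m = k := by
    rw [mul_comm, Nat.mul_add_mod, Nat.mod_eq_of_lt hk]
  have := Finset.single_le_sum (f := fun t => |input C (t / d / m : ℕ) (t / d % m : ℕ) (t % d : ℕ)|)
    (fun _ _ => abs_nonneg _) (Finset.mem_range.2 ht)
  simp only [e1, e2, e3, e4, input_apply] at this
  exact this

/-- Every vertex of `Q` is matched with a vertex of `C i` at distance at most `r`, so its
coordinates are bounded by the sum of all input coordinates plus `r`. The `2` in `off` leaves room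
for the floors on both sides. -/
theorem inRange_gridOf (hE : E.Good p) (hin : E.inp = input C) {i : Fin E.n} {Q : Curve E.m E.d}
    {τ : List (Fin E.m × Fin E.m)} (hτ : IsAlignment τ) (hr : lpCost p Q (C i) τ ≤ E.r) :
    InRange E.B E.off (gridOf E.δ Q) (E.m * E.d) := by
  intro t ht
  have hδ := hE.δ_pos
  have hd : 0 < E.d := hE.d_pos
  have hj : t / E.d < E.m := Nat.div_lt_of_lt_mul (by rwa [mul_comm])
  obtain ⟨y, hy, hyj⟩ := hτ.exists_mem ⟨t / E.d, hj⟩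
  have h1 : ‖Q y.1 - C i y.2‖ ≤ E.r := (norm_le_lpCost hE.hp Q (C i) hy).trans hr
  set k : Fin E.d := ⟨t % E.d, Nat.mod_lt _ hd⟩ with hk
  have h2 : |Q y.1 k - C i y.2 k| ≤ E.r := (PiLp.norm_apply_le (Q y.1 - C i y.2) k).trans h1
  have h3 : |C i y.2 k| ≤ absSum E.n E.m E.d E.inp := hin ▸ le_absSum C i y.2 k
  have e : gridOf E.δ Q t = ⌊Q y.1 k / E.δ⌋ := by
    rw [← gridOf_apply, hyj]
    congr 1
    simp only [hk]
    rw [mul_comm, Nat.div_add_mod]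
  have h4 : |Q y.1 k| ≤ absSum E.n E.m E.d E.inp + E.r := by
    have := abs_sub_abs_le_abs_sub (Q y.1 k) (C i y.2 k)
    linarith
  have h5 : |Q y.1 k / E.δ| ≤ (absSum E.n E.m E.d E.inp + E.r) / E.δ := by
    rw [abs_div, abs_of_pos hδ]
    gcongr
  rw [abs_le] at h5
  set u := (absSum E.n E.m E.d E.inp + E.r) / E.δ with hu
  have h6 : ⌊Q y.1 k / E.δ⌋ ≤ ⌊u⌋ := Int.floor_le_floor h5.2
  have h7 : -(⌊u⌋ + 1) ≤ ⌊Q y.1 k / E.δ⌋ := by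
    rw [Int.le_floor]
    push_cast
    have := Int.lt_floor_add_one u
    linarith [h5.1]
  rw [e, hE.B_eq, hE.off_eq, ← hu]
  constructor <;> omega

/-- An optimal alignment of `Q` and `C i` is encoded with the rounded query. The digits are counted
with the cost of `Q` itself, whereas the test of the entry sees the rounded curve, which accounts
for the `ε / 2`. -/
theorem codeEntry_complete (hE : E.Good p) (hin : E.inp = input C) (i : Fin E.n)
    (Q : Curve E.m E.d) (h : lpDist p Q (C i) ≤ E.r) :
    InRange E.B E.off (gridOf E.δ Q) (E.m * E.d) ∧ ∃ w < E.N, ∀ z₀,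
      codeEntry E w z₀ = key E.B E.off (gridOf E.δ Q) (E.m * E.d) * E.n' + (i : ℕ) := by
  obtain ⟨τ, hτ, hcost⟩ := exists_lpCost_eq hE.m_pos p Q (C i)
  rw [hcost] at h
  have hrange := inRange_gridOf hE hin hτ h
  refine ⟨hrange, ?_⟩
  have hn' : 0 < E.n' := hE.n_pos.trans hE.n_le
  have hi : (i : ℕ) < E.n' := i.2.trans_le hE.n_le
  have hlen := hτ.length_le
  have hW := weight_sum_le hE hin i Q hτ h
  have hgrid : lpCost p (gridCurve E.m E.d E.δ (gridOf E.δ Q)) (C i) τ ≤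
      (1 + E.ε / 2) * E.r := by
    have h0 : 0 ≤ (E.d : ℝ) ^ (1 / 2 : ℝ) * E.δ := mul_nonneg (by positivity) hE.δ_pos.le
    refine (lpCost_le_add hE.hp hτ h0 (norm_sub_gridCurve_le hE.δ_pos Q)).trans ?_
    have := hE.δ_le
    linarith
  obtain ⟨y, l, rfl⟩ : ∃ y l, τ = y :: l := by
    obtain _ | ⟨y, l⟩ := τ
    · exact absurd rfl hτ.nonempty
    · exact ⟨y, l, rfl⟩
  have hy := hτ.head y (by simp)
  obtain ⟨x, hx, hc⟩ := exists_path hE.M_pos (i : ℕ) (gridOf E.δ Q) l y true E.m hτ.step hτ.last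
    (by simp [hy.1])
  -- The index is the residue modulo `n'` and the path code is the quotient; the bound on `x + 1`,
  -- rather than on `x`, makes room for the residue.
  refine ⟨i + E.n' * x, ?_, fun z₀ => ?_⟩
  · calc (i : ℕ) + E.n' * x < E.n' * (x + 1) := by rw [mul_add]; omega
      _ ≤ _ := by
        rw [hE.N_eq, show 65536 = 4 ^ 8 from rfl, ← pow_mul]
        exact Nat.mul_le_mul_left _ (hx.trans (Nat.mul_le_mul_left _
          (Nat.pow_le_pow_right (by decide) hW)))
  · have e1 : ((i : ℕ) + E.n' * x) % E.n' = i := by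
      rw [Nat.add_mul_mod_self_left, Nat.mod_eq_of_lt hi]
    have e2 : ((i : ℕ) + E.n' * x) / E.n' = x := by
      rw [Nat.add_mul_div_left _ _ hn', Nat.div_eq_of_lt hi, zero_add]
    obtain ⟨ha, hb, hz, hacc⟩ := hc (startCfg E.n' (i + E.n' * x) z₀) (by simp [startCfg, hy.2])
      (by simp [startCfg, hy.1]) rfl (by simp [startCfg, e2]) (by simp [hy.1]) (2 * E.m)
      (by simpa using hlen)
    rw [codeEntry, e1, Cfg.entry, if_pos, key_congr hz]
    refine ⟨ha.ge, hb.ge, i.2, fun t ht => by rw [hz t ht]; exact hrange t ht, ?_⟩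
    rw [hacc, hE.p_eq]
    change accRoot p.toReal (List.foldl (accStep p.toReal) 0 _) ≤ _
    rw [accStep_foldl hE.hp]
    · refine le_of_eq_of_le ?_ hgrid
      rw [lpCost_eq]
      congr 1
      exact List.map_congr_left fun v _ => Par.dist_eq hin i _ _ _
    · intro x hx
      obtain ⟨v, -, rfl⟩ := List.mem_map.1 hx
      exact E.dist_nonneg ..

end

/-! ### Correctness of the answers -/

theorem mkPar_good {n m d ν μ : ℕ} {ε r : ℝ} {p : ℝ≥0∞} (hp : 1 ≤ p) (hn : 1 ≤ n) (hm : 1 ≤ m)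
    (hd : 1 ≤ d) (hε : 0 < ε) (hr : 0 < r) (hν : n ≤ 2 ^ ν) (hμ : 2 ≤ 2 ^ μ * ε)
    (C : Fin n → Curve m d) : (mkPar n m d ν μ ε r p.toReal (input C)).Good p where
  hp := hp
  p_eq := rfl
  n_pos := hn
  m_pos := hm
  d_pos := hd
  n_le := hν
  M_pos := Nat.two_pow_pos μ
  M_ge := by simpa [mkPar] using hμ
  ε_pos := hε
  r_pos := hr
  D_eq := rfl
  δ_eq := rfl
  N_eq := by
    simp only [mkPar]
    rw [← mul_pow, show 65536 = 2 ^ 16 from rfl, ← pow_add, ← pow_mul, ← pow_add]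
    congr 1
    ring
  B_eq := rfl
  off_eq := rfl

theorem gridCurve_congr {m d : ℕ} {δ : ℝ} {z z' : ℕ → ℤ} (h : ∀ t < m * d, z t = z' t) :
    gridCurve m d δ z = gridCurve m d δ z' := by
  funext j
  ext k
  change δ * (z (j * d + k) : ℝ) = δ * (z' (j * d + k) : ℝ)
  rw [h]
  calc (j : ℕ) * d + k < (j + 1) * d := by have := k.2; rw [add_mul]; omega
    _ ≤ _ := Nat.mul_le_mul_right _ j.2

theorem lpDist_le_of_gridCurve {E : Par} {p : ℝ≥0∞} {C : Fin E.n → Curve E.m E.d} (hE : E.Good p)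
    {i : Fin E.n} {Q : Curve E.m E.d} {τ : List (Fin E.m × Fin E.m)} (hτ : IsAlignment τ)
    (h : lpCost p (gridCurve E.m E.d E.δ (gridOf E.δ Q)) (C i) τ ≤ (1 + E.ε / 2) * E.r) :
    lpDist p Q (C i) ≤ (1 + E.ε) * E.r := by
  have h0 : 0 ≤ (E.d : ℝ) ^ (1 / 2 : ℝ) * E.δ := mul_nonneg (by positivity) hE.δ_pos.le
  have h1 := lpCost_le_add (Q := C i) hE.hp hτ h0 fun j => by
    rw [norm_sub_rev]; exact norm_sub_gridCurve_le hE.δ_pos Q j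
  have := hE.δ_le
  have := lpDist_le p Q (C i) hτ
  linarith

theorem mul_add_ediv {u v n' : ℤ} (h0 : 0 ≤ v) (h1 : v < n') : (u * n' + v) / n' = u := by
  rw [mul_comm, Int.mul_add_ediv_left _ _ (by omega), Int.ediv_eq_zero_of_lt h0 h1, add_zero]

/-- Some entry `K * n' + i` exists, so the last entry up to `K * n' + (n' - 1)` lies between these
two and has key `K`. By injectivity of the key its curve is the rounded query, although its index
may differ from `i`. -/
theorem search_correct {E : Par} {p : ℝ≥0∞} {C : Fin E.n → Curve E.m E.d} (hE : E.Good p)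
    (hin : E.inp = input C) {f : ℕ → ℤ} (hs : SortedOn f 0 E.N)
    (hf : ∀ k < E.N, ∃ w < E.N, ∃ z, f k = codeEntry E w z)
    (hf' : ∀ w < E.N, ∃ k < E.N, ∃ z, f k = codeEntry E w z) {Q : Curve E.m E.d} {pos : ℕ}
    (hpos : pos < E.N)
    (hle : pos = 0 ∨ f pos ≤ key E.B E.off (gridOf E.δ Q) (E.m * E.d) * E.n' + (E.n' - 1))
    (hgt : ∀ k, pos < k → k < E.N →
      key E.B E.off (gridOf E.δ Q) (E.m * E.d) * E.n' + (E.n' - 1) < f k) :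
    CorrectAnswer p E.ε E.r C Q (f pos % E.n') := by
  rintro ⟨i, hi⟩
  obtain ⟨hrange, w, hw, hentry⟩ := codeEntry_complete hE hin i Q hi
  obtain ⟨k, hk, z, hkz⟩ := hf' w hw
  rw [hentry] at hkz
  set K := key E.B E.off (gridOf E.δ Q) (E.m * E.d) with hK
  have hn' : (i : ℕ) < (E.n' : ℤ) := by exact_mod_cast i.2.trans_le hE.n_le
  have hK0 : 0 ≤ K := key_nonneg hrange
  have hKn : 0 ≤ K * E.n' := by positivity
  have hkpos : k ≤ pos := by
    by_contra h
    have := hgt k (by omega) hk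
    omega
  have h1 : f k ≤ f pos := hs k pos (Nat.zero_le _) hkpos hpos
  have h2 : f pos ≤ K * E.n' + (E.n' - 1) := by
    rcases hle with h | h
    · obtain rfl : k = pos := by omega
      omega
    · exact h
  have h3 : f pos / E.n' = K := by
    rw [show f pos = K * E.n' + (f pos - K * E.n') by ring]
    exact mul_add_ediv (by omega) (by omega)
  obtain ⟨w', -, z', hz'⟩ := hf pos hpos
  -- The value `-1` is excluded since the entry found is at least `f k ≥ 0`.
  rcases codeEntry_sound hE hin w' z' with h | ⟨j, y, τ, hτ, hy, hcost, h⟩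
  · omega
  have hj : (j : ℕ) < (E.n' : ℤ) := by exact_mod_cast j.2.trans_le hE.n_le
  rw [← hz'] at h
  rw [h, mul_add_ediv (by omega) hj] at h3
  refine ⟨j, ?_, ?_⟩
  · rw [h, add_comm, Int.add_mul_emod_self_right, Int.emod_eq_of_lt (by omega) hj]
  · rw [gridCurve_congr (key_injective hy hrange h3)] at hcost
    exact lpDist_le_of_gridCurve hE hτ hcost

/-! ## The bounds -/

/-- The factor 2 is admissible because `log 2 > 1 / 2`. -/
theorem nat_le_of_two_pow_le {k : ℕ} {x : ℝ} (h : (2 : ℝ) ^ k ≤ x) : (k : ℝ) ≤ 2 * Real.log x := by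
  have h1 := Real.log_le_log (by positivity) h
  rw [Real.log_pow] at h1
  have h2 := Real.log_two_gt_d9
  have : (0 : ℝ) ≤ k := k.cast_nonneg
  nlinarith

theorem log_size_le {n k ν μ : ℕ} {ε : ℝ} (hn : 1 ≤ n) (hk : 1 ≤ k) (hε : 0 < ε) (hε1 : ε ≤ 1)
    (hν : 2 ^ ν ≤ 2 * n) (hμ : 2 ^ μ * ε ≤ 4) :
    ((ν + k * (μ + 16) : ℕ) : ℝ) ≤ 30 * (k * (1 + Real.log (n / ε))) := by
  have hn' : (1 : ℝ) ≤ n := by exact_mod_cast hn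
  have hk' : (1 : ℝ) ≤ k := by exact_mod_cast hk
  have hl2 : Real.log 2 ≤ 1 := by have := Real.log_two_lt_d9; linarith
  have h1 : (ν : ℝ) ≤ 2 * Real.log (2 * n) := nat_le_of_two_pow_le (by exact_mod_cast hν)
  have h2 : (μ : ℝ) ≤ 2 * Real.log (4 / ε) := nat_le_of_two_pow_le (by rwa [le_div_iff₀ hε])
  rw [Real.log_mul (by norm_num) (by linarith)] at h1
  rw [Real.log_div (by norm_num) hε.ne', show (4 : ℝ) = 2 ^ 2 by norm_num, Real.log_pow] at h2
  rw [Real.log_div (by linarith) hε.ne']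
  have h3 : 0 ≤ Real.log n := Real.log_nonneg hn'
  have h4 : Real.log ε ≤ 0 := Real.log_nonpos hε.le hε1
  push_cast at h2 ⊢
  have h5 : (ν : ℝ) ≤ k * (2 + 2 * Real.log n) := by nlinarith
  have h6 : (k : ℝ) * (μ + 16) ≤ k * (20 - 2 * Real.log ε) := by
    gcongr
    linarith
  have h7 : (k : ℝ) * (2 + 2 * Real.log n) + k * (20 - 2 * Real.log ε) ≤
      k * (30 * (1 + (Real.log n - Real.log ε))) := by
    rw [← mul_add]
    gcongr
    linarith
  linarith

/-- Here `262144 = 4 * 2 ^ 16`, from `M ≤ 4 / ε` and the `4 ^ 8` displacement codes per coordinate.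
-/
theorem size_le {n k ν μ : ℕ} {ε : ℝ} (hε : 0 < ε) (hν : 2 ^ ν ≤ 2 * n) (hμ : 2 ^ μ * ε ≤ 4) :
    ((2 ^ (ν + k * (μ + 16)) : ℕ) : ℝ) ≤ 2 * n * (262144 / ε) ^ k := by
  have h1 : (2 : ℝ) ^ μ * 2 ^ 16 ≤ 262144 / ε := by
    rw [le_div_iff₀ hε]
    linarith
  have h2 : (2 : ℝ) ^ ν ≤ 2 * n := by exact_mod_cast hν
  push_cast
  rw [pow_add, mul_comm k, pow_mul, pow_add]
  gcongr

theorem time_le {n m d H N t : ℕ} (hN : n ≤ N) (hH : 1 ≤ H) (hn : 1 ≤ n) (hm : 1 ≤ m) (hd : 1 ≤ d)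
    (ht : t ≤ (H + n * (m * d)) * 100 + H * (N * 120 + 50) +
      N * (2 * m * (d * (40 * H + 120) + 140) + (m * d) * 50 + 230) + 500) :
    t ≤ 2000 * (N * ((m * d) * H)) := by
  have hmd : m ≤ m * d := Nat.le_mul_of_pos_right _ hd
  have e : 2 * m * (d * (40 * H + 120) + 140) = 80 * (m * d * H) + 240 * (m * d) + 280 * m := by ring
  rw [e] at ht
  clear e
  have hk : 1 ≤ m * d := by omega
  generalize m * d = k at *
  have h1 : k ≤ k * H := Nat.le_mul_of_pos_right _ hH
  have h2 : H ≤ k * H := Nat.le_mul_of_pos_left _ hk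
  generalize k * H = P at *
  have h3 : N * (80 * P + 240 * k + 280 * m + k * 50 + 230) ≤ N * (880 * P) :=
    Nat.mul_le_mul_left _ (by omega)
  have h4 : n * k ≤ N * P := Nat.mul_le_mul hN h1
  have h5 : H * N ≤ N * P := by rw [mul_comm]; exact Nat.mul_le_mul_left _ h2
  have h6 : P ≤ N * P := Nat.le_mul_of_pos_left _ (by omega)
  have e1 : H * (N * 120 + 50) = 120 * (H * N) + 50 * H := by ring
  have e2 : N * (880 * P) = 880 * (N * P) := by ring
  have e3 : (H + n * k) * 100 = 100 * H + 100 * (n * k) := by ring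
  rw [e1, e3] at ht
  rw [e2] at h3
  omega

/-- Both `c ≤ c ^ k` and `k ^ 2 ≤ 4 ^ k` can be moved into the base, and the exponent may grow
because the base `A / ε` is at least 1. -/
theorem pow_absorb {c k l : ℕ} {A B ε : ℝ} (hε : 0 < ε) (hε1 : ε ≤ 1) (hB : 1 ≤ B) (hk : 1 ≤ k)
    (hl : k ≤ l) (hc : 1 ≤ c) (hA : c * 4 * B ≤ A) :
    c * (k : ℝ) ^ 2 * (B / ε) ^ k ≤ (A / ε) ^ l := by
  have hc' : (1 : ℝ) ≤ c := by exact_mod_cast hc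
  have h1 : (c : ℝ) ≤ c ^ k := le_self_pow₀ hc' (by omega)
  have h2 : (k : ℝ) ^ 2 ≤ 4 ^ k := by
    have : (k : ℝ) ≤ 2 ^ k := by exact_mod_cast Nat.lt_two_pow_self.le
    calc (k : ℝ) ^ 2 ≤ (2 ^ k) ^ 2 := by gcongr
      _ = 4 ^ k := by rw [← pow_mul, mul_comm, pow_mul]; norm_num
  calc c * (k : ℝ) ^ 2 * (B / ε) ^ k ≤ c ^ k * 4 ^ k * (B / ε) ^ k := by gcongr
    _ = (c * 4 * B / ε) ^ k := by rw [← mul_pow, ← mul_pow, mul_div_assoc]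
    _ ≤ (A / ε) ^ k := by gcongr
    _ ≤ (A / ε) ^ l := by
        refine pow_le_pow_right₀ ?_ hl
        rw [one_le_div hε]
        nlinarith

end ANNC

/-! ### The data structure with its bounds -/

theorem theoremB3 :
    ∃ (preprocess query : ANNC.Prog) (A : ℝ), 0 < A ∧
      ∀ (p : ℝ≥0∞), 1 ≤ p →
      ∀ (n m d : ℕ), 1 ≤ n → 1 ≤ m → 1 ≤ d →
      ∀ (ε r : ℝ), 0 < ε → ε ≤ 1 → 0 < r →
      ∀ (C : Fin n → ANNC.Curve m d),
      ∃ (S t : ℕ) (s : ANNC.State),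
        -- space
        (S : ℝ) ≤ n * (A / ε) ^ (m * (d + 1)) ∧
        -- preprocessing
        ANNC.Exec S preprocess (ANNC.initState p ε r C) t s ∧
        (t : ℝ) ≤ n * (1 + Real.log (n / ε)) * (A / ε) ^ (m * (d + 1)) ∧
        -- queries
        ∀ (Q : ANNC.Curve m d),
        ∃ (t' : ℕ) (s' : ANNC.State),
          ANNC.Exec S query (ANNC.queryState s Q) t' s' ∧
          (t' : ℝ) ≤ A * (m * d * (1 + Real.log (n * m * d / ε))) ∧
          ANNC.CorrectAnswer p ε r C Q (s'.ireg 0) ∧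
          -- the data structure survives the query
          s'.imem = s.imem ∧ s'.rmem = s.rmem := by
  -- By `pow_absorb` the constant has to be at least `4 * 262144 * c`; this value admits every `c ≤
  -- 900000`.
  refine ⟨ANNC.preprocess, ANNC.query, 10 ^ 12, by norm_num, ?_⟩
  intro p hp n m d hn hm hd ε r hε hε1 hr C
  have hmd : 1 ≤ m * d := Nat.mul_pos hm hd
  obtain ⟨ν, μ, H, S, hν, hν', hμ, hμ', hH, hS, t, s, hexec, ht, hbuilt⟩ :=
    ANNC.preprocess_run (s := ANNC.initState p ε r C) (n := n) (m := m) (d := d) (ε := ε) (r := r)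
      (p := p.toReal) (q := ANNC.input C) rfl rfl rfl rfl rfl rfl rfl hn hmd hε hε1
  have hE := ANNC.mkPar_good hp hn hm hd hε hr hν hμ C
  set E := ANNC.mkPar n m d ν μ ε r p.toReal (ANNC.input C) with hEdef
  have hlog := ANNC.log_size_le hn hmd hε hε1 hν' hμ'
  have hsize := ANNC.size_le (k := m * d) hε hν' hμ'
  rw [← hH] at hlog hsize
  have hn1 : (1 : ℝ) ≤ n := by exact_mod_cast hn
  have hk1 : (1 : ℝ) ≤ (m * d : ℕ) := by exact_mod_cast hmd
  have hL : 0 ≤ Real.log (n / ε) := Real.log_nonneg (by rw [one_le_div hε]; linarith)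
  have hkl : m * d ≤ m * (d + 1) := Nat.mul_le_mul_left _ (Nat.le_succ _)
  have hX : (1 : ℝ) ≤ (262144 / ε) ^ (m * d) :=
    one_le_pow₀ (by rw [one_le_div hε]; linarith)
  have habs : ∀ c : ℕ, 1 ≤ c → c ≤ 900000 →
      c * ((m * d : ℕ) : ℝ) ^ 2 * (262144 / ε) ^ (m * d) ≤ (10 ^ 12 / ε) ^ (m * (d + 1)) := by
    intro c hc hc'
    have : (c : ℝ) ≤ 900000 := by exact_mod_cast hc'
    exact ANNC.pow_absorb hε hε1 (by norm_num) hmd hkl hc (by linarith)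
  set X : ℝ := (262144 / ε) ^ (m * d) with hXdef
  set k : ℕ := m * d with hkdef
  refine ⟨S, t, s, ?_, hexec, ?_, ?_⟩
  · have h1 : (S : ℝ) ≤ 9 + k + 2 * (2 * n * X) := by
      rw [hS]
      push_cast at hsize ⊢
      linarith
    -- `14 = 9 + 1 + 4`, the coefficients of the three terms of `h1`, each compared with `n * k ^ 2
    -- * X`.
    calc (S : ℝ) ≤ n * ((14 : ℕ) * (k : ℝ) ^ 2 * X) := by
          have h2 : (k : ℝ) ≤ n * (k ^ 2 * X) := by
            have : (k : ℝ) ≤ k ^ 2 := by nlinarith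
            nlinarith [mul_le_mul hn1 (mul_le_mul this hX zero_le_one (by positivity)) (by positivity) (by positivity)]
          have h3 : n * X ≤ n * (k ^ 2 * X) := by
            gcongr
            exact le_mul_of_one_le_left (by positivity) (one_le_pow₀ hk1)
          push_cast
          linarith
      _ ≤ _ := by gcongr; exact habs 14 (by norm_num) (by norm_num)
  · have hH1 : 1 ≤ H := by rw [hH]; nlinarith
    have hnN : n ≤ 2 ^ H := hν.trans (Nat.pow_le_pow_right (by norm_num) (by omega))
    have h1 := ANNC.time_le hnN hH1 hn hm hd ht
    have h2 : (t : ℝ) ≤ 2000 * ((2 ^ H : ℕ) * (k * H)) := by exact_mod_cast h1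
    calc (t : ℝ) ≤ 2000 * ((2 ^ H : ℕ) * (k * H)) := h2
      _ ≤ 2000 * ((2 * n * X) * (k * (30 * (k * (1 + Real.log (n / ε)))))) := by gcongr
      -- `120000 = 2000 * 2 * 30`; one factor `k` comes from the decoding, the other from the bound
      -- on `H`.
      _ = n * (1 + Real.log (n / ε)) * ((120000 : ℕ) * (k : ℝ) ^ 2 * X) := by push_cast; ring
      _ ≤ _ := by gcongr; exact habs 120000 (by norm_num) (by norm_num)
  · intro Q
    obtain ⟨base, f, hh, hbase, hf, hsort, hsound, hcomplete⟩ := hbuilt.exists_array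
    have hN : E.N = 2 ^ H := by rw [hH]; rfl
    obtain ⟨t', s', ⟨hexec', ht', pos, hpos, hans, hle, hgt⟩⟩ :=
      ANNC.query_run (s := ANNC.queryState s Q)
        ⟨hh.m, hh.d, hh.n', hh.N, hh.off, hh.base, hh.δ⟩ hbase (by omega) hf hsort
    have hframe := hexec'.frame
    refine ⟨t', s', hexec', ?_, ?_, hframe.imem (by decide), hframe.rmem (by decide)⟩
    · have h1 : (t' : ℝ) ≤ k * 50 + H * 40 + 200 := by exact_mod_cast ht'
      have h2 : Real.log (n / ε) ≤ Real.log (n * m * d / ε) := by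
        refine Real.log_le_log (by positivity) ?_
        gcongr
        rw [mul_assoc]
        exact le_mul_of_one_le_right (by positivity) (by exact_mod_cast hmd)
      have h3 : (k : ℝ) ≤ k * (1 + Real.log (n / ε)) :=
        le_mul_of_one_le_right (by positivity) (by linarith)
      calc (t' : ℝ) ≤ 10 ^ 12 * (k * (1 + Real.log (n / ε))) := by linarith
        _ ≤ 10 ^ 12 * (k * (1 + Real.log (n * m * d / ε))) := by gcongr
        _ = _ := by rw [hkdef]; push_cast; ring
    · rw [hans]
      rw [← hN] at hpos hgt hsort hsound hcomplete
      exact ANNC.search_correct hE rfl hsort hsound hcomplete hpos hle hgt
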